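/- For positive integers $n,m,k$ put $N=\binom n2$. The null distribution $\mathbb P_0$ is the Erdős–Rényi model $G(n,m)$, i.e. the uniform distribution over graphs on $n$ labelled vertices with exactly $m$ edges. The planted distribution $\mathbb P_1$ is the law of the graph obtained by choosing a hub vertex uniformly at random, then $k$ uniformly random edges incident to the hub, then $m-k$ uniformly random edges among the remaining $N-k$ pairs, and taking the union. Let $\Lambda=\frac{d\mathbb P_1}{d\mathbb P_0}$ be the likelihood ratio and $\Delta(G)$ the maximum degree. Fix $\gamma\in\mathbb R$ and $\alpha>1$. Let $k=k(n)$ satisfy $(\log n)^2\ll k\ll\sqrt n$, let $$m=m(n)=\frac{k^2n}{4\log n}\Bigl(1+\frac{\gamma}{\sqrt{\log n}}\Bigr)$$ (rounded to an integer, in an arbitrary way, i.e. with an error of at most $1$), and set $$t^*=\frac{2m}{n}+\sqrt{\frac{2m}{n}\Bigl(1-\frac mN\Bigr)}\,\sqrt{2\log n-\frac1\alpha\log\log n}.$$ Then, as $n\to\infty$, the probability of the symmetric difference of the events $\{\Lambda(G)\ge 1\}$ and $\{\Delta(G)\ge t^*\}$ tends to $0$ under $\mathbb P_0$ and under $\mathbb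 P_1$. Consequently the maximum-degree test, which rejects $\mathbb P_0$ when $\Delta(G)\ge t^*$, is asymptotically optimal: its sum of Type-I and Type-II errors $\mathbb P_0(\Delta\ge t^*)+\mathbb P_1(\Delta<t^*)$ exceeds the minimum of $\mathbb P_0(R)+\mathbb P_1(R^c)$ over all rejection regions $R$ by at most $o(1)$. Moreover the test is efficiently computable, so there is no statistical-to-computational gap: there is a single program of a counter machine (with increments, copies, comparisons, bounded loops and adjacency queries, each at unit cost) that on input of any graph $G$ on $n$ vertices and the integer $\max(\lceil t\rceil,0)$, for any real $t$, decides whether $\Delta(G)\ge t$ in $O((n+1)^2)$ steps. -/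

import Mathlib

open MeasureTheory ProbabilityTheory Filter Asymptotics
open scoped Topology ENNReal

namespace PlantedStar

/-- The null distribution `G(n,m)`: uniform over all graphs on `n` vertices with `m` edges. -/
noncomputable def nullDist (n m : ℕ) : Measure (SimpleGraph (Fin n)) :=
  uniformOn {G | G.edgeSet.ncard = m}

/-- The `k`-stars with hub `v`, as graphs on `n` vertices: exactly `k` edges, all incident to `v`. -/
def stars (n k : ℕ) (v : Fin n) : Set (SimpleGraph (Fin n)) :=
  {S | (∀ e ∈ S.edgeSet, v ∈ e) ∧ S.edgeSet.ncard = k}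

/-- The graphs with `m - k` edges, none of which belongs to the planted star `S`. -/
def backgrounds (n k m : ℕ) (S : SimpleGraph (Fin n)) : Set (SimpleGraph (Fin n)) :=
  {H | Disjoint H S ∧ H.edgeSet.ncard = m - k}

/-- The planted distribution: choose a hub `v` uniformly, then `k` uniformly random edges incident
to `v`, then `m - k` uniformly random edges among the remaining ones, and take the union. -/
noncomputable def plantedDist (n k m : ℕ) : Measure (SimpleGraph (Fin n)) :=
  (uniformOn (Set.univ : Set (Fin n))).bind fun v =>
    (uniformOn (stars n k v)).bind fun S =>
      (uniformOn (backgrounds n k m S)).map fun H => S ⊔ H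

/-- The likelihood ratio `Λ = dP₁/dP₀`. -/
noncomputable def likelihoodRatio (n k m : ℕ) : SimpleGraph (Fin n) → ℝ≥0∞ :=
  (plantedDist n k m).rnDeriv (nullDist n m)

open scoped Classical in
/-- The maximum degree `Δ(G)`. -/
noncomputable def maxDeg {n : ℕ} (G : SimpleGraph (Fin n)) : ℕ := G.maxDegree

/-- The threshold `t* = 2m/n + √((2m/n)(1 - m/N)) √(2 log n - (1/α) log log n)`, `N = n choose 2`. -/
noncomputable def threshold (α : ℝ) (n m : ℕ) : ℝ :=
  2 * m / n + √(2 * m / n * (1 - m / (n.choose 2 : ℝ))) *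
    √(2 * Real.log n - 1 / α * Real.log (Real.log n))

/-- Rejection region of the likelihood-ratio test: `{Λ ≥ 1}`. -/
def lrRegion (n k m : ℕ) : Set (SimpleGraph (Fin n)) := {G | 1 ≤ likelihoodRatio n k m G}

/-- Rejection region of the maximum-degree test: `{Δ ≥ t*}`. -/
def maxDegRegion (α : ℝ) (n m : ℕ) : Set (SimpleGraph (Fin n)) :=
  {G | threshold α n m ≤ (maxDeg G : ℝ)}

/-- Sum of the Type-I and Type-II errors of the test that rejects the null hypothesis on `R`. -/
noncomputable def testError (n k m : ℕ) (R : Set (SimpleGraph (Fin n))) : ℝ :=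
  (nullDist n m).real R + (plantedDist n k m).real Rᶜ

/-- Programs of a counter machine with registers indexed by `ℕ` holding natural numbers, with query
access to the adjacency matrix of the input graph. -/
inductive Program where
  | zero (x : ℕ)
  | succ (x : ℕ)
  | copy (x y : ℕ)
  | seq (p q : Program)
  | ifAdj (x y : ℕ) (p : Program)
  | ifLe (x y : ℕ) (p : Program)
  | loop (x : ℕ) (p : Program)

open scoped Classical in
/-- `exec adj p r` is the pair (final registers, number of elementary steps) of the run of `p`
started in registers `r`. Assignments, tests and loop iterations cost one step each;
`loop x p` repeats `p` as many times as the value of register `x` on entry. The only arithmetic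
is the increment, so values exceed the inputs by at most the number of steps. -/
noncomputable def exec (adj : ℕ → ℕ → Prop) : Program → (ℕ → ℕ) → (ℕ → ℕ) × ℕ
  | .zero x, r => (Function.update r x 0, 1)
  | .succ x, r => (Function.update r x (r x + 1), 1)
  | .copy x y, r => (Function.update r x (r y), 1)
  | .seq p q, r =>
      ((exec adj q (exec adj p r).1).1, (exec adj p r).2 + (exec adj q (exec adj p r).1).2)
  | .ifAdj x y p, r => if adj (r x) (r y) then ((exec adj p r).1, (exec adj p r).2 + 1) else (r, 1)
  | .ifLe x y p, r => if r x ≤ r y then ((exec adj p r).1, (exec adj p r).2 + 1) else (r, 1)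
  | .loop x p, r =>
      (fun s : (ℕ → ℕ) × ℕ => ((exec adj p s.1).1, s.2 + (exec adj p s.1).2 + 1))^[r x] (r, 1)

/-- Run `p` on a graph `G` on `n` vertices and a number `T`: register `0` initially holds `n`,
register `1` holds `T`, and all others hold `0`. -/
noncomputable def runOn (p : Program) {n : ℕ} (G : SimpleGraph (Fin n)) (T : ℕ) : (ℕ → ℕ) × ℕ :=
  exec (fun i j => ∃ (hi : i < n) (hj : j < n), G.Adj ⟨i, hi⟩ ⟨j, hj⟩) p
    (fun x => if x = 0 then n else if x = 1 then T else 0)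

/-- The program accepts if register `2` finally holds `1`. -/
def Accepts (p : Program) {n : ℕ} (G : SimpleGraph (Fin n)) (T : ℕ) : Prop :=
  (runOn p G T).1 2 = 1

/-- The number of steps of the run. -/
noncomputable def steps (p : Program) {n : ℕ} (G : SimpleGraph (Fin n)) (T : ℕ) : ℕ :=
  (runOn p G T).2

end PlantedStar

/-!
Conditioning on the hub shows that the likelihood ratio is an average over the vertices,
`Λ(G) = (1/n) ∑ᵥ λ(deg v)` with `λ(j) = C(j,k) C(N,m) / (C(n-1,k) C(N-k,m-k))` (`hubRatio`,
`plantedDist_eq_withDensity`). Let `T = ⌈t*⌉` and let `Λ'` be the same average with `λ` cut off at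
degrees `≥ T`. Since `Λ = Λ'` on `{Δ < T}`, everything follows from three estimates.

* *Null tail*: `P₀(Δ ≥ T) → 0`. On `{Δ ≥ T} ∖ {Λ ≥ 1}` the planted law is dominated by the null law,
  so this settles that half of the symmetric difference under both laws.
* *Truncated second moment*: `Var₀ Λ' → 0`.
* *Gap*: `E₀ Λ'`, the planted probability that the hub has degree below `T`, is at most `1 - δ`.

On `{Λ ≥ 1} ∖ {Δ ≥ T}` one has `Λ' ≥ 1`, so that Chebyshev's inequality bounds the other half under
the null law, and `Λ' ≤ ((Λ' - E₀ Λ') / (1 - E₀ Λ'))²` there bounds it under the planted law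
(`nullDist_symmDiff_le`, `plantedDist_symmDiff_le`). Near-optimality of the degree test is then the
Neyman–Pearson lemma (`testError_le`).

For the estimates, the law of a degree reweighted by `λ` is that of `k` plus a hypergeometric
variable (`degPmf_mul_hubRatio`). The ratios of consecutive hypergeometric probabilities are
explicit, which gives a local bound of order `1/√d`, `d = 2m/n`, for each of them (`hyperPmf_le`) and
a lower bound for upper tails (`exists_le_sum_hyperPmf`); the latter is the gap, because `t*` exceeds
the mean hub degree by `O(√d)` only. The local bound reduces the null tail to
`(n/√d) ∑_{j ≥ T} 1/λ(j)` and the diagonal part of the variance to `(1/(n√d)) ∑_{j < T} λ(j)`, sums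
of binomial coefficients with closed forms, and with `s = k/√d` and
`x = √(2 log n - log log n / α)` one finds
`log λ(T) = x²/2 - (s - x)²/2 + O(1) = log n - log log n / (2α) + O(1)`
(`Regime.exponent_bounds`). The local bound contributes a factor of order `1/√(log n)` to both
quantities, so that both vanish because `α > 1`. The off-diagonal part of the variance is
negligible because the joint law of two degrees is at most `1 + o(1)` times the product law,
uniformly over all degrees below `T` (`degPairPmf_le`).
-/

namespace PlantedStar

/-! ### The counter-machine program -/

/-- Inner loop body: if the vertices in registers `3` and `4` are adjacent, increment the counter in
register `5`; then move on to the next value of register `4`. -/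
def countStep : Program := .seq (.ifAdj 3 4 (.succ 5)) (.succ 4)

/-- Outer loop body: count in register `5` the neighbours of the vertex in register `3`, accept in
register `2` if there are at least as many as register `1` says, and go to the next vertex. -/
def vertexStep : Program :=
  .seq (.zero 4) <| .seq (.zero 5) <| .seq (.loop 0 countStep) <|
    .seq (.ifLe 1 5 (.seq (.zero 2) (.succ 2))) (.succ 3)

/-- The program that tests whether some degree is at least the number in register `1`. The test
against the empty register `6` deals with the threshold `0`, which also the empty graph meets. -/
def maxDegProgram : Program :=
  .seq (.ifLe 1 6 (.succ 2)) (.loop 0 vertexStep)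

open scoped Classical in
lemma exec_countStep_fst (adj : ℕ → ℕ → Prop) (r : ℕ → ℕ) :
    (exec adj countStep r).1 =
      Function.update (Function.update r 5 (if adj (r 3) (r 4) then r 5 + 1 else r 5))
        4 (r 4 + 1) := by
  by_cases h : adj (r 3) (r 4) <;> simp [countStep, exec, h]

lemma exec_countStep_snd (adj : ℕ → ℕ → Prop) (r : ℕ → ℕ) :
    (exec adj countStep r).2 ≤ 3 := by
  by_cases h : adj (r 3) (r 4) <;> simp [countStep, exec, h]

/-- The number of `j < l` adjacent to `i`. -/
noncomputable def countAdj (adj : ℕ → ℕ → Prop) (i l : ℕ) : ℕ :=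
  open scoped Classical in ((Finset.range l).filter (adj i)).card

lemma countAdj_succ (adj : ℕ → ℕ → Prop) (i l : ℕ) :
    open scoped Classical in
    countAdj adj i (l + 1) = if adj i l then countAdj adj i l + 1 else countAdj adj i l := by
  classical
  unfold countAdj
  rw [Finset.range_add_one, Finset.filter_insert]
  split_ifs <;> simp

lemma loop_countStep (adj : ℕ → ℕ → Prop) (r : ℕ → ℕ) (h4 : r 4 = 0) (h5 : r 5 = 0) (l : ℕ) :
    let s := (fun s : (ℕ → ℕ) × ℕ =>
      ((exec adj countStep s.1).1, s.2 + (exec adj countStep s.1).2 + 1))^[l] (r, 1)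
    (∀ x, x ≠ 4 → x ≠ 5 → s.1 x = r x) ∧ s.1 4 = l ∧ s.1 5 = countAdj adj (r 3) l ∧
      s.2 ≤ 4 * l + 1 := by
  induction l with
  | zero => simp [h4, h5, countAdj]
  | succ l ih =>
    obtain ⟨i1, i2, i3, i4⟩ := ih
    rw [Function.iterate_succ_apply']
    set s := (fun s : (ℕ → ℕ) × ℕ =>
      ((exec adj countStep s.1).1, s.2 + (exec adj countStep s.1).2 + 1))^[l] (r, 1) with hs
    refine ⟨fun x hx hx' => ?_, ?_, ?_, ?_⟩
    · simp [exec_countStep_fst, hx, hx', i1 x hx hx']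
    · simp [exec_countStep_fst, i2]
    · simp [exec_countStep_fst, i3, countAdj_succ]
      rw [i2, i1 3 (by simp) (by simp)]
    · have := exec_countStep_snd adj s.1
      simp only
      omega

lemma exec_vertexStep (adj : ℕ → ℕ → Prop) (r : ℕ → ℕ) :
    let s := exec adj vertexStep r
    s.1 0 = r 0 ∧ s.1 1 = r 1 ∧ s.1 2 = (if r 1 ≤ countAdj adj (r 3) (r 0) then 1 else r 2) ∧
      s.1 3 = r 3 + 1 ∧ s.2 ≤ 4 * r 0 + 7 := by
  set r' := Function.update (Function.update r 4 0) 5 0 with hr'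
  obtain ⟨i1, i2, i3, i4⟩ := loop_countStep adj r' (by simp [hr']) (by simp [hr']) (r 0)
  have hr0 : r' 0 = r 0 := by simp [hr']
  have hr1 : r' 1 = r 1 := by simp [hr']
  have hr2 : r' 2 = r 2 := by simp [hr']
  have hr3 : r' 3 = r 3 := by simp [hr']
  simp only [vertexStep, exec, ← hr', hr0]
  set s := (fun s : (ℕ → ℕ) × ℕ =>
      ((exec adj countStep s.1).1, s.2 + (exec adj countStep s.1).2 + 1))^[r 0] (r', 1) with hs
  have e1 : s.1 1 = r 1 := by rw [i1 1 (by simp) (by simp), hr1]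
  have e0 : s.1 0 = r 0 := by rw [i1 0 (by simp) (by simp), hr0]
  have e2 : s.1 2 = r 2 := by rw [i1 2 (by simp) (by simp), hr2]
  have e3 : s.1 3 = r 3 := by rw [i1 3 (by simp) (by simp), hr3]
  rw [hr3] at i3
  by_cases h : r 1 ≤ countAdj adj (r 3) (r 0)
  · simp [e0, e1, e3, i3, h]; omega
  · simp [e0, e1, e2, e3, i3, h]; omega

lemma loop_vertexStep (adj : ℕ → ℕ → Prop) (r : ℕ → ℕ) (h3 : r 3 = 0) (l : ℕ) :
    let s := (fun s : (ℕ → ℕ) × ℕ =>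
      ((exec adj vertexStep s.1).1, s.2 + (exec adj vertexStep s.1).2 + 1))^[l] (r, 1)
    s.1 0 = r 0 ∧ s.1 1 = r 1 ∧ s.1 3 = l ∧
      (s.1 2 = 1 ↔ r 2 = 1 ∨ ∃ i < l, r 1 ≤ countAdj adj i (r 0)) ∧
      s.2 ≤ (4 * r 0 + 8) * l + 1 := by
  induction l with
  | zero => simp [h3]
  | succ l ih =>
    obtain ⟨i0, i1, i2, i3, i4⟩ := ih
    rw [Function.iterate_succ_apply']
    set s := (fun s : (ℕ → ℕ) × ℕ =>
      ((exec adj vertexStep s.1).1, s.2 + (exec adj vertexStep s.1).2 + 1))^[l] (r, 1) with hs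
    obtain ⟨j0, j1, j2, j3, j4⟩ := exec_vertexStep adj s.1
    rw [i0, i1, i2] at j2
    refine ⟨by simp [j0, i0], by simp [j1, i1], by simp [j3, i2], ?_, ?_⟩
    · simp only [j2]
      simp only [Nat.lt_succ_iff_lt_or_eq, or_and_right, exists_or, exists_eq_left]
      by_cases h : r 1 ≤ countAdj adj l (r 0)
      · simp [h]
      · simp [h, i3]
    · rw [i0] at j4
      simp only
      rw [Nat.mul_succ]
      omega

lemma countAdj_eq_degree {n : ℕ} (G : SimpleGraph (Fin n)) [DecidableRel G.Adj] (v : Fin n) :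
    countAdj (fun i j => ∃ (hi : i < n) (hj : j < n), G.Adj ⟨i, hi⟩ ⟨j, hj⟩) v n = G.degree v := by
  classical
  unfold countAdj
  rw [← SimpleGraph.card_neighborFinset_eq_degree,
    ← Finset.card_map Fin.valEmbedding (s := G.neighborFinset v)]
  congr 1
  ext j
  simp only [Finset.mem_filter, Finset.mem_range, Finset.mem_map, SimpleGraph.mem_neighborFinset,
    Fin.valEmbedding_apply, Fin.is_lt, Fin.eta, exists_true_left]
  constructor
  · rintro ⟨_, hj, h⟩
    exact ⟨⟨j, hj⟩, h, rfl⟩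
  · rintro ⟨j, h, rfl⟩
    exact ⟨j.2, j.2, h⟩

lemma le_maxDeg_iff {n : ℕ} (G : SimpleGraph (Fin n)) [DecidableRel G.Adj] (T : ℕ) :
    T ≤ maxDeg G ↔ T = 0 ∨ ∃ v, T ≤ G.degree v := by
  classical
  have hm : maxDeg G = G.maxDegree := by unfold maxDeg; congr!
  rw [hm]
  constructor
  · intro h
    by_cases hT : T = 0
    · exact Or.inl hT
    rcases isEmpty_or_nonempty (Fin n) with hn | hn
    · simp at h
      exact Or.inl h
    · obtain ⟨v, hv⟩ := G.exists_maximal_degree_vertex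
      exact Or.inr ⟨v, hv ▸ h⟩
  · rintro (rfl | ⟨v, hv⟩)
    · exact Nat.zero_le _
    · exact hv.trans (G.degree_le_maxDegree v)

/-- One program decides all maximum-degree tests in quadratic time. -/
theorem exists_maxDeg_program :
    ∃ (p : Program) (C : ℕ), ∀ (n : ℕ) (G : SimpleGraph (Fin n)) (t : ℝ),
      (Accepts p G ⌈t⌉₊ ↔ t ≤ (maxDeg G : ℝ)) ∧ steps p G ⌈t⌉₊ ≤ C * (n + 1) ^ 2 := by
  classical
  refine ⟨maxDegProgram, 20, fun n G t => ?_⟩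
  rw [← Nat.ceil_le]
  generalize ⌈t⌉₊ = T
  rw [le_maxDeg_iff]
  set adj : ℕ → ℕ → Prop := fun i j => ∃ (hi : i < n) (hj : j < n), G.Adj ⟨i, hi⟩ ⟨j, hj⟩ with hadj
  set r0 : ℕ → ℕ := fun x => if x = 0 then n else if x = 1 then T else 0 with hr0
  set r : ℕ → ℕ := (exec adj (.ifLe 1 6 (.succ 2)) r0).1 with hr
  have hst : (exec adj (.ifLe 1 6 (.succ 2)) r0).2 ≤ 2 := by
    by_cases hT : T = 0 <;> simp [exec, hr0, hT]
  have hn0 : r 0 = n := by by_cases hT : T = 0 <;> simp [hr, exec, hr0, hT]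
  have hn1 : r 1 = T := by by_cases hT : T = 0 <;> simp [hr, exec, hr0, hT]
  have hn2 : r 2 = 1 ↔ T = 0 := by by_cases hT : T = 0 <;> simp [hr, exec, hr0, hT]
  have hn3 : r 3 = 0 := by by_cases hT : T = 0 <;> simp [hr, exec, hr0, hT]
  obtain ⟨-, -, -, h2, h3⟩ := loop_vertexStep adj r hn3 (r 0)
  have key : runOn maxDegProgram G T = ((exec adj (.loop 0 vertexStep) r).1,
      (exec adj (.ifLe 1 6 (.succ 2)) r0).2 + (exec adj (.loop 0 vertexStep) r).2) := rfl
  constructor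
  · rw [Accepts, key]
    simp only [exec]
    rw [h2, hn2, hn1, hn0]
    refine or_congr Iff.rfl ⟨?_, ?_⟩
    · rintro ⟨i, hi, h⟩
      exact ⟨⟨i, hi⟩, by rwa [← countAdj_eq_degree]⟩
    · rintro ⟨v, hv⟩
      exact ⟨v, v.2, by rwa [countAdj_eq_degree]⟩
  · rw [steps, key]
    simp only [exec] at h3 hst ⊢
    rw [hn0] at h3 ⊢
    nlinarith [h3, hst]

/-! ### Counting sets by their intersection pattern -/

/-- Sets of size `m` meeting `A` in `i` points split into their part inside and their part
outside `A`. -/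
lemma card_filter_inter_sdiff {ι : Type*} [DecidableEq ι] (E A : Finset ι) (hA : A ⊆ E)
    (m i : ℕ) (hi : i ≤ m) (P : Finset ι → Prop) [DecidablePred P] :
    ((E.powersetCard m).filter fun s => (s ∩ A).card = i ∧ P (s \ A)).card =
      A.card.choose i * (((E \ A).powersetCard (m - i)).filter P).card := by
  rw [← Finset.card_powersetCard, ← Finset.card_product]
  refine Finset.card_bij' (fun s _ => (s ∩ A, s \ A)) (fun p _ => p.1 ∪ p.2) ?_ ?_ ?_ ?_
  · intro s hs
    simp only [Finset.mem_filter, Finset.mem_powersetCard, Finset.mem_product] at hs ⊢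
    obtain ⟨⟨hs1, hs2⟩, hs3, hs4⟩ := hs
    refine ⟨⟨Finset.inter_subset_right, hs3⟩, ⟨Finset.sdiff_subset_sdiff hs1 le_rfl, ?_⟩, hs4⟩
    have := Finset.card_inter_add_card_sdiff s A
    omega
  · rintro ⟨p, q⟩ hp
    simp only [Finset.mem_filter, Finset.mem_powersetCard, Finset.mem_product] at hp ⊢
    obtain ⟨⟨hp1, hp2⟩, ⟨hq1, hq2⟩, hq3⟩ := hp
    have hd : Disjoint q A := Finset.disjoint_of_subset_left hq1 Finset.sdiff_disjoint
    have e1 : (p ∪ q) ∩ A = p := by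
      rw [Finset.union_inter_distrib_right, Finset.inter_eq_left.2 hp1,
        Finset.disjoint_iff_inter_eq_empty.1 hd, Finset.union_empty]
    have e2 : (p ∪ q) \ A = q := by
      rw [Finset.union_sdiff_distrib, Finset.sdiff_eq_empty_iff_subset.2 hp1,
        Finset.sdiff_eq_self_of_disjoint hd, Finset.empty_union]
    refine ⟨⟨Finset.union_subset (hp1.trans hA) (hq1.trans Finset.sdiff_subset), ?_⟩, ?_, ?_⟩
    · rw [Finset.card_union_of_disjoint (Finset.disjoint_of_subset_left hp1 hd.symm)]
      omega
    · rw [e1, hp2]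
    · rwa [e2]
  · intro s hs
    simp only
    ext x
    simp only [Finset.mem_union, Finset.mem_inter, Finset.mem_sdiff]
    tauto
  · rintro ⟨p, q⟩ hp
    simp only [Finset.mem_filter, Finset.mem_powersetCard, Finset.mem_product] at hp
    obtain ⟨⟨hp1, hp2⟩, ⟨hq1, hq2⟩, hq3⟩ := hp
    have hd : Disjoint q A := Finset.disjoint_of_subset_left hq1 Finset.sdiff_disjoint
    simp only [Prod.mk.injEq]
    constructor
    · rw [Finset.union_inter_distrib_right, Finset.inter_eq_left.2 hp1,
        Finset.disjoint_iff_inter_eq_empty.1 hd, Finset.union_empty]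
    · rw [Finset.union_sdiff_distrib, Finset.sdiff_eq_empty_iff_subset.2 hp1,
        Finset.sdiff_eq_self_of_disjoint hd, Finset.empty_union]

lemma card_filter_card_inter {ι : Type*} [DecidableEq ι] (E A : Finset ι) (hA : A ⊆ E)
    (m i : ℕ) (hi : i ≤ m) :
    ((E.powersetCard m).filter fun s => (s ∩ A).card = i).card =
      A.card.choose i * (E.card - A.card).choose (m - i) := by
  have := card_filter_inter_sdiff E A hA m i hi (fun _ => True)
  simp only [and_true, Finset.filter_true, Finset.card_powersetCard] at this
  rw [this, Finset.card_sdiff_of_subset hA]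

/-- Number of `m`-sets meeting two disjoint sets in `i` and `j` points. -/
lemma card_filter_card_inter_disjoint {ι : Type*} [DecidableEq ι] (E A B : Finset ι) (hA : A ⊆ E)
    (hB : B ⊆ E) (hAB : Disjoint A B) (m i j : ℕ) (hi : i + j ≤ m) :
    ((E.powersetCard m).filter fun s => (s ∩ A).card = i ∧ (s ∩ B).card = j).card =
      A.card.choose i * (B.card.choose j * (E.card - A.card - B.card).choose (m - i - j)) := by
  have hB' : B ⊆ E \ A := Finset.subset_sdiff.2 ⟨hB, hAB.symm⟩
  have := card_filter_inter_sdiff E A hA m i (by omega) (fun s => (s ∩ B).card = j)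
  rw [card_filter_card_inter (E \ A) B hB' (m - i) j (by omega), Finset.card_sdiff_of_subset hA]
    at this
  rw [← this]
  congr 1
  refine Finset.filter_congr fun s _ => ?_
  have : (s \ A) ∩ B = s ∩ B := by
    ext x
    simp only [Finset.mem_inter, Finset.mem_sdiff]
    have : x ∈ B → x ∉ A := fun h h' => Finset.disjoint_left.1 hAB h' h
    tauto
  rw [this]

/-- Number of `m`-sets meeting `A` in `i` and `B` in `j` points, where `A` and `B` have exactly the
point `e` in common: the sets avoiding `e` and those containing `e` are counted separately. -/
lemma card_filter_card_inter_pair {ι : Type*} [DecidableEq ι] (E A B : Finset ι) (hA : A ⊆ E)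
    (hB : B ⊆ E) (e : ι) (hAB : A ∩ B = {e}) (m i j : ℕ) (hi : i + j ≤ m) :
    ((E.powersetCard m).filter fun s => (s ∩ A).card = i ∧ (s ∩ B).card = j).card =
      (A.card - 1).choose i * ((B.card - 1).choose j *
        (E.card + 1 - A.card - B.card).choose (m - i - j)) +
      if 1 ≤ i ∧ 1 ≤ j then
        (A.card - 1).choose (i - 1) * ((B.card - 1).choose (j - 1) *
          (E.card + 1 - A.card - B.card).choose (m + 1 - i - j))
      else 0 := by
  have heAB : e ∈ A ∩ B := by simp [hAB]
  have heA := (Finset.mem_inter.1 heAB).1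
  have heB := (Finset.mem_inter.1 heAB).2
  have hd : Disjoint (A.erase e) (B.erase e) := by
    rw [Finset.disjoint_left]
    intro x hx hx'
    have : x ∈ A ∩ B := Finset.mem_inter.2 ⟨Finset.mem_of_mem_erase hx, Finset.mem_of_mem_erase hx'⟩
    rw [hAB, Finset.mem_singleton] at this
    exact Finset.ne_of_mem_erase hx this
  have hcA : (A.erase e).card = A.card - 1 := Finset.card_erase_of_mem heA
  have hcB : (B.erase e).card = B.card - 1 := Finset.card_erase_of_mem heB
  have hcE : (E.erase e).card = E.card - 1 := Finset.card_erase_of_mem (hA heA)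
  have pA : 1 ≤ A.card := Finset.card_pos.2 ⟨e, heA⟩
  have pB : 1 ≤ B.card := Finset.card_pos.2 ⟨e, heB⟩
  have pE : E.card ≥ A.card := Finset.card_le_card hA
  have hc : (E.erase e).card - (A.erase e).card - (B.erase e).card =
      E.card + 1 - A.card - B.card := by omega
  have hAE := Finset.erase_subset_erase e hA
  have hBE := Finset.erase_subset_erase e hB
  rw [← Finset.card_filter_add_card_filter_not (fun s => e ∉ s), Finset.filter_filter,
    Finset.filter_filter]
  congr 1
  · have := card_filter_card_inter_disjoint (E.erase e) (A.erase e) (B.erase e) hAE hBE hd m i j hi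
    rw [hc, hcA, hcB] at this
    rw [← this]
    congr 1
    ext s
    simp only [Finset.mem_filter, Finset.mem_powersetCard]
    constructor
    · rintro ⟨⟨h1, h2⟩, ⟨h3, h4⟩, h5⟩
      refine ⟨⟨Finset.subset_erase.2 ⟨h1, h5⟩, h2⟩, ?_, ?_⟩
      · rwa [Finset.inter_erase, Finset.erase_eq_of_notMem (by simp [h5])]
      · rwa [Finset.inter_erase, Finset.erase_eq_of_notMem (by simp [h5])]
    · rintro ⟨⟨h1, h2⟩, h3, h4⟩
      obtain ⟨h1, h5⟩ := Finset.subset_erase.1 h1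
      rw [Finset.inter_erase, Finset.erase_eq_of_notMem (by simp [h5])] at h3 h4
      exact ⟨⟨h1, h2⟩, ⟨h3, h4⟩, h5⟩
  · split_ifs with hij
    · have := card_filter_card_inter_disjoint (E.erase e) (A.erase e) (B.erase e) hAE hBE hd
        (m - 1) (i - 1) (j - 1) (by omega)
      rw [hc, hcA, hcB, show m - 1 - (i - 1) - (j - 1) = m + 1 - i - j by omega] at this
      rw [← this]
      refine Finset.card_bij' (fun s _ => s.erase e) (fun s _ => insert e s) ?_ ?_ ?_ ?_
      · intro s hs
        simp only [Finset.mem_filter, Finset.mem_powersetCard, not_not] at hs ⊢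
        obtain ⟨⟨h1, h2⟩, ⟨h3, h4⟩, h5⟩ := hs
        rw [Finset.erase_inter, Finset.inter_erase, Finset.erase_idem, Finset.erase_inter,
          Finset.inter_erase, Finset.erase_idem,
          Finset.card_erase_of_mem (Finset.mem_inter.2 ⟨h5, heA⟩),
          Finset.card_erase_of_mem (Finset.mem_inter.2 ⟨h5, heB⟩), Finset.card_erase_of_mem h5]
        exact ⟨⟨Finset.erase_subset_erase e h1, by omega⟩, by omega, by omega⟩
      · intro s hs
        simp only [Finset.mem_filter, Finset.mem_powersetCard, not_not] at hs ⊢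
        obtain ⟨⟨h1, h2⟩, h3, h4⟩ := hs
        obtain ⟨h1, h5⟩ := Finset.subset_erase.1 h1
        rw [Finset.inter_erase, Finset.erase_eq_of_notMem (by simp [h5])] at h3 h4
        refine ⟨⟨Finset.insert_subset (hA heA) h1, ?_⟩, ⟨?_, ?_⟩, Finset.mem_insert_self _ _⟩
        · rw [Finset.card_insert_of_notMem h5]; omega
        · rw [Finset.insert_inter_of_mem heA, Finset.card_insert_of_notMem (by simp [h5])]; omega
        · rw [Finset.insert_inter_of_mem heB, Finset.card_insert_of_notMem (by simp [h5])]; omega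
      · intro s hs
        simp only [Finset.mem_filter, Finset.mem_powersetCard, not_not] at hs
        exact Finset.insert_erase hs.2.2
      · intro s hs
        simp only [Finset.mem_filter, Finset.mem_powersetCard] at hs
        exact Finset.erase_insert (Finset.subset_erase.1 hs.1.1).2
    · rw [Finset.card_eq_zero, Finset.filter_eq_empty_iff]
      intro s hs h
      obtain ⟨⟨h3, h4⟩, h5⟩ := h
      rw [not_not] at h5
      have : 1 ≤ (s ∩ A).card := Finset.card_pos.2 ⟨e, by simp [h5, heA]⟩
      have : 1 ≤ (s ∩ B).card := Finset.card_pos.2 ⟨e, by simp [h5, heB]⟩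
      omega

/-! ### The two laws as weighted counts of graphs -/

instance {n : ℕ} : MeasurableSingletonClass (SimpleGraph (Fin n)) where
  measurableSet_singleton G := by
    refine ⟨{G.Adj}, measurableSet_singleton _, ?_⟩
    ext H
    exact SimpleGraph.adj_inj

/-- The graphs on `n` vertices with `m` edges. -/
noncomputable def graphs (n m : ℕ) : Finset (SimpleGraph (Fin n)) :=
  (Set.toFinite {G | G.edgeSet.ncard = m}).toFinset

@[simp] lemma mem_graphs {n m : ℕ} {G : SimpleGraph (Fin n)} :
    G ∈ graphs n m ↔ G.edgeSet.ncard = m := by simp [graphs]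

/-- The degree of a vertex, free of decidability instances. -/
noncomputable def deg {n : ℕ} (G : SimpleGraph (Fin n)) (v : Fin n) : ℕ := (G.incidenceSet v).ncard

/-- All pairs of distinct vertices. -/
noncomputable def pairs (n : ℕ) : Finset (Sym2 (Fin n)) := (⊤ : SimpleGraph (Fin n)).edgeFinset

/-- All pairs containing the vertex `v`. -/
noncomputable def pairsAt (n : ℕ) (v : Fin n) : Finset (Sym2 (Fin n)) :=
  (pairs n).filter (v ∈ ·)

lemma card_pairs (n : ℕ) : (pairs n).card = n.choose 2 := by
  rw [pairs, SimpleGraph.card_edgeFinset_top_eq_card_choose_two, Fintype.card_fin]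

lemma mem_pairs {n : ℕ} {e : Sym2 (Fin n)} : e ∈ pairs n ↔ ¬ e.IsDiag := by
  simp [pairs]

lemma edgeSet_subset_pairs {n : ℕ} (G : SimpleGraph (Fin n)) : G.edgeSet ⊆ pairs n := by
  intro e he
  exact mem_pairs.2 (G.not_isDiag_of_mem_edgeSet he)

lemma card_pairsAt (n : ℕ) (v : Fin n) : (pairsAt n v).card = n - 1 := by
  classical
  rw [pairsAt, pairs, ← SimpleGraph.incidenceFinset_eq_filter,
    SimpleGraph.card_incidenceFinset_eq_degree]
  simp

lemma pairsAt_subset (n : ℕ) (v : Fin n) : pairsAt n v ⊆ pairs n := Finset.filter_subset _ _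

lemma pairsAt_inter_pairsAt {n : ℕ} {u v : Fin n} (h : u ≠ v) :
    pairsAt n u ∩ pairsAt n v = {s(u, v)} := by
  ext e
  simp only [pairsAt, Finset.mem_inter, Finset.mem_filter, Finset.mem_singleton, mem_pairs]
  constructor
  · rintro ⟨⟨_, hu⟩, _, hv⟩
    exact (Sym2.mem_and_mem_iff h).1 ⟨hu, hv⟩
  · rintro rfl
    simp [h]

open scoped Classical in
/-- A graph contained in a set of pairs is a subset of this set. -/
lemma card_filter_edgeFinset {n : ℕ} (F : Finset (Sym2 (Fin n))) (hF : F ⊆ pairs n) (r : ℕ)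
    (P : Finset (Sym2 (Fin n)) → Prop) [DecidablePred P] :
    {G : SimpleGraph (Fin n) | G.edgeSet ⊆ F ∧ G.edgeSet.ncard = r ∧ P G.edgeFinset}.ncard =
      ((F.powersetCard r).filter P).card := by
  rw [← Set.ncard_coe_finset]
  refine Set.ncard_congr (fun G _ => G.edgeFinset) ?_ ?_ ?_
  · rintro G ⟨h1, h2, h3⟩
    simp only [Finset.coe_filter, Finset.mem_powersetCard, Set.mem_ofPred_eq]
    refine ⟨⟨?_, ?_⟩, h3⟩
    · rw [← Finset.coe_subset]; simpa using h1
    · rw [← h2, ← Set.ncard_coe_finset]; simp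
  · intro G H _ _ h
    exact SimpleGraph.edgeFinset_inj.1 h
  · intro s hs
    simp only [Finset.coe_filter, Finset.mem_powersetCard, Set.mem_ofPred_eq] at hs
    obtain ⟨⟨h1, h2⟩, h3⟩ := hs
    have he : (SimpleGraph.fromEdgeSet (s : Set (Sym2 (Fin n)))).edgeSet = s := by
      rw [SimpleGraph.edgeSet_fromEdgeSet, sdiff_eq_left, Set.disjoint_left]
      intro e he he'
      exact mem_pairs.1 (hF (h1 he)) he'
    have he' : ∀ inst, @SimpleGraph.edgeFinset _
        (SimpleGraph.fromEdgeSet (s : Set (Sym2 (Fin n)))) inst = s := by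
      intro inst
      rw [← Finset.coe_inj, SimpleGraph.coe_edgeFinset, he]
    refine ⟨SimpleGraph.fromEdgeSet s, ⟨?_, ?_, ?_⟩, he' _⟩
    · rw [he]; exact_mod_cast h1
    · rw [he, Set.ncard_coe_finset, h2]
    · rwa [he']

lemma ncard_edgeSet_subset {n : ℕ} (F : Finset (Sym2 (Fin n))) (hF : F ⊆ pairs n) (r : ℕ) :
    {G : SimpleGraph (Fin n) | G.edgeSet ⊆ F ∧ G.edgeSet.ncard = r}.ncard = F.card.choose r := by
  classical
  have := card_filter_edgeFinset F hF r (fun _ => True)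
  simpa using this

lemma card_graphs (n m : ℕ) : (graphs n m).card = (n.choose 2).choose m := by
  rw [← card_pairs, ← ncard_edgeSet_subset _ (subset_refl _), ← Set.ncard_coe_finset]
  congr 1
  ext G
  simp [edgeSet_subset_pairs]

lemma edgeSet_inter_pairsAt {n : ℕ} (G : SimpleGraph (Fin n)) (v : Fin n) :
    G.edgeSet ∩ pairsAt n v = G.incidenceSet v := by
  ext e
  simp only [SimpleGraph.incidenceSet, Set.mem_inter_iff, Finset.mem_coe, pairsAt,
    Finset.mem_filter, Set.mem_ofPred_eq]
  have := @edgeSet_subset_pairs _ G e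
  simp only [Finset.mem_coe] at this
  tauto

open scoped Classical in
lemma card_inter_pairsAt {n : ℕ} (G : SimpleGraph (Fin n)) (v : Fin n) :
    (G.edgeFinset ∩ pairsAt n v).card = deg G v := by
  rw [deg, ← edgeSet_inter_pairsAt, ← Set.ncard_coe_finset]
  simp

lemma deg_eq_degree {n : ℕ} (G : SimpleGraph (Fin n)) [DecidableRel G.Adj] (v : Fin n) :
    deg G v = G.degree v := by
  classical
  rw [deg, ← SimpleGraph.card_incidenceFinset_eq_degree, ← Set.ncard_coe_finset,
    SimpleGraph.coe_incidenceFinset]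

lemma deg_le_maxDeg {n : ℕ} (G : SimpleGraph (Fin n)) (v : Fin n) : deg G v ≤ maxDeg G := by
  classical
  rw [deg_eq_degree, le_maxDeg_iff]
  exact Or.inr ⟨v, le_rfl⟩

lemma exists_deg_ge {n : ℕ} (G : SimpleGraph (Fin n)) {T : ℕ} (hT : 0 < T) (h : T ≤ maxDeg G) :
    ∃ v, T ≤ deg G v := by
  classical
  obtain h | ⟨v, hv⟩ := (le_maxDeg_iff G T).1 h
  · omega
  · exact ⟨v, by rwa [deg_eq_degree]⟩

lemma deg_le {n : ℕ} (G : SimpleGraph (Fin n)) (v : Fin n) : deg G v ≤ n - 1 := by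
  classical
  rw [← card_pairsAt n v, ← card_inter_pairsAt]
  exact Finset.card_le_card Finset.inter_subset_right

/-- The degree of a vertex of `G(n,m)` is hypergeometric. -/
lemma card_filter_deg (n m : ℕ) (v : Fin n) (i : ℕ) (hi : i ≤ m) :
    ((graphs n m).filter fun G => deg G v = i).card =
      (n - 1).choose i * (n.choose 2 - (n - 1)).choose (m - i) := by
  classical
  have h1 := card_filter_edgeFinset (pairs n) (subset_refl _) m (fun s => (s ∩ pairsAt n v).card = i)
  rw [card_filter_card_inter _ _ (pairsAt_subset n v) _ _ hi, card_pairs, card_pairsAt] at h1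
  rw [← h1, ← Set.ncard_coe_finset]
  congr 1
  ext G
  simp [edgeSet_subset_pairs, card_inter_pairsAt]

/-- The joint law of two degrees of `G(n,m)`. -/
lemma card_filter_deg_pair (n m : ℕ) {u v : Fin n} (huv : u ≠ v) (i j : ℕ) (hi : i + j ≤ m) :
    ((graphs n m).filter fun G => deg G u = i ∧ deg G v = j).card =
      (n - 2).choose i * ((n - 2).choose j *
        (n.choose 2 + 1 - (n - 1) - (n - 1)).choose (m - i - j)) +
      if 1 ≤ i ∧ 1 ≤ j then
        (n - 2).choose (i - 1) * ((n - 2).choose (j - 1) *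
          (n.choose 2 + 1 - (n - 1) - (n - 1)).choose (m + 1 - i - j))
      else 0 := by
  classical
  have h1 := card_filter_edgeFinset (pairs n) (subset_refl _) m
    (fun s => (s ∩ pairsAt n u).card = i ∧ (s ∩ pairsAt n v).card = j)
  rw [card_filter_card_inter_pair _ _ _ (pairsAt_subset n u) (pairsAt_subset n v) _
    (pairsAt_inter_pairsAt huv) _ _ _ hi, card_pairs, card_pairsAt, card_pairsAt,
    Nat.sub_sub] at h1
  rw [← h1, ← Set.ncard_coe_finset]
  congr 1
  ext G
  simp [edgeSet_subset_pairs, card_inter_pairsAt]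

lemma ncard_stars (n k : ℕ) (v : Fin n) : (stars n k v).ncard = (n - 1).choose k := by
  rw [← card_pairsAt n v, ← ncard_edgeSet_subset _ (pairsAt_subset n v)]
  congr 1
  ext G
  simp only [stars, Set.mem_ofPred_eq, and_congr_left_iff]
  intro _
  constructor
  · intro h e he
    exact Finset.mem_filter.2 ⟨edgeSet_subset_pairs G he, h e he⟩
  · intro h e he
    exact (Finset.mem_filter.1 (h he)).2

lemma ncard_stars_le {n : ℕ} (k : ℕ) (v : Fin n) (G : SimpleGraph (Fin n)) :
    {S | S ∈ stars n k v ∧ S ≤ G}.ncard = (deg G v).choose k := by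
  classical
  rw [← card_inter_pairsAt, ← ncard_edgeSet_subset _
    (Finset.inter_subset_right.trans (pairsAt_subset n v))]
  congr 1
  ext S
  simp only [stars, Set.mem_ofPred_eq, ← SimpleGraph.edgeSet_subset_edgeSet, Finset.coe_inter,
    SimpleGraph.coe_edgeFinset, Set.subset_inter_iff]
  have : (∀ e ∈ S.edgeSet, v ∈ e) ↔ S.edgeSet ⊆ pairsAt n v := by
    constructor
    · intro h e he
      exact Finset.mem_filter.2 ⟨edgeSet_subset_pairs S he, h e he⟩
    · intro h e he
      exact (Finset.mem_filter.1 (h he)).2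
  rw [this]
  tauto

lemma ncard_backgrounds {n k m : ℕ} (S : SimpleGraph (Fin n)) (hS : S.edgeSet.ncard = k) :
    (backgrounds n k m S).ncard = (n.choose 2 - k).choose (m - k) := by
  classical
  have hc : (pairs n \ S.edgeFinset).card = n.choose 2 - k := by
    rw [Finset.card_sdiff_of_subset, card_pairs, ← hS, ← Set.ncard_coe_finset,
      SimpleGraph.coe_edgeFinset]
    rw [← Finset.coe_subset, SimpleGraph.coe_edgeFinset]
    exact edgeSet_subset_pairs S
  rw [← hc, ← ncard_edgeSet_subset _ Finset.sdiff_subset]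
  congr 1
  ext H
  simp only [backgrounds, Set.mem_ofPred_eq, Finset.coe_sdiff, SimpleGraph.coe_edgeFinset,
    Set.subset_sdiff, edgeSet_subset_pairs, true_and, SimpleGraph.disjoint_edgeSet]

lemma uniformOn_singleton_eq {Ω : Type*} [MeasurableSpace Ω] [MeasurableSingletonClass Ω]
    [Finite Ω] (s : Set Ω) (x : Ω) [Decidable (x ∈ s)] :
    uniformOn s {x} = if x ∈ s then (s.ncard : ℝ≥0∞)⁻¹ else 0 := by
  have hs : s.Finite := Set.toFinite s
  rw [uniformOn, cond_apply hs.measurableSet, Measure.count_apply hs.measurableSet]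
  split_ifs with h
  · rw [Set.inter_eq_right.2 (Set.singleton_subset_iff.2 h), Measure.count_singleton, mul_one]
    rw [← hs.cast_ncard_eq, ENat.toENNReal_coe]
  · rw [Set.inter_singleton_eq_empty.2 h, measure_empty, mul_zero]

lemma nullDist_singleton (n m : ℕ) (G : SimpleGraph (Fin n)) [Decidable (G ∈ graphs n m)] :
    nullDist n m {G} = if G ∈ graphs n m then ((n.choose 2).choose m : ℝ≥0∞)⁻¹ else 0 := by
  classical
  rw [nullDist, uniformOn_singleton_eq, ← card_graphs, ← Set.ncard_coe_finset]
  simp [graphs]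

lemma map_sup_singleton {n k m : ℕ} (hkm : k ≤ m) (S G : SimpleGraph (Fin n))
    (hS : S.edgeSet.ncard = k) [Decidable (S ≤ G ∧ G ∈ graphs n m)] :
    (uniformOn (backgrounds n k m S)).map (fun H => S ⊔ H) {G} =
      if S ≤ G ∧ G ∈ graphs n m then ((n.choose 2 - k).choose (m - k) : ℝ≥0∞)⁻¹ else 0 := by
  classical
  rw [Measure.map_apply (measurable_of_countable _) (measurableSet_singleton _)]
  have hfin : (backgrounds n k m S).Finite := Set.toFinite _
  -- a background `H` completes the star `S` to `G` only if `H = G \ S`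
  have key : backgrounds n k m S ∩ (fun H => S ⊔ H) ⁻¹' {G} =
      backgrounds n k m S ∩ (if S ≤ G ∧ G ∈ graphs n m then {G \ S} else ∅) := by
    ext H
    simp only [Set.mem_inter_iff, Set.mem_preimage, Set.mem_singleton_iff, and_congr_right_iff]
    rintro ⟨hd, hH⟩
    have hcard : (S ⊔ H).edgeSet.ncard = m := by
      rw [SimpleGraph.edgeSet_sup, Set.ncard_union_eq (SimpleGraph.disjoint_edgeSet.2 hd.symm), hS, hH]
      omega
    split_ifs with h
    · rw [Set.mem_singleton_iff]
      constructor
      · rintro rfl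
        rw [sup_sdiff_left_self, hd.sdiff_eq_left]
      · rintro rfl
        exact sup_sdiff_cancel_right h.1
    · simp only [Set.mem_empty_iff_false, iff_false]
      rintro rfl
      exact h ⟨le_sup_left, by simpa using hcard⟩
  rw [← uniformOn_inter_self hfin, key, uniformOn_inter_self hfin]
  split_ifs with h
  · rw [uniformOn_singleton_eq, if_pos, ncard_backgrounds S hS]
    refine ⟨disjoint_sdiff_self_left, ?_⟩
    rw [SimpleGraph.edgeSet_sdiff, Set.ncard_sdiff (SimpleGraph.edgeSet_subset_edgeSet.2 h.1), hS]
    rw [mem_graphs.1 h.2]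
  · simp

lemma plantedDist_singleton {n k m : ℕ} (hkm : k ≤ m) (G : SimpleGraph (Fin n))
    [Decidable (G ∈ graphs n m)] :
    plantedDist n k m {G} = if G ∈ graphs n m then
      ∑ v, (deg G v).choose k * ((n.choose 2 - k).choose (m - k) : ℝ≥0∞)⁻¹ *
        ((n - 1).choose k : ℝ≥0∞)⁻¹ * (n : ℝ≥0∞)⁻¹ else 0 := by
  classical
  rw [plantedDist, Measure.bind_apply (measurableSet_singleton _)
    (measurable_of_countable _).aemeasurable, lintegral_fintype]
  have h1 : ∀ v : Fin n, ((uniformOn (stars n k v)).bind fun S =>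
      (uniformOn (backgrounds n k m S)).map fun H => S ⊔ H) {G} =
      if G ∈ graphs n m then (deg G v).choose k * ((n.choose 2 - k).choose (m - k) : ℝ≥0∞)⁻¹ *
        ((n - 1).choose k : ℝ≥0∞)⁻¹ else 0 := by
    intro v
    rw [Measure.bind_apply (measurableSet_singleton _)
      (measurable_of_countable _).aemeasurable, lintegral_fintype]
    have h2 : ∀ S : SimpleGraph (Fin n), (uniformOn (backgrounds n k m S)).map (fun H => S ⊔ H) {G} *
        uniformOn (stars n k v) {S} = if S ∈ stars n k v ∧ S ≤ G then (if G ∈ graphs n m then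
          ((n.choose 2 - k).choose (m - k) : ℝ≥0∞)⁻¹ * ((n - 1).choose k : ℝ≥0∞)⁻¹ else 0)
          else 0 := by
      intro S
      rw [uniformOn_singleton_eq, ncard_stars]
      by_cases hS : S ∈ stars n k v
      · rw [map_sup_singleton hkm S G hS.2]
        by_cases hSG : S ≤ G <;> by_cases hG : G ∈ graphs n m <;> simp [hS, hSG, hG]
      · simp [hS]
    rw [Finset.sum_congr rfl fun S _ => h2 S, ← Finset.sum_filter, Finset.sum_const, nsmul_eq_mul,
      ← ncard_stars_le, ← Set.ncard_coe_finset]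
    split_ifs
    · rw [mul_assoc]; simp
    · simp
  rw [Finset.sum_congr rfl fun v _ => by
    rw [h1 v, uniformOn_singleton_eq, if_pos (Set.mem_univ v), Set.ncard_univ, Nat.card_fin]]
  split_ifs <;> simp

/-! ### Averages over `G(n,m)` and the likelihood ratio -/

/-- Expectation under `G(n,m)`. -/
noncomputable def mean (n m : ℕ) (f : SimpleGraph (Fin n) → ℝ) : ℝ :=
  (∑ G ∈ graphs n m, f G) / (graphs n m).card

/-- The likelihood ratio of the law planted at one given hub, as a function of the hub's degree. -/
noncomputable def hubRatio (n k m j : ℕ) : ℝ :=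
  j.choose k * (n.choose 2).choose m / ((n - 1).choose k * (n.choose 2 - k).choose (m - k))

/-- The average over the hub `v` of `g (deg v)`. -/
noncomputable def hubAverage (n : ℕ) (g : ℕ → ℝ) (G : SimpleGraph (Fin n)) : ℝ :=
  (∑ v, g (deg G v)) / n

lemma mean_mono {n m : ℕ} {f g : SimpleGraph (Fin n) → ℝ} (h : ∀ G ∈ graphs n m, f G ≤ g G) :
    mean n m f ≤ mean n m g := by
  unfold mean
  gcongr with G hG
  exact h G hG

lemma mean_add {n m : ℕ} (f g : SimpleGraph (Fin n) → ℝ) :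
    mean n m (fun G => f G + g G) = mean n m f + mean n m g := by
  simp [mean, Finset.sum_add_distrib, add_div]

lemma mean_const_mul {n m : ℕ} (c : ℝ) (f : SimpleGraph (Fin n) → ℝ) :
    mean n m (fun G => c * f G) = c * mean n m f := by
  simp [mean, ← Finset.mul_sum, mul_div_assoc]

lemma mean_sum {n m : ℕ} {ι : Type*} (s : Finset ι) (f : ι → SimpleGraph (Fin n) → ℝ) :
    mean n m (fun G => ∑ i ∈ s, f i G) = ∑ i ∈ s, mean n m (f i) := by
  simp only [mean]
  rw [Finset.sum_comm, Finset.sum_div]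

lemma mean_nonneg {n m : ℕ} {f : SimpleGraph (Fin n) → ℝ} (h : ∀ G ∈ graphs n m, 0 ≤ f G) :
    0 ≤ mean n m f :=
  div_nonneg (Finset.sum_nonneg h) (Nat.cast_nonneg _)

lemma card_graphs_pos {n m : ℕ} (h : m ≤ n.choose 2) : (0 : ℝ) < (graphs n m).card := by
  rw [card_graphs]
  exact_mod_cast Nat.choose_pos h

lemma mean_const {n m : ℕ} (h : m ≤ n.choose 2) (c : ℝ) : mean n m (fun _ => c) = c := by
  have := card_graphs_pos h
  simp only [mean, Finset.sum_const, nsmul_eq_mul]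
  field_simp

lemma hubRatio_nonneg (n k m j : ℕ) : 0 ≤ hubRatio n k m j := by
  unfold hubRatio; positivity

lemma hubAverage_nonneg {n : ℕ} {g : ℕ → ℝ} (hg : ∀ i, 0 ≤ g i) (G : SimpleGraph (Fin n)) :
    0 ≤ hubAverage n g G :=
  div_nonneg (Finset.sum_nonneg fun _ _ => hg _) (Nat.cast_nonneg _)

lemma measureReal_eq_sum_singleton {n : ℕ} (μ : Measure (SimpleGraph (Fin n)))
    [IsFiniteMeasure μ] (R : Set (SimpleGraph (Fin n))) (m : ℕ)
    (h : ∀ G ∉ graphs n m, μ {G} = 0) :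
    μ.real R = ∑ G ∈ graphs n m, R.indicator (fun G => μ.real {G}) G := by
  classical
  have hR : R = ((Set.toFinite R).toFinset : Set (SimpleGraph (Fin n))) := by simp
  conv_lhs => rw [hR, ← sum_measureReal_singleton]
  rw [← Finset.sum_indicator_subset_of_eq_zero
    (fun G => μ.real {G}) (fun _ x => x) (Finset.subset_univ (Set.toFinite R).toFinset) (by simp)]
  rw [← Finset.sum_subset (Finset.subset_univ (graphs n m))]
  · simp
  · intro G _ hG
    simp [Measure.real, h G hG, Set.indicator]

instance (n m : ℕ) : IsFiniteMeasure (nullDist n m) := by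
  unfold nullDist uniformOn; infer_instance

lemma nullDist_real {n m : ℕ} (R : Set (SimpleGraph (Fin n))) :
    (nullDist n m).real R = mean n m (R.indicator fun _ => 1) := by
  classical
  rw [measureReal_eq_sum_singleton _ R m (by intro G hG; rw [nullDist_singleton, if_neg hG]), mean,
    Finset.sum_div, card_graphs]
  refine Finset.sum_congr rfl fun G hG => ?_
  by_cases h : G ∈ R
  · simp [h, Measure.real, nullDist_singleton, mem_graphs.1 hG]
  · simp [h]

section Ratio

variable {n k m : ℕ}

lemma plantedDist_eq_withDensity (hkm : k ≤ m) (hmN : m ≤ n.choose 2) (hkn : k ≤ n - 1) :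
    plantedDist n k m = (nullDist n m).withDensity
      (fun G => ENNReal.ofReal (hubAverage n (hubRatio n k m) G)) := by
  classical
  refine Measure.ext_of_singleton fun G => ?_
  rw [plantedDist_singleton hkm, withDensity_apply _ (measurableSet_singleton _),
    lintegral_singleton, nullDist_singleton]
  split_ifs with hG
  · rcases Nat.eq_zero_or_pos n with rfl | hn
    · simp [hubAverage]
    have p1 : (0 : ℝ) < (n.choose 2).choose m := by exact_mod_cast Nat.choose_pos hmN
    have p2 : (0 : ℝ) < (n - 1).choose k := by exact_mod_cast Nat.choose_pos hkn
    have p3 : (0 : ℝ) < (n.choose 2 - k).choose (m - k) := by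
      exact_mod_cast Nat.choose_pos (by omega)
    have p4 : (0 : ℝ) < n := by exact_mod_cast hn
    have e : ∀ a : ℕ, (a : ℝ≥0∞) = ENNReal.ofReal a := fun a => (ENNReal.ofReal_natCast a).symm
    simp only [e]
    rw [← ENNReal.ofReal_inv_of_pos p1, ← ENNReal.ofReal_inv_of_pos p2,
      ← ENNReal.ofReal_inv_of_pos p3, ← ENNReal.ofReal_inv_of_pos p4,
      ← ENNReal.ofReal_mul (hubAverage_nonneg (hubRatio_nonneg n k m) G)]
    have : ∀ v, ENNReal.ofReal ((deg G v).choose k : ℕ) *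
        ENNReal.ofReal ((n.choose 2 - k).choose (m - k) : ℝ)⁻¹ *
        ENNReal.ofReal ((n - 1).choose k : ℝ)⁻¹ * ENNReal.ofReal (n : ℝ)⁻¹ =
        ENNReal.ofReal (((deg G v).choose k : ℕ) * ((n.choose 2 - k).choose (m - k) : ℝ)⁻¹ *
        ((n - 1).choose k : ℝ)⁻¹ * (n : ℝ)⁻¹) := by
      intro v
      rw [ENNReal.ofReal_mul (by positivity), ENNReal.ofReal_mul (by positivity),
        ENNReal.ofReal_mul (by positivity)]
    rw [Finset.sum_congr rfl fun v _ => this v, ← ENNReal.ofReal_sum_of_nonneg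
      (fun v _ => by positivity)]
    congr 1
    rw [hubAverage, div_mul_eq_mul_div, Finset.sum_mul, Finset.sum_div]
    refine Finset.sum_congr rfl fun v _ => ?_
    rw [hubRatio]
    field_simp
  · simp

lemma plantedDist_real (hkm : k ≤ m) (hmN : m ≤ n.choose 2) (hkn : k ≤ n - 1)
    (R : Set (SimpleGraph (Fin n))) :
    (plantedDist n k m).real R = mean n m (R.indicator (hubAverage n (hubRatio n k m))) := by
  classical
  have : IsFiniteMeasure (plantedDist n k m) := by
    rw [plantedDist_eq_withDensity hkm hmN hkn]
    exact isFiniteMeasure_withDensity_ofReal (Integrable.of_finite).2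
  have hs : ∀ G, (plantedDist n k m) {G} =
      ENNReal.ofReal (hubAverage n (hubRatio n k m) G) * nullDist n m {G} := by
    intro G
    rw [plantedDist_eq_withDensity hkm hmN hkn, withDensity_apply _ (measurableSet_singleton _),
      lintegral_singleton]
  rw [measureReal_eq_sum_singleton _ R m (by intro G hG; rw [plantedDist_singleton hkm, if_neg hG]),
    mean, Finset.sum_div, card_graphs]
  refine Finset.sum_congr rfl fun G hG => ?_
  by_cases h : G ∈ R
  · simp [h, Measure.real, hs, nullDist_singleton, mem_graphs.1 hG,
      ENNReal.toReal_ofReal (hubAverage_nonneg (hubRatio_nonneg n k m) G), div_eq_mul_inv]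
  · simp [h]

lemma mem_lrRegion_iff (hkm : k ≤ m) (hmN : m ≤ n.choose 2) (hkn : k ≤ n - 1)
    {G : SimpleGraph (Fin n)} (hG : G ∈ graphs n m) :
    G ∈ lrRegion n k m ↔ 1 ≤ hubAverage n (hubRatio n k m) G := by
  classical
  have h := Measure.rnDeriv_withDensity (nullDist n m)
    (measurable_of_countable
      (fun G => ENNReal.ofReal (hubAverage n (hubRatio n k m) G)))
  rw [← plantedDist_eq_withDensity hkm hmN hkn] at h
  have hpos : nullDist n m {G} ≠ 0 := by
    rw [nullDist_singleton, if_pos hG]; simp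
  -- an almost sure identity holds at every graph of positive probability
  have h2 : likelihoodRatio n k m G = ENNReal.ofReal (hubAverage n (hubRatio n k m) G) := by
    by_contra hne
    refine hpos (measure_mono_null (Set.singleton_subset_iff.2 ?_) (ae_iff.1 h))
    exact hne
  rw [lrRegion, Set.mem_ofPred_eq, h2, ENNReal.one_le_ofReal]

end Ratio

/-! ### Comparison of the two tests through a truncated second moment -/

/-- The ratio `hubRatio`, set to zero for degrees at least `T`. -/
noncomputable def truncRatio (n k m T j : ℕ) : ℝ := if j < T then hubRatio n k m j else 0

lemma truncRatio_nonneg (n k m T j : ℕ) : 0 ≤ truncRatio n k m T j := by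
  unfold truncRatio
  split_ifs
  · exact hubRatio_nonneg ..
  · exact le_rfl

/-- The mean of the truncated likelihood ratio. -/
noncomputable def truncMean (n k m T : ℕ) : ℝ :=
  mean n m (hubAverage n (truncRatio n k m T))

/-- The variance of the truncated likelihood ratio. -/
noncomputable def truncVar (n k m T : ℕ) : ℝ :=
  mean n m (fun G => hubAverage n (truncRatio n k m T) G ^ 2) - truncMean n k m T ^ 2

lemma truncMean_nonneg (n k m T : ℕ) : 0 ≤ truncMean n k m T :=
  mean_nonneg fun G _ => hubAverage_nonneg (truncRatio_nonneg n k m T) G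

lemma hubAverage_truncRatio_of_maxDeg_lt {n : ℕ} (k m : ℕ) {T : ℕ} {G : SimpleGraph (Fin n)}
    (h : maxDeg G < T) :
    hubAverage n (truncRatio n k m T) G = hubAverage n (hubRatio n k m) G := by
  unfold hubAverage truncRatio
  congr 1
  exact Finset.sum_congr rfl fun v _ => if_pos ((deg_le_maxDeg G v).trans_lt h)

lemma maxDegRegion_eq (α : ℝ) (n m : ℕ) :
    maxDegRegion α n m = {G | ⌈threshold α n m⌉₊ ≤ maxDeg G} := by
  ext G
  simp [maxDegRegion, Nat.ceil_le]

section Compare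

variable {n k m : ℕ} {T : ℕ}

lemma mean_indicator_add_sq (hmN : m ≤ n.choose 2) (A : Set (SimpleGraph (Fin n))) :
    mean n m (fun G => A.indicator (fun _ => 1) G +
      ((1 - truncMean n k m T)⁻¹) ^ 2 *
        (hubAverage n (truncRatio n k m T) G - truncMean n k m T) ^ 2) =
      mean n m (A.indicator fun _ => 1) + truncVar n k m T / (1 - truncMean n k m T) ^ 2 := by
  set c := truncMean n k m T with hc
  rw [mean_add, mean_const_mul, div_eq_inv_mul, inv_pow]
  congr 2
  have : (fun G => (hubAverage n (truncRatio n k m T) G - c) ^ 2) = fun G =>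
      (hubAverage n (truncRatio n k m T) G ^ 2 + (-2 * c) * hubAverage n (truncRatio n k m T) G)
        + c ^ 2 := by
    ext G; ring
  rw [this, mean_add, mean_add, mean_const_mul, mean_const hmN, truncVar, ← hc]
  have : mean n m (hubAverage n (truncRatio n k m T)) = c := rfl
  rw [show mean n m (fun G => hubAverage n (truncRatio n k m T) G) = c from this]
  ring

/-- Chebyshev's inequality for the truncated ratio controls the disagreement under the null law. -/
lemma nullDist_symmDiff_le (hkm : k ≤ m) (hmN : m ≤ n.choose 2) (hkn : k ≤ n - 1)
    (hc : truncMean n k m T < 1) :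
    (nullDist n m).real (symmDiff (lrRegion n k m) {G | T ≤ maxDeg G}) ≤
      mean n m ({G | T ≤ maxDeg G}.indicator fun _ => 1) +
        truncVar n k m T / (1 - truncMean n k m T) ^ 2 := by
  classical
  rw [← mean_indicator_add_sq hmN, nullDist_real]
  refine mean_mono fun G hG => ?_
  set c := truncMean n k m T
  have hc' : 0 < 1 - c := by linarith
  set W := hubAverage n (truncRatio n k m T) G with hW
  have hnn : 0 ≤ (1 - c)⁻¹ ^ 2 * (W - c) ^ 2 := by positivity
  by_cases hA : G ∈ {G | T ≤ maxDeg G}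
  · by_cases hs : G ∈ symmDiff (lrRegion n k m) {G | T ≤ maxDeg G}
    · simp only [Set.indicator_of_mem hs, Set.indicator_of_mem hA]; linarith
    · simp only [Set.indicator_of_notMem hs, Set.indicator_of_mem hA]; linarith
  · rw [Set.indicator_of_notMem hA]
    by_cases hs : G ∈ symmDiff (lrRegion n k m) {G | T ≤ maxDeg G}
    · have hL : G ∈ lrRegion n k m := by
        rcases hs with h | h
        · exact h.1
        · exact absurd h.1 hA
      rw [mem_lrRegion_iff hkm hmN hkn hG, ← hubAverage_truncRatio_of_maxDeg_lt k m (T := T)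
        (by simpa using hA), ← hW] at hL
      rw [Set.indicator_of_mem hs, ← mul_pow, zero_add]
      refine one_le_pow₀ ?_
      rw [inv_mul_eq_div, le_div_iff₀ hc']
      linarith
    · rw [Set.indicator_of_notMem hs]; linarith

/-- Under the planted law, graphs rejected by the degree test only have `Λ < 1`, so that their
planted probability is at most their null probability. -/
lemma plantedDist_symmDiff_le (hkm : k ≤ m) (hmN : m ≤ n.choose 2) (hkn : k ≤ n - 1)
    (hc : truncMean n k m T < 1) :
    (plantedDist n k m).real (symmDiff (lrRegion n k m) {G | T ≤ maxDeg G}) ≤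
      mean n m ({G | T ≤ maxDeg G}.indicator fun _ => 1) +
        truncVar n k m T / (1 - truncMean n k m T) ^ 2 := by
  classical
  rw [← mean_indicator_add_sq hmN, plantedDist_real hkm hmN hkn]
  refine mean_mono fun G hG => ?_
  have hc0 : 0 ≤ truncMean n k m T := truncMean_nonneg ..
  set c := truncMean n k m T
  have hc' : 0 < 1 - c := by linarith
  set W := hubAverage n (truncRatio n k m T) G with hW
  have hnn : 0 ≤ (1 - c)⁻¹ ^ 2 * (W - c) ^ 2 := by positivity
  by_cases hA : G ∈ {G | T ≤ maxDeg G}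
  · rw [Set.indicator_of_mem hA]
    by_cases hs : G ∈ symmDiff (lrRegion n k m) {G | T ≤ maxDeg G}
    · have hL : G ∉ lrRegion n k m := by
        rcases hs with h | h
        · exact absurd hA h.2
        · exact h.2
      rw [mem_lrRegion_iff hkm hmN hkn hG, not_le] at hL
      rw [Set.indicator_of_mem hs]; linarith
    · rw [Set.indicator_of_notMem hs]; linarith
  · rw [Set.indicator_of_notMem hA]
    by_cases hs : G ∈ symmDiff (lrRegion n k m) {G | T ≤ maxDeg G}
    · have hL : G ∈ lrRegion n k m := by
        rcases hs with h | h
        · exact h.1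
        · exact absurd h.1 hA
      rw [mem_lrRegion_iff hkm hmN hkn hG, ← hubAverage_truncRatio_of_maxDeg_lt k m (T := T)
        (by simpa using hA), ← hW] at hL
      rw [Set.indicator_of_mem hs, ← mul_pow, zero_add,
        ← hubAverage_truncRatio_of_maxDeg_lt k m (T := T) (by simpa using hA), ← hW]
      have h1 : W ≤ (1 - c)⁻¹ * (W - c) := by
        rw [inv_mul_eq_div, le_div_iff₀ hc']
        nlinarith
      nlinarith
    · rw [Set.indicator_of_notMem hs]; linarith

/-- The likelihood-ratio test is optimal, so a test loses at most the mass of its disagreement with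
the likelihood-ratio test. -/
lemma testError_le (hkm : k ≤ m) (hmN : m ≤ n.choose 2) (hkn : k ≤ n - 1)
    (M R : Set (SimpleGraph (Fin n))) :
    testError n k m M ≤ testError n k m R +
      ((nullDist n m).real (symmDiff (lrRegion n k m) M) +
        (plantedDist n k m).real (symmDiff (lrRegion n k m) M)) := by
  classical
  simp only [testError, plantedDist_real hkm hmN hkn, nullDist_real, ← mean_add]
  refine mean_mono fun G hG => ?_
  have hw := hubAverage_nonneg (hubRatio_nonneg n k m) G
  have hL := mem_lrRegion_iff hkm hmN hkn hG
  set w := hubAverage n (hubRatio n k m) G with hw'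
  by_cases h1 : G ∈ lrRegion n k m <;> by_cases h2 : G ∈ M <;> by_cases h3 : G ∈ R <;>
    simp only [h1, true_iff, false_iff, not_le] at hL <;>
    simp [Set.indicator, Set.mem_symmDiff, h1, h2, h3, ← hw'] <;> linarith

end Compare

/-! ### Moments of the degrees -/

/-- The law of a degree of `G(n,m)`. -/
noncomputable def degPmf (n m i : ℕ) : ℝ :=
  (n - 1).choose i * (n.choose 2 - (n - 1)).choose (m - i) / (n.choose 2).choose m

/-- The joint law of the degrees of two vertices of `G(n,m)`. -/
noncomputable def degPairPmf (n m i j : ℕ) : ℝ :=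
  ((n - 2).choose i * ((n - 2).choose j *
      (n.choose 2 + 1 - (n - 1) - (n - 1)).choose (m - i - j)) +
    if 1 ≤ i ∧ 1 ≤ j then
      (n - 2).choose (i - 1) * ((n - 2).choose (j - 1) *
        (n.choose 2 + 1 - (n - 1) - (n - 1)).choose (m + 1 - i - j))
    else 0 : ℕ) / (n.choose 2).choose m

lemma degPmf_nonneg (n m i : ℕ) : 0 ≤ degPmf n m i := by unfold degPmf; positivity

lemma mean_deg {n m : ℕ} (hnm : n - 1 ≤ m) (v : Fin n) (f : ℕ → ℝ) :
    mean n m (fun G => f (deg G v)) = ∑ i ∈ Finset.range n, degPmf n m i * f i := by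
  have hn : 0 < n := v.pos
  rw [mean, card_graphs, Finset.sum_div,
    ← Finset.sum_fiberwise_of_maps_to (t := Finset.range n) (g := fun G => deg G v)]
  · refine Finset.sum_congr rfl fun i hi => ?_
    rw [Finset.sum_congr rfl (g := fun _ => f i / ((n.choose 2).choose m : ℝ)),
      Finset.sum_const, card_filter_deg n m v i (by simp at hi; omega), degPmf, nsmul_eq_mul]
    · push_cast; ring
    · intro G hG
      rw [(Finset.mem_filter.1 hG).2]
  · intro G _
    have := deg_le G v
    simp; omega

lemma mean_deg_pair {n m T : ℕ} (hT : 2 * T ≤ m) {u v : Fin n} (huv : u ≠ v) (f g : ℕ → ℝ)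
    (hf : ∀ i, T ≤ i → f i = 0) (hg : ∀ i, T ≤ i → g i = 0) :
    mean n m (fun G => f (deg G u) * g (deg G v)) =
      ∑ i ∈ Finset.range T, ∑ j ∈ Finset.range T, degPairPmf n m i j * (f i * g j) := by
  classical
  rw [mean, card_graphs, Finset.sum_div, ← Finset.sum_product']
  rw [← Finset.sum_filter_of_ne (p := fun G => deg G u < T ∧ deg G v < T),
    ← Finset.sum_fiberwise_of_maps_to (t := Finset.range T ×ˢ Finset.range T)
      (g := fun G => (deg G u, deg G v))]
  · refine Finset.sum_congr rfl ?_
    rintro ⟨i, j⟩ hij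
    simp only [Finset.mem_product, Finset.mem_range] at hij
    rw [Finset.sum_congr rfl (g := fun _ => f i * g j / ((n.choose 2).choose m : ℝ)),
      Finset.sum_const, Finset.filter_filter]
    · have : ((graphs n m).filter fun G => (deg G u < T ∧ deg G v < T) ∧
          (deg G u, deg G v) = (i, j)) =
          (graphs n m).filter fun G => deg G u = i ∧ deg G v = j := by
        refine Finset.filter_congr fun G _ => ?_
        simp only [Prod.mk.injEq]
        constructor
        · exact fun h => h.2
        · rintro ⟨rfl, rfl⟩; exact ⟨hij, rfl, rfl⟩
      rw [this, card_filter_deg_pair n m huv i j (by omega), degPairPmf, nsmul_eq_mul]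
      ring
    · intro G hG
      have := (Finset.mem_filter.1 hG).2
      simp only [Prod.mk.injEq] at this
      rw [this.1, this.2]
  · intro G hG
    simpa using (Finset.mem_filter.1 hG).2
  · intro G _ hne
    by_contra h
    apply hne
    rw [not_and_or, not_lt, not_lt] at h
    rcases h with h | h
    · simp [hf _ h]
    · simp [hg _ h]

/-- Union bound for the maximum degree. -/
lemma mean_maxDeg_le {n m T : ℕ} (hT : 0 < T) (hnm : n - 1 ≤ m) :
    mean n m ({G | T ≤ maxDeg G}.indicator fun _ => 1) ≤
      n * ∑ i ∈ Finset.Ico T n, degPmf n m i := by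
  classical
  have h1 : mean n m ({G | T ≤ maxDeg G}.indicator fun _ => 1) ≤
      mean n m (fun G => ∑ v, if T ≤ deg G v then 1 else 0) := by
    refine mean_mono fun G _ => ?_
    by_cases h : G ∈ {G | T ≤ maxDeg G}
    · rw [Set.indicator_of_mem h]
      obtain ⟨v, hv⟩ := exists_deg_ge G hT h
      calc (1 : ℝ) = if T ≤ deg G v then 1 else 0 := by rw [if_pos hv]
        _ ≤ _ := Finset.single_le_sum (f := fun v => if T ≤ deg G v then (1 : ℝ) else 0)
          (fun v _ => by split_ifs <;> simp) (Finset.mem_univ v)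
    · rw [Set.indicator_of_notMem h]
      exact Finset.sum_nonneg fun v _ => by split_ifs <;> simp
  refine h1.trans (le_of_eq ?_)
  rw [mean_sum]
  have h2 : ∀ v : Fin n, mean n m (fun G => if T ≤ deg G v then (1 : ℝ) else 0) =
      ∑ i ∈ Finset.Ico T n, degPmf n m i := by
    intro v
    rw [mean_deg hnm v (fun i => if T ≤ i then (1 : ℝ) else 0)]
    simp only [mul_ite, mul_one, mul_zero]
    rw [← Finset.sum_filter]
    congr 1
    ext i
    simp [and_comm]
  rw [Finset.sum_congr rfl fun v _ => h2 v]
  simp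

lemma sum_range_truncRatio {n k m T : ℕ} (hTn : T ≤ n) (f : ℕ → ℝ → ℝ) (hf : ∀ i, f i 0 = 0) :
    ∑ i ∈ Finset.range n, f i (truncRatio n k m T i) =
      ∑ i ∈ Finset.range T, f i (hubRatio n k m i) := by
  rw [← Finset.sum_subset (Finset.range_subset_range.2 hTn)]
  · refine Finset.sum_congr rfl fun i hi => ?_
    rw [truncRatio, if_pos (Finset.mem_range.1 hi)]
  · intro i _ hi
    rw [truncRatio, if_neg (by simpa using hi), hf]

lemma truncMean_eq {n k m T : ℕ} (hn : 0 < n) (hnm : n - 1 ≤ m) (hTn : T ≤ n) :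
    truncMean n k m T = ∑ i ∈ Finset.range T, degPmf n m i * hubRatio n k m i := by
  have h : ∀ v : Fin n, mean n m (fun G => truncRatio n k m T (deg G v)) =
      ∑ i ∈ Finset.range T, degPmf n m i * hubRatio n k m i := fun v => by
    rw [mean_deg hnm v, sum_range_truncRatio hTn (fun i x => degPmf n m i * x) (by simp)]
  have h2 : hubAverage n (truncRatio n k m T) =
      fun G => (n : ℝ)⁻¹ * ∑ v, truncRatio n k m T (deg G v) := by
    ext G
    rw [hubAverage, div_eq_inv_mul]
  rw [truncMean, h2, mean_const_mul, mean_sum, Finset.sum_congr rfl fun v _ => h v]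
  simp only [Finset.sum_const, Finset.card_univ, Fintype.card_fin, nsmul_eq_mul]
  have : (n : ℝ) ≠ 0 := by positivity
  field_simp

/-- If two degrees are almost uncorrelated in the strong sense that their joint law is at most
`1 + ε` times the product law, then the variance of the truncated ratio reduces to its diagonal
part. -/
lemma truncVar_le {n k m T : ℕ} (hn : 0 < n) (hnm : n - 1 ≤ m) (hTn : T ≤ n) (hTm : 2 * T ≤ m)
    {ε : ℝ} (hε : 0 ≤ ε)
    (hpair : ∀ i < T, ∀ j < T, degPairPmf n m i j ≤ (1 + ε) * (degPmf n m i * degPmf n m j)) :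
    truncVar n k m T ≤ ε * truncMean n k m T ^ 2 +
      (∑ i ∈ Finset.range T, degPmf n m i * hubRatio n k m i ^ 2) / n := by
  classical
  set c := truncMean n k m T with hc
  set g := truncRatio n k m T with hg
  set D := ∑ i ∈ Finset.range T, degPmf n m i * hubRatio n k m i ^ 2 with hD
  have hD0 : 0 ≤ D := Finset.sum_nonneg fun i _ => mul_nonneg (degPmf_nonneg ..) (sq_nonneg _)
  have hgT : ∀ i, T ≤ i → g i = 0 := fun i hi => if_neg (by omega)
  have h2 : (fun G => hubAverage n g G ^ 2) =
      fun G => ((n : ℝ)⁻¹) ^ 2 * ∑ u, ∑ v, g (deg G u) * g (deg G v) := by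
    ext G
    rw [hubAverage, div_eq_inv_mul, mul_pow, sq (∑ v, g (deg G v)), Finset.sum_mul_sum]
  have hdiag : ∀ u v : Fin n, u = v → mean n m (fun G => g (deg G u) * g (deg G v)) = D := by
    rintro u _ rfl
    rw [mean_deg hnm u (fun i => g i * g i),
      sum_range_truncRatio hTn (fun i x => degPmf n m i * (x * x)) (by simp)]
    exact Finset.sum_congr rfl fun i _ => by ring
  have hoff : ∀ u v : Fin n, u ≠ v →
      mean n m (fun G => g (deg G u) * g (deg G v)) ≤ (1 + ε) * c ^ 2 := by
    intro u v huv
    rw [mean_deg_pair hTm huv g g hgT hgT, hc, truncMean_eq hn hnm hTn, sq, Finset.sum_mul_sum,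
      Finset.mul_sum]
    refine Finset.sum_le_sum fun i hi => ?_
    rw [Finset.mul_sum]
    refine Finset.sum_le_sum fun j hj => ?_
    rw [Finset.mem_range] at hi hj
    have e1 : g i = hubRatio n k m i := if_pos hi
    have e2 : g j = hubRatio n k m j := if_pos hj
    rw [e1, e2]
    have := mul_le_mul_of_nonneg_right (hpair i hi j hj)
      (mul_nonneg (hubRatio_nonneg n k m i) (hubRatio_nonneg n k m j))
    refine this.trans (le_of_eq ?_)
    ring
  have hall : ∀ u v : Fin n, mean n m (fun G => g (deg G u) * g (deg G v)) ≤
      (1 + ε) * c ^ 2 + if u = v then D else 0 := by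
    intro u v
    by_cases h : u = v
    · rw [if_pos h, hdiag u v h]
      have : 0 ≤ (1 + ε) * c ^ 2 := by positivity
      linarith
    · rw [if_neg h, add_zero]
      exact hoff u v h
  have hmean : mean n m (fun G => hubAverage n g G ^ 2) ≤ (1 + ε) * c ^ 2 + D / n := by
    rw [h2, mean_const_mul, mean_sum]
    simp_rw [mean_sum]
    have hn' : (0 : ℝ) < n := by exact_mod_cast hn
    calc ((n : ℝ)⁻¹) ^ 2 * ∑ u, ∑ v, mean n m (fun G => g (deg G u) * g (deg G v))
        ≤ ((n : ℝ)⁻¹) ^ 2 * ∑ u : Fin n, ∑ v : Fin n,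
          ((1 + ε) * c ^ 2 + if u = v then D else 0) := by
          gcongr with u _ v _
          exact hall u v
      _ = (1 + ε) * c ^ 2 + D / n := by
          simp [Finset.sum_add_distrib]
          field_simp
  rw [truncVar, ← hc]
  linarith

/-! ### Local bounds for the hypergeometric distribution -/

lemma pow_mul_le_of_step {h : ℕ → ℝ} {ρ : ℝ} (hρ : 0 ≤ ρ) {i s : ℕ}
    (hs : ∀ j < s, ρ * h (i + j) ≤ h (i + j + 1)) : ρ ^ s * h i ≤ h (i + s) := by
  induction s with
  | zero => simp
  | succ s ih =>
    have h1 := ih fun j hj => hs j (by omega)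
    have h2 := hs s (by omega)
    calc ρ ^ (s + 1) * h i = ρ * (ρ ^ s * h i) := by ring
      _ ≤ ρ * h (i + s) := by gcongr
      _ ≤ h (i + (s + 1)) := h2

/-- A subprobability mass function whose consecutive ratios are at least `1 - C/w` below `d + w` and
at most `1 + C/w` above `d - w` is `O(1/w)`: each value is comparable with about `w/(2C)` neighbours
on one side. -/
lemma le_div_of_ratio {h : ℕ → ℝ} {d w C : ℝ} (h0 : ∀ i, 0 ≤ h i)
    (hsum : ∀ s : Finset ℕ, ∑ i ∈ s, h i ≤ 1) (hC : 1 ≤ C) (hCw : C ≤ w) (hwd : w ≤ d)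
    (hlow : ∀ i : ℕ, (i : ℝ) ≤ d + w → (1 - C / w) * h i ≤ h (i + 1))
    (hup : ∀ i : ℕ, d - w ≤ (i : ℝ) → h (i + 1) ≤ (1 + C / w) * h i) (i : ℕ) :
    h i ≤ 4 * C / w := by
  have hw : 0 < w := by linarith
  have hρ : 0 ≤ 1 - C / w := by rw [sub_nonneg, div_le_one hw]; exact hCw
  set l := ⌊w / (2 * C)⌋₊ with hl
  have hl1 : (l : ℝ) ≤ w / (2 * C) := Nat.floor_le (by positivity)
  have hl2 : w / (2 * C) < l + 1 := Nat.lt_floor_add_one _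
  have hlw : (l : ℝ) ≤ w := hl1.trans (by
    rw [div_le_iff₀ (by positivity)]; nlinarith)
  have hpow : ∀ j ≤ l, 1 / 2 ≤ (1 - C / w) ^ j := by
    intro j hj
    have hb := one_add_mul_le_pow (a := -(C / w)) (by linarith) j
    have hj' : (j : ℝ) ≤ w / (2 * C) := le_trans (by exact_mod_cast hj) hl1
    have : (j : ℝ) * (C / w) ≤ w / (2 * C) * (C / w) := by gcongr
    have e : w / (2 * C) * (C / w) = 1 / 2 := by field_simp
    rw [← sub_eq_add_neg] at hb
    linarith
  have key : ((l : ℝ) + 1) * (h i / 2) ≤ 1 := by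
    by_cases hi : (i : ℝ) ≤ d
    · have h1 : ∀ j ∈ Finset.range (l + 1), h i / 2 ≤ h (i + j) := by
        intro j hj
        have hj' : j ≤ l := by simp at hj; omega
        have := pow_mul_le_of_step (h := h) hρ (i := i) (s := j) fun j' hj' => by
          refine hlow _ ?_
          push_cast
          have : (j' : ℝ) ≤ l := by exact_mod_cast (by omega : j' ≤ l)
          linarith
        nlinarith [hpow j hj', h0 i]
      have h2 := Finset.card_nsmul_le_sum _ _ _ h1
      have h3 := hsum ((Finset.range (l + 1)).image (i + ·))
      rw [Finset.sum_image (by intro a _ b _ hab; simpa using hab)] at h3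
      simp only [Finset.card_range, nsmul_eq_mul] at h2
      push_cast at h2
      linarith
    · push Not at hi
      have hli : l ≤ i := by
        have : (l : ℝ) ≤ i := by linarith
        exact_mod_cast this
      have hstep : ∀ j : ℕ, d - w ≤ (j : ℝ) → (1 - C / w) * h (j + 1) ≤ h j := by
        intro j hj
        have h1 := hup j hj
        have hx : 0 ≤ C / w := by positivity
        calc (1 - C / w) * h (j + 1) ≤ (1 - C / w) * ((1 + C / w) * h j) := by gcongr
          _ = (1 - (C / w) ^ 2) * h j := by ring
          _ ≤ 1 * h j := by gcongr; exact h0 j; nlinarith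
          _ = h j := one_mul _
      have h1 : ∀ j ∈ Finset.range (l + 1), h i / 2 ≤ h (i - j) := by
        intro j hj
        have hj' : j ≤ l := by simp at hj; omega
        have := pow_mul_le_of_step (h := fun j => h (i - j)) hρ (i := 0) (s := j) fun j' hj' => by
          have e : i - (0 + j') = i - (0 + j' + 1) + 1 := by omega
          rw [e]
          refine hstep _ ?_
          have : ((i - (0 + j' + 1) : ℕ) : ℝ) = i - (j' + 1) := by
            rw [Nat.cast_sub (by omega)]; push_cast; ring
          rw [this]
          have : (j' : ℝ) + 1 ≤ l := by exact_mod_cast (by omega : j' + 1 ≤ l)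
          linarith
        simp only [Nat.sub_zero, zero_add] at this
        nlinarith [hpow j hj', h0 i]
      have h2 := Finset.card_nsmul_le_sum _ _ _ h1
      have h3 := hsum ((Finset.range (l + 1)).image (i - ·))
      rw [Finset.sum_image (by
        intro a ha b hb hab
        simp only [Finset.coe_range, Set.mem_Iio] at ha hb hab
        omega)] at h3
      simp only [Finset.card_range, nsmul_eq_mul] at h2
      push_cast at h2
      linarith
  have h4 : w / (2 * C) * (h i / 2) ≤ 1 :=
    le_trans (by gcongr; have := h0 i; positivity) key
  rw [le_div_iff₀ hw]
  have e : w / (2 * C) * (h i / 2) = (h i * w) / (4 * C) := by field_simp; ring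
  rw [e, div_le_one (by positivity)] at h4
  exact h4

/-- If the ratios are at least `1 + 1/w` below `d - 2w`, then at least half of the mass lies above
`d - 5w`, because shifting by `⌈w⌉` doubles the values far to the left. -/
lemma half_le_sum_Ico {h : ℕ → ℝ} {d w : ℝ} {M : ℕ} (h0 : ∀ i, 0 ≤ h i) (hM : ∀ i, M ≤ i → h i = 0)
    (hsum : ∑ i ∈ Finset.range M, h i = 1) (hw : 1 ≤ w)
    (hleft : ∀ i : ℕ, (i : ℝ) ≤ d - 2 * w → (1 + 1 / w) * h i ≤ h (i + 1)) (a : ℕ)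
    (ha : (a : ℝ) ≤ d - 4 * w) : 1 / 2 ≤ ∑ i ∈ Finset.Ico a M, h i := by
  have hw0 : 0 < w := by linarith
  set s := ⌈w⌉₊ with hs
  have hs1 : w ≤ s := Nat.le_ceil _
  have hs2 : (s : ℝ) < w + 1 := Nat.ceil_lt_add_one hw0.le
  have hdouble : ∀ i ∈ Finset.range a, 2 * h i ≤ h (i + s) := by
    intro i hi
    have hia : (i : ℝ) + 1 ≤ a := by exact_mod_cast Finset.mem_range.1 hi
    have h1 := pow_mul_le_of_step (h := h) (ρ := 1 + 1 / w) (by positivity) (i := i) (s := s)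
      fun j hj => by
        refine hleft _ ?_
        push_cast
        have : (j : ℝ) + 1 ≤ s := by exact_mod_cast hj
        linarith
    have hb := one_add_mul_le_pow (a := 1 / w) (by have : 0 ≤ 1 / w := by positivity
                                                   linarith) s
    have : 1 ≤ (s : ℝ) * (1 / w) := by rw [mul_one_div, le_div_iff₀ hw0]; linarith
    nlinarith [h0 i]
  have h2 := Finset.sum_le_sum hdouble
  rw [← Finset.mul_sum] at h2
  have h3 : ∑ i ∈ Finset.range a, h (i + s) ≤ ∑ i ∈ Finset.range M, h i := by
    have e : ∑ i ∈ Finset.range a, h (i + s) = ∑ i ∈ Finset.Ico s (a + s), h i := by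
      rw [Finset.range_eq_Ico, Finset.sum_Ico_add', zero_add]
    rw [e]
    calc ∑ i ∈ Finset.Ico s (a + s), h i ≤ ∑ i ∈ Finset.range (a + s + M), h i :=
          Finset.sum_le_sum_of_subset_of_nonneg (by intro i; simp; omega) fun i _ _ => h0 i
      _ = ∑ i ∈ Finset.range M, h i := by
          symm
          refine Finset.sum_subset (by intro i; simp; omega) fun i _ hi => hM i (by simpa using hi)
  by_cases haM : a ≤ M
  · have h5 := Finset.sum_range_add_sum_Ico h haM
    linarith
  · exfalso
    have : ∑ i ∈ Finset.range M, h i ≤ ∑ i ∈ Finset.range a, h i :=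
      Finset.sum_le_sum_of_subset_of_nonneg (by intro i; simp; omega) fun i _ _ => h0 i
    linarith

lemma exp_le_one_sub_pow {x : ℝ} (hx0 : 0 ≤ x) (hx : x ≤ 1 / 2) (s : ℕ) :
    Real.exp (-(2 * x * s)) ≤ (1 - x) ^ s := by
  have h1 : Real.exp (-(2 * x)) ≤ 1 - x := by
    have h2 : 1 + 2 * x ≤ Real.exp (2 * x) := by linarith [Real.add_one_le_exp (2 * x)]
    rw [Real.exp_neg, inv_le_comm₀ (Real.exp_pos _) (by linarith)]
    refine le_trans ?_ h2
    rw [inv_le_iff_one_le_mul₀ (by linarith)]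
    nlinarith
  calc Real.exp (-(2 * x * s)) = Real.exp (-(2 * x)) ^ s := by
        rw [← Real.exp_nat_mul]; congr 1; ring
    _ ≤ (1 - x) ^ s := by gcongr

/-- A mass function whose ratios behave like those of a law with mean `d` and standard deviation
of order `w` puts mass bounded below beyond `d + B w`, because it loses only a constant factor under
a shift of order `w`. -/
lemma exp_le_sum_Ico {h : ℕ → ℝ} {d w B C : ℝ} {M : ℕ} (h0 : ∀ i, 0 ≤ h i)
    (hM : ∀ i, M ≤ i → h i = 0) (hsum : ∑ i ∈ Finset.range M, h i = 1) (hw : 1 ≤ w) (hB : 0 ≤ B)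
    (hd : 5 * w ≤ d) (hC : 0 ≤ C) (hCw : 2 * C ≤ w)
    (hleft : ∀ i : ℕ, (i : ℝ) ≤ d - 2 * w → (1 + 1 / w) * h i ≤ h (i + 1))
    (hlow : ∀ i : ℕ, (i : ℝ) ≤ d + (2 * B + 8) * w → (1 - C / w) * h i ≤ h (i + 1))
    (b : ℕ) (hb : (b : ℝ) ≤ d + B * w) :
    Real.exp (-(2 * C * (B + 6))) / 4 ≤ ∑ i ∈ Finset.Ico b M, h i := by
  have hw0 : 0 < w := by linarith
  set κ := Real.exp (-(2 * C * (B + 6))) with hκ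
  have hκ0 : 0 < κ := Real.exp_pos _
  have hκ1 : κ ≤ 1 := Real.exp_le_one_iff.2 (by
    have : 0 ≤ 2 * C * (B + 6) := by positivity
    linarith)
  set a := ⌊d - 4 * w⌋₊ with ha
  have ha1 : (a : ℝ) ≤ d - 4 * w := Nat.floor_le (by linarith)
  have ha2 : d - 4 * w < a + 1 := Nat.lt_floor_add_one _
  have hhalf := half_le_sum_Ico h0 hM hsum hw hleft a ha1
  by_cases hab : b ≤ a
  · have : ∑ i ∈ Finset.Ico a M, h i ≤ ∑ i ∈ Finset.Ico b M, h i :=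
      Finset.sum_le_sum_of_subset_of_nonneg (Finset.Ico_subset_Ico_left hab) fun i _ _ => h0 i
    linarith
  · push Not at hab
    set s := b - a with hs
    have hs' : (s : ℝ) = b - a := by rw [hs, Nat.cast_sub hab.le]
    have hsw : (s : ℝ) ≤ (B + 5) * w + 1 := by rw [hs']; linarith
    have hκs : κ ≤ (1 - C / w) ^ s := by
      refine le_trans ?_ (exp_le_one_sub_pow (by positivity) ?_ s)
      · rw [hκ, Real.exp_le_exp]
        have : 2 * (C / w) * s ≤ 2 * (C / w) * ((B + 6) * w) := by gcongr; linarith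
        have e : 2 * (C / w) * ((B + 6) * w) = 2 * C * (B + 6) := by field_simp
        linarith
      · rw [div_le_iff₀ hw0]; linarith
    have hρ : 0 ≤ 1 - C / w := by
      rw [sub_nonneg, div_le_one hw0]; linarith
    have hshift : ∀ i ∈ Finset.Ico a b, κ * h i ≤ h (i + s) := by
      intro i hi
      rw [Finset.mem_Ico] at hi
      have hib : (i : ℝ) ≤ b := by exact_mod_cast hi.2.le
      have h1 := pow_mul_le_of_step (h := h) hρ (i := i) (s := s) fun j hj => by
        refine hlow _ ?_
        push_cast
        have : (j : ℝ) + 1 ≤ s := by exact_mod_cast hj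
        nlinarith
      exact (mul_le_mul_of_nonneg_right hκs (h0 i)).trans h1
    have h2 := Finset.sum_le_sum hshift
    rw [← Finset.mul_sum, Finset.sum_Ico_add',
      show a + s = b by omega] at h2
    have hU : ∀ c, ∑ i ∈ Finset.Ico b c, h i ≤ ∑ i ∈ Finset.Ico b M, h i := by
      intro c
      by_cases hcM : c ≤ M
      · exact Finset.sum_le_sum_of_subset_of_nonneg (Finset.Ico_subset_Ico_right hcM)
          fun i _ _ => h0 i
      · refine le_of_eq (Finset.sum_subset (Finset.Ico_subset_Ico_right (by omega)) ?_).symm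
        intro i hi hi'
        simp only [Finset.mem_Ico] at hi hi'
        exact hM i (by omega)
    have h3 : ∑ i ∈ Finset.Ico a M, h i ≤ ∑ i ∈ Finset.Ico a b, h i + ∑ i ∈ Finset.Ico b M, h i := by
      rw [← Finset.sum_union (Finset.Ico_disjoint_Ico_consecutive a b M)]
      refine Finset.sum_le_sum_of_subset_of_nonneg ?_ fun i _ _ => h0 i
      intro i; simp only [Finset.mem_Ico, Finset.mem_union]; omega
    have h4 := hU (b + s)
    set U := ∑ i ∈ Finset.Ico b M, h i
    set V := ∑ i ∈ Finset.Ico a b, h i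
    nlinarith

/-- The hypergeometric probability mass function: `Q` draws from a population of `K` marked and
`L` unmarked elements. -/
noncomputable def hyperPmf (K L Q i : ℕ) : ℝ :=
  K.choose i * L.choose (Q - i) / (K + L).choose Q

section Hyper

variable {K L Q : ℕ}

lemma hyperPmf_nonneg (K L Q i : ℕ) : 0 ≤ hyperPmf K L Q i := by unfold hyperPmf; positivity

lemma hyperPmf_eq_zero {i : ℕ} (hi : K < i) : hyperPmf K L Q i = 0 := by
  simp [hyperPmf, Nat.choose_eq_zero_of_lt hi]

lemma sum_hyperPmf (hKQ : K ≤ Q) (hQL : Q ≤ L) :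
    ∑ i ∈ Finset.range (K + 1), hyperPmf K L Q i = 1 := by
  have h1 : (K + L).choose Q = ∑ i ∈ Finset.range (K + 1), K.choose i * L.choose (Q - i) := by
    rw [Nat.add_choose_eq, Finset.Nat.sum_antidiagonal_eq_sum_range_succ
      (fun i j => K.choose i * L.choose j)]
    symm
    refine Finset.sum_subset (Finset.range_subset_range.2 (by omega)) fun i _ hi => ?_
    rw [Nat.choose_eq_zero_of_lt (by simpa using hi), zero_mul]
  have hpos : (0 : ℝ) < (K + L).choose Q := by exact_mod_cast Nat.choose_pos (by omega)
  simp only [hyperPmf]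
  rw [← Finset.sum_div, div_eq_one_iff_eq hpos.ne', h1]
  push_cast
  rfl

lemma sum_hyperPmf_le (hKQ : K ≤ Q) (hQL : Q ≤ L) (s : Finset ℕ) :
    ∑ i ∈ s, hyperPmf K L Q i ≤ 1 := by
  rw [← sum_hyperPmf hKQ hQL]
  calc ∑ i ∈ s, hyperPmf K L Q i = ∑ i ∈ s.filter (· < K + 1), hyperPmf K L Q i := by
        symm
        refine Finset.sum_filter_of_ne fun i _ hi => ?_
        by_contra h
        exact hi (hyperPmf_eq_zero (by omega))
    _ ≤ _ := Finset.sum_le_sum_of_subset_of_nonneg (by intro i; simp) fun i _ _ =>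
        hyperPmf_nonneg ..

lemma hyperPmf_succ (hKQ : K ≤ Q) (hQL : Q ≤ L) {i : ℕ} (hi : i ≤ K) :
    hyperPmf K L Q (i + 1) * ((i + 1) * (L - Q + i + 1)) =
      hyperPmf K L Q i * ((K - i) * (Q - i)) := by
  rcases hi.eq_or_lt with rfl | hi
  · simp [hyperPmf_eq_zero (Nat.lt_succ_self i)]
  have h1 := Nat.choose_succ_right_eq K i
  have h2 := Nat.choose_succ_right_eq L (Q - (i + 1))
  rw [show Q - (i + 1) + 1 = Q - i by omega] at h2
  have h1' : (K.choose (i + 1) : ℝ) * (i + 1) = K.choose i * (K - i) := by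
    have : ((K - i : ℕ) : ℝ) = K - i := by rw [Nat.cast_sub hi.le]
    rw [← this]; exact_mod_cast h1
  have h2' : (L.choose (Q - i) : ℝ) * (Q - i) = L.choose (Q - (i + 1)) * (L - Q + i + 1) := by
    have e1 : ((Q - i : ℕ) : ℝ) = Q - i := by rw [Nat.cast_sub (by omega)]
    have e2 : ((L - (Q - (i + 1)) : ℕ) : ℝ) = L - Q + i + 1 := by
      rw [Nat.cast_sub (by omega), Nat.cast_sub (by omega)]; push_cast; ring
    rw [← e1, ← e2]; exact_mod_cast h2
  simp only [hyperPmf]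
  rw [div_mul_eq_mul_div, div_mul_eq_mul_div]
  congr 1
  linear_combination (L.choose (Q - (i + 1)) : ℝ) * (L - Q + i + 1) * h1' -
    (K.choose i : ℝ) * (K - i) * h2'

/-- The point where the ratio of consecutive hypergeometric probabilities crosses `1`, which is
close to the mean. -/
noncomputable def hyperMode (K L Q : ℕ) : ℝ := (K + 1) * (Q + 1) / (K + L + 2) - 1

lemma hyper_num_sub_den (K L Q : ℕ) (i : ℝ) :
    (K - i) * (Q - i) - (i + 1) * (L - Q + i + 1) =
      ((K + L + 2 : ℝ)) * (hyperMode K L Q - i) := by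
  unfold hyperMode
  have : (K + L + 2 : ℝ) ≠ 0 := by positivity
  field_simp
  ring

/-- Lower bound for the ratio of consecutive hypergeometric probabilities. -/
lemma hyperPmf_ratio_low (hKQ : K ≤ Q) (hQL : Q ≤ L) (hhalf : (K + L + 2 : ℝ) ≤ 2 * (L - Q))
    {d w A : ℝ} (hw : 2 ≤ w) (hd : d = w ^ 2) (hmode : |hyperMode K L Q - d| ≤ w) (hA : 0 ≤ A)
    (i : ℕ) (hi : (i : ℝ) ≤ d + A * w) :
    (1 - 4 * (A + 1) / w) * hyperPmf K L Q i ≤ hyperPmf K L Q (i + 1) := by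
  by_cases hiK : K < i
  · rw [hyperPmf_eq_zero hiK, hyperPmf_eq_zero (by omega), mul_zero]
  push Not at hiK
  have hsucc := hyperPmf_succ hKQ hQL hiK
  have hnd := hyper_num_sub_den K L Q i
  have h0 := hyperPmf_nonneg K L Q i
  have hQL' : (0 : ℝ) ≤ L - Q := sub_nonneg.2 (by exact_mod_cast hQL)
  have hi0 : (0 : ℝ) ≤ i := Nat.cast_nonneg _
  have hden : 0 < ((i : ℝ) + 1) * (L - Q + i + 1) := by positivity
  rw [← mul_le_mul_iff_left₀ hden, hsucc]
  rw [mul_right_comm, mul_comm _ (hyperPmf K L Q i)]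
  refine mul_le_mul_of_nonneg_left ?_ h0
  obtain ⟨hm1, hm2⟩ := abs_le.1 hmode
  set P : ℝ := K + L + 2 with hP
  have hP0 : 0 < P := by positivity
  suffices h : -(4 * (A + 1) / w * (((i : ℝ) + 1) * (L - Q + i + 1))) ≤
      P * (hyperMode K L Q - i) by linarith
  by_cases hle : (i : ℝ) ≤ hyperMode K L Q
  · have h1 : 0 ≤ 4 * (A + 1) / w * (((i : ℝ) + 1) * (L - Q + i + 1)) := by positivity
    have h2 : 0 ≤ P * (hyperMode K L Q - i) := mul_nonneg hP0.le (by linarith)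
    linarith
  · push Not at hle
    have hd2 : w ^ 2 / 2 ≤ (i : ℝ) + 1 := by nlinarith
    have hden2 : w ^ 2 / 2 * (P / 2) ≤ ((i : ℝ) + 1) * (L - Q + i + 1) := by
      gcongr
      linarith
    have h1 : 4 * (A + 1) / w * (w ^ 2 / 2 * (P / 2)) ≤
        4 * (A + 1) / w * (((i : ℝ) + 1) * (L - Q + i + 1)) := by gcongr
    have e : 4 * (A + 1) / w * (w ^ 2 / 2 * (P / 2)) = P * ((A + 1) * w) := by
      field_simp; ring
    have h2 : P * ((A + 1) * w) ≥ P * (i - hyperMode K L Q) := by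
      refine mul_le_mul_of_nonneg_left ?_ hP0.le
      linarith
    linarith

lemma hyperPmf_ratio_up (hKQ : K ≤ Q) (hQL : Q ≤ L) (hhalf : (K + L + 2 : ℝ) ≤ 2 * (L - Q))
    {d w : ℝ} (hw : 2 ≤ w) (hd : d = w ^ 2) (hmode : |hyperMode K L Q - d| ≤ w)
    (i : ℕ) (hi : d - w ≤ (i : ℝ)) :
    hyperPmf K L Q (i + 1) ≤ (1 + 8 / w) * hyperPmf K L Q i := by
  by_cases hiK : K < i
  · rw [hyperPmf_eq_zero hiK, hyperPmf_eq_zero (by omega), mul_zero]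
  push Not at hiK
  have hsucc := hyperPmf_succ hKQ hQL hiK
  have hnd := hyper_num_sub_den K L Q i
  have h0 := hyperPmf_nonneg K L Q i
  have hQL' : (0 : ℝ) ≤ L - Q := sub_nonneg.2 (by exact_mod_cast hQL)
  have hi0 : (0 : ℝ) ≤ i := Nat.cast_nonneg _
  have hden : 0 < ((i : ℝ) + 1) * (L - Q + i + 1) := by positivity
  rw [← mul_le_mul_iff_left₀ hden, hsucc]
  rw [mul_right_comm, mul_comm _ (hyperPmf K L Q i)]
  refine mul_le_mul_of_nonneg_left ?_ h0
  obtain ⟨hm1, hm2⟩ := abs_le.1 hmode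
  set P : ℝ := K + L + 2 with hP
  have hP0 : 0 < P := by positivity
  suffices h : P * (hyperMode K L Q - i) ≤ 8 / w * (((i : ℝ) + 1) * (L - Q + i + 1)) by linarith
  have hd2 : w ^ 2 / 2 ≤ (i : ℝ) + 1 := by nlinarith
  have hden2 : w ^ 2 / 2 * (P / 2) ≤ ((i : ℝ) + 1) * (L - Q + i + 1) := by
    gcongr
    linarith
  have h1 : 8 / w * (w ^ 2 / 2 * (P / 2)) ≤ 8 / w * (((i : ℝ) + 1) * (L - Q + i + 1)) := by gcongr
  have e : 8 / w * (w ^ 2 / 2 * (P / 2)) = P * (2 * w) := by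
    field_simp; ring
  have h2 : P * (hyperMode K L Q - i) ≤ P * (2 * w) := by
    refine mul_le_mul_of_nonneg_left ?_ hP0.le
    linarith
  linarith

lemma hyperPmf_ratio_left (hKQ : K ≤ Q) (hQL : Q ≤ L)
    {d w : ℝ} (hw : 2 ≤ w) (hd : d = w ^ 2) (hmode : |hyperMode K L Q - d| ≤ w)
    (i : ℕ) (hi : (i : ℝ) ≤ d - 2 * w) :
    (1 + 1 / w) * hyperPmf K L Q i ≤ hyperPmf K L Q (i + 1) := by
  by_cases hiK : K < i
  · rw [hyperPmf_eq_zero hiK, hyperPmf_eq_zero (by omega), mul_zero]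
  push Not at hiK
  have hsucc := hyperPmf_succ hKQ hQL hiK
  have hnd := hyper_num_sub_den K L Q i
  have h0 := hyperPmf_nonneg K L Q i
  have hQL' : (0 : ℝ) ≤ L - Q := sub_nonneg.2 (by exact_mod_cast hQL)
  have hi0 : (0 : ℝ) ≤ i := Nat.cast_nonneg _
  have hden : 0 < ((i : ℝ) + 1) * (L - Q + i + 1) := by positivity
  rw [← mul_le_mul_iff_left₀ hden, hsucc]
  rw [mul_right_comm, mul_comm _ (hyperPmf K L Q i)]
  refine mul_le_mul_of_nonneg_left ?_ h0
  obtain ⟨hm1, hm2⟩ := abs_le.1 hmode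
  set P : ℝ := K + L + 2 with hP
  have hP0 : 0 < P := by positivity
  suffices h : 1 / w * (((i : ℝ) + 1) * (L - Q + i + 1)) ≤ P * (hyperMode K L Q - i) by linarith
  have hiQ : (i : ℝ) ≤ Q := by exact_mod_cast hiK.trans hKQ
  have hK0 : (0 : ℝ) ≤ K := Nat.cast_nonneg _
  have hden2 : ((i : ℝ) + 1) * (L - Q + i + 1) ≤ w ^ 2 * P := by
    gcongr
    · linarith
    · linarith
  have h1 : 1 / w * (((i : ℝ) + 1) * (L - Q + i + 1)) ≤ 1 / w * (w ^ 2 * P) := by gcongr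
  have e : 1 / w * (w ^ 2 * P) = P * w := by field_simp
  have h2 : P * w ≤ P * (hyperMode K L Q - i) := by
    refine mul_le_mul_of_nonneg_left ?_ hP0.le
    linarith
  linarith

/-- Local upper bound: no point carries more than the order of the inverse standard deviation. -/
lemma hyperPmf_le (hKQ : K ≤ Q) (hQL : Q ≤ L) (hhalf : (K + L + 2 : ℝ) ≤ 2 * (L - Q))
    {d w : ℝ} (hw : 8 ≤ w) (hd : d = w ^ 2) (hmode : |hyperMode K L Q - d| ≤ w) (i : ℕ) :
    hyperPmf K L Q i ≤ 32 / w := by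
  have h := le_div_of_ratio (h := hyperPmf K L Q) (d := d) (w := w) (C := 8)
    (hyperPmf_nonneg K L Q) (sum_hyperPmf_le hKQ hQL) (by norm_num) hw (by nlinarith)
    (fun i hi => by
      have := hyperPmf_ratio_low hKQ hQL hhalf (A := 1) (by linarith) hd hmode zero_le_one i
        (by linarith)
      norm_num at this ⊢
      exact this)
    (fun i hi => hyperPmf_ratio_up hKQ hQL hhalf (by linarith) hd hmode i hi) i
  norm_num at h
  exact h

/-- Anti-concentration: a fixed number of standard deviations is exceeded with probability bounded
below. -/
lemma exists_le_sum_hyperPmf (B : ℝ) (hB : 0 ≤ B) :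
    ∃ δ w₀ : ℝ, 0 < δ ∧ ∀ (K L Q : ℕ) (d w : ℝ), K ≤ Q → Q ≤ L →
      (K + L + 2 : ℝ) ≤ 2 * (L - Q) → w₀ ≤ w → d = w ^ 2 → |hyperMode K L Q - d| ≤ w →
      ∀ b : ℕ, (b : ℝ) ≤ d + B * w → δ ≤ ∑ i ∈ Finset.Ico b (K + 1), hyperPmf K L Q i := by
  set C := 4 * (2 * B + 8 + 1) with hC
  refine ⟨Real.exp (-(2 * C * (B + 6))) / 4, 2 * C, by positivity, ?_⟩
  intro K L Q d w hKQ hQL hhalf hw hd hmode b hb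
  have hw' : 72 ≤ w := by linarith
  exact exp_le_sum_Ico (hyperPmf_nonneg K L Q) (fun i hi => hyperPmf_eq_zero (by omega))
    (sum_hyperPmf hKQ hQL) (by linarith) hB (by nlinarith) (by positivity) hw
    (hyperPmf_ratio_left hKQ hQL (by linarith) hd hmode)
    (hyperPmf_ratio_low hKQ hQL hhalf (by linarith) hd hmode (by positivity)) b hb

end Hyper

/-! ### The degree of the hub -/

lemma choose_two_sub_lt {n : ℕ} (hn : 2 ≤ n) : n - 1 ≤ n.choose 2 := by
  rw [Nat.choose_two_right, Nat.le_div_iff_mul_le two_pos, mul_comm]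
  exact Nat.mul_le_mul_right _ hn

/-- Reweighted by `hubRatio`, the degree of a vertex becomes `k` plus a hypergeometric variable: the
hub receives `k` planted edges and its share of the others. -/
lemma degPmf_mul_hubRatio {n k m i : ℕ} (hn : 2 ≤ n) (hkn : k ≤ n - 1)
    (hmN : m ≤ n.choose 2) (hi : k ≤ i) :
    degPmf n m i * hubRatio n k m i =
      hyperPmf (n - 1 - k) (n.choose 2 - (n - 1)) (m - k) (i - k) := by
  have hN := choose_two_sub_lt hn
  have h1 : ((n - 1).choose i : ℝ) * i.choose k = (n - 1).choose k * (n - 1 - k).choose (i - k) := by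
    exact_mod_cast Nat.choose_mul (n := n - 1) hi
  have p1 : ((n.choose 2).choose m : ℝ) ≠ 0 := by exact_mod_cast (Nat.choose_pos hmN).ne'
  have p2 : ((n - 1).choose k : ℝ) ≠ 0 := by exact_mod_cast (Nat.choose_pos hkn).ne'
  have p3 : ((n.choose 2 - k).choose (m - k) : ℝ) ≠ 0 := by
    exact_mod_cast (Nat.choose_pos (by omega)).ne'
  rw [degPmf, hubRatio, hyperPmf, show n - 1 - k + (n.choose 2 - (n - 1)) = n.choose 2 - k by omega,
    show m - k - (i - k) = m - i by omega]
  field_simp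
  linear_combination ((n.choose 2 - (n - 1)).choose (m - i) : ℝ) * h1

lemma hubRatio_eq_zero {n k m i : ℕ} (hi : i < k) : hubRatio n k m i = 0 := by
  simp [hubRatio, Nat.choose_eq_zero_of_lt hi]

lemma hubRatio_pos {n k m i : ℕ} (hkm : k ≤ m) (hkn : k ≤ n - 1) (hmN : m ≤ n.choose 2)
    (hi : k ≤ i) : 0 < hubRatio n k m i := by
  have p1 : (0 : ℝ) < (n.choose 2).choose m := by exact_mod_cast Nat.choose_pos hmN
  have p2 : (0 : ℝ) < (n - 1).choose k := by exact_mod_cast Nat.choose_pos hkn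
  have p3 : (0 : ℝ) < (n.choose 2 - k).choose (m - k) := by
    exact_mod_cast Nat.choose_pos (by omega)
  have p4 : (0 : ℝ) < i.choose k := by exact_mod_cast Nat.choose_pos hi
  unfold hubRatio
  positivity

lemma hubRatio_mul_choose (n k m i T : ℕ) :
    hubRatio n k m i * T.choose k = hubRatio n k m T * i.choose k := by
  unfold hubRatio
  ring

lemma truncMean_le {n k m T : ℕ} {δ : ℝ} (hn : 2 ≤ n) (hkn : k ≤ n - 1) (hnm : n - 1 ≤ m)
    (hmN : m ≤ n.choose 2) (hQL : m - k ≤ n.choose 2 - (n - 1)) (hkT : k ≤ T) (hTn : T ≤ n)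
    (hδ : δ ≤ ∑ i ∈ Finset.Ico (T - k) (n - 1 - k + 1),
      hyperPmf (n - 1 - k) (n.choose 2 - (n - 1)) (m - k) i) :
    truncMean n k m T ≤ 1 - δ := by
  rw [truncMean_eq (by omega) hnm hTn, Finset.range_eq_Ico,
    ← Finset.sum_Ico_consecutive _ (Nat.zero_le k) hkT]
  have h1 : ∑ i ∈ Finset.Ico 0 k, degPmf n m i * hubRatio n k m i = 0 :=
    Finset.sum_eq_zero fun i hi => by
      rw [hubRatio_eq_zero (Finset.mem_Ico.1 hi).2, mul_zero]
  have h2 : ∑ i ∈ Finset.Ico k T, degPmf n m i * hubRatio n k m i =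
      ∑ i ∈ Finset.range (T - k), hyperPmf (n - 1 - k) (n.choose 2 - (n - 1)) (m - k) i := by
    rw [Finset.sum_Ico_eq_sum_range]
    refine Finset.sum_congr rfl fun i _ => ?_
    rw [degPmf_mul_hubRatio hn hkn hmN (by omega), Nat.add_sub_cancel_left]
  have h3 := sum_hyperPmf (K := n - 1 - k) (L := n.choose 2 - (n - 1)) (Q := m - k)
    (by omega) hQL
  rw [← Finset.sum_range_add_sum_Ico _ (show T - k ≤ n - 1 - k + 1 by omega)] at h3
  rw [h1, h2]
  linarith

/-- The sum telescopes, since `1 / C(a,k)` is a difference of consecutive values of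
`a / ((k-1) C(a,k))`. -/
lemma sum_Ico_inv_choose_le {k T : ℕ} (hk : 2 ≤ k) (hT : k ≤ T) (n : ℕ) :
    ∑ i ∈ Finset.Ico T n, ((i.choose k : ℕ) : ℝ)⁻¹ ≤ T / ((k - 1) * T.choose k) := by
  have hk' : (0 : ℝ) < k - 1 := by
    have : (2 : ℝ) ≤ k := by exact_mod_cast hk
    linarith
  have hF : ∀ i, k ≤ i → ((i.choose k : ℕ) : ℝ)⁻¹ =
      i / ((k - 1) * i.choose k) - (i + 1 : ℕ) / ((k - 1) * (i + 1).choose k) := by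
    intro i hi
    have p1 : (0 : ℝ) < i.choose k := by exact_mod_cast Nat.choose_pos hi
    have p2 : (0 : ℝ) < (i + 1).choose k := by exact_mod_cast Nat.choose_pos (by omega)
    have h1 : (i + 1).choose k * (i + 1 - k) = i.choose k * (i + 1) := by
      have := Nat.choose_mul_succ_eq i k
      omega
    have h1' : ((i + 1).choose k : ℝ) * (i + 1 - k) = i.choose k * (i + 1) := by
      have e : ((i + 1 - k : ℕ) : ℝ) = i + 1 - k := by rw [Nat.cast_sub (by omega)]; push_cast; ring
      rw [← e]; exact_mod_cast h1
    push_cast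
    rw [div_sub_div _ _ (by positivity) (by positivity), inv_eq_one_div, div_eq_div_iff
      (by positivity) (by positivity)]
    linear_combination -((k : ℝ) - 1) * i.choose k * h1'
  by_cases hTn : T ≤ n
  · have h2 : ∀ n, T ≤ n → ∑ i ∈ Finset.Ico T n, ((i.choose k : ℕ) : ℝ)⁻¹ =
        T / ((k - 1) * T.choose k) - n / ((k - 1) * n.choose k) := by
      intro n hn
      induction n, hn using Nat.le_induction with
      | base => simp
      | succ n hn ih =>
        rw [Finset.sum_Ico_succ_top hn, ih, hF n (by omega)]
        ring
    rw [h2 n hTn]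
    have : (0 : ℝ) ≤ n / ((k - 1) * n.choose k) := by positivity
    linarith
  · rw [Finset.Ico_eq_empty (by omega), Finset.sum_empty]
    positivity

lemma sum_range_choose_mul (k T : ℕ) :
    (∑ i ∈ Finset.range T, (i.choose k : ℝ)) * (k + 1) = T.choose k * (T - k) := by
  induction T with
  | zero =>
    rcases Nat.eq_zero_or_pos k with rfl | hk
    · simp
    · simp [Nat.choose_eq_zero_of_lt hk]
  | succ T ih =>
    rw [Finset.sum_range_succ, add_mul, ih]
    have h : ((T + 1).choose k : ℝ) * (T + 1 - k) = T.choose k * (T + 1) := by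
      by_cases hk : k ≤ T + 1
      · have e : ((T + 1 - k : ℕ) : ℝ) = T + 1 - k := by
          rw [Nat.cast_sub hk]; push_cast; ring
        rw [← e]
        have := Nat.choose_mul_succ_eq T k
        exact_mod_cast this.symm
      · simp [Nat.choose_eq_zero_of_lt (show T + 1 < k by omega),
          Nat.choose_eq_zero_of_lt (show T < k by omega)]
    push_cast
    linear_combination -h

/-- If the hub degree has bounded density `b`, the null tail of a degree is at most `b` divided by
the likelihood ratio at the threshold, up to the factor `T / (k - 1)`. -/
lemma sum_Ico_degPmf_le {n k m T : ℕ} {b : ℝ} (hn : 2 ≤ n) (hk : 2 ≤ k) (hkm : k ≤ m)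
    (hkn : k ≤ n - 1) (hmN : m ≤ n.choose 2) (hkT : k ≤ T)
    (hb : ∀ i, hyperPmf (n - 1 - k) (n.choose 2 - (n - 1)) (m - k) i ≤ b) :
    ∑ i ∈ Finset.Ico T n, degPmf n m i ≤ b * (T / ((k - 1) * hubRatio n k m T)) := by
  have hb0 : 0 ≤ b := (hyperPmf_nonneg _ _ _ 0).trans (hb 0)
  have pT : (0 : ℝ) < T.choose k := by exact_mod_cast Nat.choose_pos hkT
  have hT := hubRatio_pos hkm hkn hmN hkT
  have h1 : ∀ i ∈ Finset.Ico T n, degPmf n m i ≤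
      b * (T.choose k / hubRatio n k m T) * ((i.choose k : ℕ) : ℝ)⁻¹ := by
    intro i hi
    have hki : k ≤ i := hkT.trans (Finset.mem_Ico.1 hi).1
    have pi : (0 : ℝ) < i.choose k := by exact_mod_cast Nat.choose_pos hki
    have h2 := degPmf_mul_hubRatio hn hkn hmN hki
    have h3 := hb (i - k)
    rw [← h2] at h3
    have h4 := hubRatio_mul_choose n k m i T
    have h5 := hubRatio_pos hkm hkn hmN hki
    have h6 : hubRatio n k m i = hubRatio n k m T * i.choose k / T.choose k := by
      rw [← h4]; field_simp
    rw [h6] at h3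
    rw [mul_div_assoc', div_mul_eq_mul_div, le_div_iff₀ hT, ← div_eq_mul_inv, le_div_iff₀ pi]
    rw [mul_div_assoc', div_le_iff₀ pT] at h3
    linarith
  refine (Finset.sum_le_sum h1).trans ?_
  rw [← Finset.mul_sum]
  have h7 := sum_Ico_inv_choose_le hk hkT n
  have hk' : (0 : ℝ) < k - 1 := by
    have : (2 : ℝ) ≤ k := by exact_mod_cast hk
    linarith
  calc b * (T.choose k / hubRatio n k m T) * ∑ i ∈ Finset.Ico T n, ((i.choose k : ℕ) : ℝ)⁻¹
      ≤ b * (T.choose k / hubRatio n k m T) * (T / ((k - 1) * T.choose k)) := by gcongr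
    _ = b * (T / ((k - 1) * hubRatio n k m T)) := by field_simp

lemma sum_range_degPmf_mul_sq_le {n k m T : ℕ} {b : ℝ} (hn : 2 ≤ n)
    (hkn : k ≤ n - 1) (hmN : m ≤ n.choose 2) (hkT : k ≤ T)
    (hb : ∀ i, hyperPmf (n - 1 - k) (n.choose 2 - (n - 1)) (m - k) i ≤ b) :
    ∑ i ∈ Finset.range T, degPmf n m i * hubRatio n k m i ^ 2 ≤
      b * (hubRatio n k m T * T / (k + 1)) := by
  have hb0 : 0 ≤ b := (hyperPmf_nonneg _ _ _ 0).trans (hb 0)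
  have pT : (0 : ℝ) < T.choose k := by exact_mod_cast Nat.choose_pos hkT
  have hT := hubRatio_nonneg n k m T
  have h1 : ∀ i ∈ Finset.range T, degPmf n m i * hubRatio n k m i ^ 2 ≤
      b * (hubRatio n k m T / T.choose k) * i.choose k := by
    intro i _
    rcases lt_or_ge i k with hi | hi
    · rw [hubRatio_eq_zero hi]
      have : 0 ≤ b * (hubRatio n k m T / T.choose k) * i.choose k := by positivity
      simpa using this
    · have h3 := hb (i - k)
      rw [← degPmf_mul_hubRatio hn hkn hmN hi] at h3
      have h4 := hubRatio_mul_choose n k m i T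
      have h6 : hubRatio n k m i = hubRatio n k m T * i.choose k / T.choose k := by
        rw [← h4]; field_simp
      calc degPmf n m i * hubRatio n k m i ^ 2
          = degPmf n m i * hubRatio n k m i * hubRatio n k m i := by ring
        _ ≤ b * hubRatio n k m i := mul_le_mul_of_nonneg_right h3 (hubRatio_nonneg ..)
        _ = b * (hubRatio n k m T / T.choose k) * i.choose k := by rw [h6]; ring
  refine (Finset.sum_le_sum h1).trans ?_
  rw [← Finset.mul_sum]
  have h7 := sum_range_choose_mul k T
  have hk1 : (0 : ℝ) < k + 1 := by positivity
  rw [← eq_div_iff hk1.ne'] at h7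
  rw [h7]
  calc b * (hubRatio n k m T / T.choose k) * (T.choose k * (T - k) / (k + 1))
      = b * (hubRatio n k m T * (T - k) / (k + 1)) := by field_simp
    _ ≤ b * (hubRatio n k m T * T / (k + 1)) := by
      gcongr
      have : (0 : ℝ) ≤ k := Nat.cast_nonneg _
      linarith

/-! ### Two degrees are almost independent -/

lemma choose_succ_mul_real {a b : ℕ} (h : b ≤ a) :
    (a.choose (b + 1) : ℝ) * (b + 1) = a.choose b * (a - b) := by
  have e : ((a - b : ℕ) : ℝ) = a - b := by rw [Nat.cast_sub h]
  rw [← e]; exact_mod_cast Nat.choose_succ_right_eq a b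

/-- Among products `C(x,m) C(y,m)` with `x + y` fixed, balanced ones are largest. -/
lemma choose_mul_choose_le {M₁ M₂ N : ℕ} (h : M₂ + N = 2 * M₁ + 1) (h2 : M₂ ≤ M₁) (m : ℕ)
    (hm : m ≤ M₂) :
    (M₂.choose m : ℝ) * N.choose m ≤ M₁.choose m * (M₁ + 1).choose m := by
  induction m with
  | zero => simp
  | succ m ih =>
    have ih := ih (by omega)
    have e1 := choose_succ_mul_real (show m ≤ M₂ by omega)
    have e2 := choose_succ_mul_real (show m ≤ N by omega)
    have e3 := choose_succ_mul_real (show m ≤ M₁ by omega)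
    have e4 := choose_succ_mul_real (show m ≤ M₁ + 1 by omega)
    have hN : (N : ℝ) = 2 * M₁ + 1 - M₂ := by
      have : (M₂ : ℝ) + N = 2 * M₁ + 1 := by exact_mod_cast h
      linarith
    have hc : (M₂ : ℝ) ≤ M₁ := by exact_mod_cast h2
    have hm' : (m : ℝ) + 1 ≤ M₂ := by exact_mod_cast hm
    have hpos : (0 : ℝ) < ((m : ℝ) + 1) * (m + 1) := by positivity
    rw [← mul_le_mul_iff_left₀ hpos]
    calc (M₂.choose (m + 1) : ℝ) * N.choose (m + 1) * ((m + 1) * (m + 1))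
        = (M₂.choose (m + 1) * (m + 1)) * (N.choose (m + 1) * (m + 1)) := by ring
      _ = (M₂.choose m * N.choose m) * ((M₂ - m) * (N - m)) := by rw [e1, e2]; ring
      _ ≤ (M₁.choose m * (M₁ + 1).choose m) * ((M₁ - m) * ((M₁ + 1 : ℕ) - m)) := by
          push_cast
          refine mul_le_mul ih ?_ ?_ (by positivity)
          · rw [hN]; nlinarith
          · refine mul_nonneg (by linarith) ?_
            rw [hN]; linarith
      _ = (M₁.choose (m + 1) * (m + 1)) * ((M₁ + 1).choose (m + 1) * (m + 1)) := by
          rw [e3, e4]; ring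
      _ = _ := by ring

lemma choose_mul_choose_step {M₁ M₂ a b : ℕ} {β : ℝ} (hab : a ≤ b) (hb : b < M₂) (h2 : M₂ ≤ M₁)
    (hβ0 : 0 ≤ β) (hβ : (M₁ - M₂ : ℝ) ≤ β * (M₂ - b)) :
    (M₂.choose a : ℝ) * M₁.choose (b + 1) ≤ (1 + β) * (M₂.choose (a + 1) * M₁.choose b) := by
  have e1 := choose_succ_mul_real (show a ≤ M₂ by omega)
  have e2 := choose_succ_mul_real (show b ≤ M₁ by omega)
  have hab' : (a : ℝ) ≤ b := by exact_mod_cast hab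
  have hb' : (b : ℝ) + 1 ≤ M₂ := by exact_mod_cast hb
  have h2' : (M₂ : ℝ) ≤ M₁ := by exact_mod_cast h2
  have hpos : (0 : ℝ) < ((a : ℝ) + 1) * (b + 1) := by positivity
  rw [← mul_le_mul_iff_left₀ hpos]
  have hβ' : β * (M₂ - b) ≤ β * (M₂ - a) := by gcongr
  calc (M₂.choose a : ℝ) * M₁.choose (b + 1) * ((a + 1) * (b + 1))
      = M₂.choose a * (a + 1) * (M₁.choose (b + 1) * (b + 1)) := by ring
    _ = M₂.choose a * M₁.choose b * ((a + 1) * (M₁ - b)) := by rw [e2]; ring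
    _ ≤ M₂.choose a * M₁.choose b * ((b + 1) * ((1 + β) * (M₂ - a))) := by
        have : (0 : ℝ) ≤ M₁ - b := by linarith
        gcongr
        linarith
    _ = (1 + β) * (M₂.choose a * (M₂ - a) * M₁.choose b) * (b + 1) := by ring
    _ = (1 + β) * (M₂.choose (a + 1) * (a + 1) * M₁.choose b) * (b + 1) := by rw [e1]
    _ = _ := by ring

lemma choose_pair_le {M₁ M₂ N m : ℕ} {β : ℝ} (h : M₂ + N = 2 * M₁ + 1) (h2 : M₂ ≤ M₁)
    (hm : m < M₂) (hβ0 : 0 ≤ β) (hβ : (M₁ - M₂ : ℝ) ≤ β * (M₂ - m)) (i j : ℕ) (hij : i + j ≤ m) :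
    (M₂.choose (m - i - j) : ℝ) * N.choose m ≤
      (1 + β) ^ (i + j) * ((M₁ + 1) / (M₁ + 1 - m)) * (M₁.choose (m - i) * M₁.choose (m - j)) := by
  have hstep : ∀ a b : ℕ, a ≤ b → b + 1 ≤ m →
      (M₂.choose a : ℝ) * M₁.choose (b + 1) ≤ (1 + β) * (M₂.choose (a + 1) * M₁.choose b) := by
    intro a b hab hb
    refine choose_mul_choose_step hab (by omega) h2 hβ0 (hβ.trans ?_)
    have : (b : ℝ) + 1 ≤ m := by exact_mod_cast hb
    gcongr
    linarith
  have hm' : (m : ℝ) < M₁ + 1 := by exact_mod_cast (by omega : m < M₁ + 1)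
  have hτ : 0 ≤ ((M₁ : ℝ) + 1) / (M₁ + 1 - m) := div_nonneg (by positivity) (by linarith)
  set τ := ((M₁ : ℝ) + 1) / (M₁ + 1 - m) with hτ'
  have hzero : (M₂.choose m : ℝ) * N.choose m ≤ τ * (M₁.choose m * M₁.choose m) := by
    refine (choose_mul_choose_le h h2 m hm.le).trans (le_of_eq ?_)
    have e : ((M₁ + 1).choose m : ℝ) * (M₁ + 1 - m) = M₁.choose m * (M₁ + 1) := by
      have e' : ((M₁ + 1 - m : ℕ) : ℝ) = M₁ + 1 - m := by
        rw [Nat.cast_sub (by omega)]; push_cast; ring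
      rw [← e']
      exact_mod_cast (Nat.choose_mul_succ_eq M₁ m).symm
    rw [← eq_div_iff (by linarith)] at e
    rw [e, hτ']; ring
  -- one step lowers the index of `M₂` and one of the indices of `M₁` together
  have hcol : ∀ j, j ≤ m → (M₂.choose (m - j) : ℝ) * N.choose m ≤
      (1 + β) ^ j * τ * (M₁.choose m * M₁.choose (m - j)) := by
    intro j
    induction j with
    | zero => intro _; simpa using hzero
    | succ j ih =>
      intro hj
      have ih := ih (by omega)
      have hs := hstep (m - (j + 1)) (m - (j + 1)) le_rfl (by omega)
      rw [show m - (j + 1) + 1 = m - j by omega] at hs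
      have p : (0 : ℝ) < M₁.choose (m - j) := by exact_mod_cast Nat.choose_pos (by omega)
      rw [← mul_le_mul_iff_left₀ p]
      calc (M₂.choose (m - (j + 1)) : ℝ) * N.choose m * M₁.choose (m - j)
          = M₂.choose (m - (j + 1)) * M₁.choose (m - j) * N.choose m := by ring
        _ ≤ (1 + β) * (M₂.choose (m - j) * M₁.choose (m - (j + 1))) * N.choose m := by gcongr
        _ = (1 + β) * M₁.choose (m - (j + 1)) * (M₂.choose (m - j) * N.choose m) := by ring
        _ ≤ (1 + β) * M₁.choose (m - (j + 1)) *
            ((1 + β) ^ j * τ * (M₁.choose m * M₁.choose (m - j))) := by gcongr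
        _ = _ := by ring
  induction i with
  | zero => simpa using hcol j (by omega)
  | succ i ih =>
    have ih := ih (by omega)
    have hs := hstep (m - (i + 1) - j) (m - (i + 1)) (by omega) (by omega)
    rw [show m - (i + 1) + 1 = m - i by omega, show m - (i + 1) - j + 1 = m - i - j by omega] at hs
    have p : (0 : ℝ) < M₁.choose (m - i) := by exact_mod_cast Nat.choose_pos (by omega)
    rw [← mul_le_mul_iff_left₀ p]
    calc (M₂.choose (m - (i + 1) - j) : ℝ) * N.choose m * M₁.choose (m - i)
        = M₂.choose (m - (i + 1) - j) * M₁.choose (m - i) * N.choose m := by ring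
      _ ≤ (1 + β) * (M₂.choose (m - i - j) * M₁.choose (m - (i + 1))) * N.choose m := by gcongr
      _ = (1 + β) * M₁.choose (m - (i + 1)) * (M₂.choose (m - i - j) * N.choose m) := by ring
      _ ≤ (1 + β) * M₁.choose (m - (i + 1)) *
          ((1 + β) ^ (i + j) * τ * (M₁.choose (m - i) * M₁.choose (m - j))) := by gcongr
      _ = _ := by ring

/-- The joint law of two degrees is bounded by the product law, uniformly over all degrees below
`T`. -/
lemma degPairPmf_le {n m T : ℕ} {β : ℝ} (hn : 2 ≤ n) (hTm : 2 * T ≤ m)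
    (hm : m + 2 * n ≤ n.choose 2)
    (hβ0 : 0 ≤ β) (hβ : (n : ℝ) ≤ β * (n.choose 2 - 2 * n - m)) :
    ∀ i < T, ∀ j < T, degPairPmf n m i j ≤
      ((1 + β) ^ (2 * T) * ((n.choose 2 : ℝ) / (n.choose 2 - n - m)) *
        (1 + T ^ 2 * n.choose 2 / ((n - 1) ^ 2 * (m - 2 * T + 1)))) *
        (degPmf n m i * degPmf n m j) := by
  intro i hi j hj
  set N := n.choose 2 with hN
  set M₁ := N - (n - 1) with hM₁
  set M₂ := N + 1 - (n - 1) - (n - 1) with hM₂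
  have c1 : (M₁ : ℝ) = N - (n - 1) := by
    rw [hM₁, Nat.cast_sub (by omega), Nat.cast_sub (by omega)]; push_cast; ring
  have c2 : (M₂ : ℝ) = N + 1 - (n - 1) - (n - 1) := by
    rw [hM₂, Nat.cast_sub (by omega), Nat.cast_sub (by omega), Nat.cast_sub (by omega)]
    push_cast; ring
  have hn' : (2 : ℝ) ≤ n := by exact_mod_cast hn
  have hm' : (m : ℝ) + 2 * n ≤ N := by exact_mod_cast hm
  have hpair := choose_pair_le (M₁ := M₁) (M₂ := M₂) (N := N) (m := m) (β := β) (by omega)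
    (by omega) (by omega) hβ0 (by
      rw [c1, c2]
      have : β * (N - 2 * n - m) ≤ β * (N + 1 - (n - 1) - (n - 1) - m) :=
        mul_le_mul_of_nonneg_left (by linarith) hβ0
      linarith) i j (by omega)
  set X : ℝ := ((M₂.choose (m - i - j) : ℕ) : ℝ) with hX
  have hX0 : 0 ≤ X := Nat.cast_nonneg _
  have hTm' : 2 * (T : ℝ) ≤ m := by exact_mod_cast hTm
  have hiT : (i : ℝ) ≤ T := by exact_mod_cast hi.le
  have hjT : (j : ℝ) ≤ T := by exact_mod_cast hj.le
  set A : ℝ := (((n - 1).choose i : ℕ) : ℝ) with hA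
  set B : ℝ := (((n - 1).choose j : ℕ) : ℝ) with hB
  have hA0 : 0 ≤ A := Nat.cast_nonneg _
  have hB0 : 0 ≤ B := Nat.cast_nonneg _
  -- graphs without the edge between the two vertices
  have f1 : ((n - 2).choose i : ℝ) ≤ A := by
    rw [hA]; exact_mod_cast Nat.choose_le_choose i (by omega)
  have f2 : ((n - 2).choose j : ℝ) ≤ B := by
    rw [hB]; exact_mod_cast Nat.choose_le_choose j (by omega)
  -- graphs with the edge between the two vertices
  have g : ∀ i : ℕ, 1 ≤ i → ((n - 2).choose (i - 1) : ℝ) = (n - 1).choose i * i / (n - 1) := by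
    intro i hi
    have := Nat.add_one_mul_choose_eq (n - 2) (i - 1)
    rw [show n - 2 + 1 = n - 1 by omega, show i - 1 + 1 = i by omega] at this
    have c : ((n - 1 : ℕ) : ℝ) = n - 1 := by rw [Nat.cast_sub (by omega)]; simp
    rw [eq_div_iff (by linarith), ← c, mul_comm]
    exact_mod_cast this
  have hmT : (0 : ℝ) < m - 2 * T + 1 := by linarith
  have hX1 : (M₂.choose (m + 1 - i - j) : ℝ) ≤ X * (N / (m - 2 * T + 1)) := by
    have e := choose_succ_mul_real (a := M₂) (b := m - i - j) (by omega)
    rw [show m - i - j + 1 = m + 1 - i - j by omega] at e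
    have c : ((m - i - j : ℕ) : ℝ) = m - i - j := by
      rw [Nat.cast_sub (by omega), Nat.cast_sub (by omega)]
    rw [c, ← hX] at e
    have : 0 ≤ (M₂.choose (m + 1 - i - j) : ℝ) := Nat.cast_nonneg _
    rw [mul_div_assoc', le_div_iff₀ hmT]
    calc (M₂.choose (m + 1 - i - j) : ℝ) * (m - 2 * T + 1)
        ≤ M₂.choose (m + 1 - i - j) * (m - i - j + 1) :=
          mul_le_mul_of_nonneg_left (by linarith) this
      _ = X * (M₂ - (m - i - j)) := e
      _ ≤ X * N := mul_le_mul_of_nonneg_left (by rw [c2]; linarith) hX0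
  set η : ℝ := T ^ 2 * N / ((n - 1) ^ 2 * (m - 2 * T + 1)) with hη
  have hcount : (((n - 2).choose i * ((n - 2).choose j * M₂.choose (m - i - j)) +
      if 1 ≤ i ∧ 1 ≤ j then
        (n - 2).choose (i - 1) * ((n - 2).choose (j - 1) * M₂.choose (m + 1 - i - j))
      else 0 : ℕ) : ℝ) ≤ A * B * X * (1 + η) := by
    have h1 : ((n - 2).choose i : ℝ) * ((n - 2).choose j * X) ≤ A * (B * X) := by gcongr
    have h2 : ((if 1 ≤ i ∧ 1 ≤ j then
        (n - 2).choose (i - 1) * ((n - 2).choose (j - 1) * M₂.choose (m + 1 - i - j))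
      else 0 : ℕ) : ℝ) ≤ A * B * X * η := by
      split_ifs with hij
      · push_cast
        rw [g i hij.1, g j hij.2]
        have hn1 : (0 : ℝ) < n - 1 := by linarith
        calc A * i / (n - 1) * (B * j / (n - 1) * M₂.choose (m + 1 - i - j))
            ≤ A * T / (n - 1) * (B * T / (n - 1) * (X * (N / (m - 2 * T + 1)))) := by gcongr
          _ = A * B * X * η := by rw [hη]; field_simp
      · have : 0 ≤ η := by rw [hη]; positivity
        simp only [Nat.cast_zero]
        positivity
    rw [Nat.cast_add]
    push_cast at h1 h2 ⊢
    linarith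
  have hNm : (0 : ℝ) < (N.choose m : ℝ) := by exact_mod_cast Nat.choose_pos (by omega)
  have hη0 : 0 ≤ η := by rw [hη]; positivity
  rw [degPairPmf, div_le_iff₀ hNm]
  refine hcount.trans ?_
  have hτ : ((M₁ : ℝ) + 1) / (M₁ + 1 - m) ≤ N / (N - n - m) := by
    rw [c1]
    have : (0 : ℝ) < N - n - m := by linarith
    refine div_le_div₀ (by positivity) (by linarith) this (by linarith)
  have hpow : (1 + β) ^ (i + j) ≤ (1 + β) ^ (2 * T) :=
    pow_le_pow_right₀ (by linarith) (by omega)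
  have hpair2 : X * N.choose m ≤ (1 + β) ^ (2 * T) * (N / (N - n - m)) *
      (M₁.choose (m - i) * M₁.choose (m - j)) := by
    refine hpair.trans ?_
    have : (0 : ℝ) ≤ ((M₁ : ℝ) + 1) / (M₁ + 1 - m) := by
      rw [c1]; exact div_nonneg (by linarith) (by linarith)
    gcongr
  have hX2 : X ≤ (1 + β) ^ (2 * T) * (N / (N - n - m)) *
      (M₁.choose (m - i) * M₁.choose (m - j)) / N.choose m := by
    rwa [le_div_iff₀ hNm]
  calc A * B * X * (1 + η) ≤ A * B * ((1 + β) ^ (2 * T) * (N / (N - n - m)) *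
      (M₁.choose (m - i) * M₁.choose (m - j)) / N.choose m) * (1 + η) := by gcongr
    _ = _ := by
      rw [degPmf, degPmf, ← hN, ← hM₁, ← hA, ← hB]
      generalize (1 + β) ^ (2 * T) * ((N : ℝ) / (N - n - m)) = ρ
      generalize (M₁.choose (m - i) : ℝ) = x
      generalize (M₁.choose (m - j) : ℝ) = y
      generalize (N.choose m : ℝ) = z at hNm ⊢
      field_simp

/-! ### Size of the likelihood ratio -/

lemma cast_choose_eq_prod {a k : ℕ} (h : k ≤ a) :
    (a.choose k : ℝ) * k.factorial = ∏ i ∈ Finset.range k, ((a : ℝ) - i) := by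
  have h1 : a.choose k * k.factorial = ∏ i ∈ Finset.range k, (a - i) := by
    rw [← Nat.descFactorial_eq_prod_range, Nat.descFactorial_eq_factorial_mul_choose, mul_comm]
  have h2 : (a.choose k : ℝ) * k.factorial = ((∏ i ∈ Finset.range k, (a - i) : ℕ) : ℝ) := by
    rw [← h1]; push_cast; ring
  rw [h2, Nat.cast_prod]
  refine Finset.prod_congr rfl fun i hi => ?_
  rw [Nat.cast_sub (by have := Finset.mem_range.1 hi; omega)]

lemma hubRatio_eq_prod {n k m T : ℕ} (hn : 2 ≤ n) (hkn : k ≤ n - 1) (hkm : k ≤ m)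
    (hmN : m ≤ n.choose 2) (hkT : k ≤ T) :
    hubRatio n k m T = ∏ i ∈ Finset.range k,
      (((T : ℝ) - i) * (n.choose 2 - i) / ((n - 1 - i) * (m - i))) := by
  have hc : ((n.choose 2).choose m : ℝ) * m.choose k =
      (n.choose 2).choose k * (n.choose 2 - k).choose (m - k) := by
    exact_mod_cast Nat.choose_mul (n := n.choose 2) hkm
  have f : (k.factorial : ℝ) ≠ 0 := by exact_mod_cast k.factorial_ne_zero
  have p1 : ((n - 1).choose k : ℝ) ≠ 0 := by exact_mod_cast (Nat.choose_pos hkn).ne'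
  have p2 : (m.choose k : ℝ) ≠ 0 := by exact_mod_cast (Nat.choose_pos hkm).ne'
  have p3 : ((n.choose 2 - k).choose (m - k) : ℝ) ≠ 0 := by
    exact_mod_cast (Nat.choose_pos (by omega)).ne'
  have e : ((n - 1 : ℕ) : ℝ) = n - 1 := by rw [Nat.cast_sub (by omega)]; simp
  rw [Finset.prod_div_distrib, Finset.prod_mul_distrib, Finset.prod_mul_distrib,
    ← cast_choose_eq_prod hkT, ← cast_choose_eq_prod hkm,
    ← cast_choose_eq_prod (hkm.trans hmN), ← e, ← cast_choose_eq_prod hkn, hubRatio]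
  field_simp
  linear_combination (T.choose k : ℝ) * hc

/-- The average degree. -/
noncomputable def avgDeg (n m : ℕ) : ℝ := 2 * m / n

lemma cast_choose_two (n : ℕ) : (n.choose 2 : ℝ) = n * (n - 1) / 2 := Nat.cast_choose_two ℝ n

lemma sum_range_deviation (k : ℕ) {d : ℝ} (hd : d ≠ 0) (T : ℝ) :
    ∑ i ∈ Finset.range k, ((T - d - i) / d) = k * (T - d) / d - k * (k - 1) / (2 * d) := by
  induction k with
  | zero => simp
  | succ k ih =>
    rw [Finset.sum_range_succ, ih]
    push_cast
    field_simp
    ring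

lemma inv_one_sub_le_exp {x : ℝ} (hx : 0 ≤ x) (hx' : x ≤ 1 / 2) : (1 - x)⁻¹ ≤ Real.exp (2 * x) := by
  have h2 : 1 + 2 * x ≤ Real.exp (2 * x) := by linarith [Real.add_one_le_exp (2 * x)]
  refine le_trans ?_ h2
  rw [inv_le_iff_one_le_mul₀ (by linarith)]
  nlinarith

lemma exp_sub_sq_le {y : ℝ} (hy : |y| ≤ 1 / 8) : Real.exp (y - 2 * y ^ 2) ≤ 1 + y := by
  obtain ⟨h1, h2⟩ := abs_le.1 hy
  have h3 := (abs_le.1 (Real.abs_exp_sub_one_sub_id_le (x := y - 2 * y ^ 2)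
    (by rw [abs_le]; constructor <;> nlinarith))).2
  have h4 : (y - 2 * y ^ 2) ^ 2 ≤ 2 * y ^ 2 := by
    have : (1 - 2 * y) ^ 2 ≤ 2 := by nlinarith
    calc (y - 2 * y ^ 2) ^ 2 = (1 - 2 * y) ^ 2 * y ^ 2 := by ring
      _ ≤ 2 * y ^ 2 := by gcongr
  linarith

/-- Upper bound for the likelihood ratio at hub degree `T`. -/
lemma hubRatio_le {n k m T : ℕ} (hn : 2 ≤ n) (hkn : 2 * k ≤ n - 1) (hnm : n - 1 ≤ m)
    (hmN : m ≤ n.choose 2) (hkT : k ≤ T) :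
    hubRatio n k m T ≤ Real.exp (k * (T - avgDeg n m) / avgDeg n m -
      k * (k - 1) / (2 * avgDeg n m) + 4 * k ^ 2 / (n - 1)) := by
  have hn' : (2 : ℝ) ≤ n := by exact_mod_cast hn
  have hn1 : (0 : ℝ) < n - 1 := by linarith
  have hkn' : 2 * (k : ℝ) ≤ n - 1 := by
    have : ((2 * k : ℕ) : ℝ) ≤ ((n - 1 : ℕ) : ℝ) := by exact_mod_cast hkn
    rw [Nat.cast_sub (by omega)] at this
    push_cast at this; linarith
  have hnm' : (n : ℝ) - 1 ≤ m := by
    have : ((n - 1 : ℕ) : ℝ) ≤ m := by exact_mod_cast hnm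
    rw [Nat.cast_sub (by omega)] at this
    simpa using this
  have hm0 : (0 : ℝ) < m := by linarith
  have hd : 0 < avgDeg n m := by unfold avgDeg; positivity
  have hN := cast_choose_two n
  rw [hubRatio_eq_prod hn (by omega) (by omega) hmN hkT]
  set d := avgDeg n m with hd'
  have hdN : d * (n.choose 2 : ℝ) = (n - 1) * m := by
    rw [hd', avgDeg, hN]; field_simp
  have hNm : (m : ℝ) ≤ n.choose 2 := by exact_mod_cast hmN
  set N : ℝ := (n.choose 2 : ℝ) with hN'
  have key : ∀ i ∈ Finset.range k, ((T : ℝ) - i) * (N - i) / ((n - 1 - i) * (m - i)) ≤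
      Real.exp ((T - d - i) / d + 4 * k / (n - 1)) := by
    intro i hi
    have hik : (i : ℝ) + 1 ≤ k := by exact_mod_cast Finset.mem_range.1 hi
    have hkT' : (k : ℝ) ≤ T := by exact_mod_cast hkT
    have hi0 : (0 : ℝ) ≤ i := Nat.cast_nonneg _
    have e : ((T : ℝ) - i) * (N - i) / ((n - 1 - i) * (m - i)) =
        (((T : ℝ) - i) / d) * (1 - (i : ℝ) / N) * (1 - (i : ℝ) / (n - 1))⁻¹ *
          (1 - (i : ℝ) / m)⁻¹ := by
      have hN0 : 0 < N := by linarith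
      have a1 : (n : ℝ) - 1 - i ≠ 0 := by linarith
      have a2 : (m : ℝ) - i ≠ 0 := by linarith
      have e1 : (1 - (i : ℝ) / (n - 1))⁻¹ = (n - 1) / (n - 1 - i) := by
        rw [one_sub_div hn1.ne', inv_div]
      have e2 : (1 - (i : ℝ) / m)⁻¹ = m / (m - i) := by
        rw [one_sub_div hm0.ne', inv_div]
      have e3 : 1 - (i : ℝ) / N = (N - i) / N := by rw [one_sub_div hN0.ne']
      rw [e1, e2, e3]
      rw [div_mul_div_comm, hdN, div_mul_div_comm, div_mul_div_comm,
        div_eq_div_iff (by positivity) (by positivity)]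
      ring
    rw [e]
    have b1 : ((T : ℝ) - i) / d ≤ Real.exp ((T - d - i) / d) := by
      refine le_trans (le_of_eq ?_) (Real.add_one_le_exp _)
      field_simp; ring
    have b2 : 1 - (i : ℝ) / N ≤ 1 := by
      have : 0 ≤ (i : ℝ) / N := by positivity
      linarith
    have b3 : (1 - (i : ℝ) / (n - 1))⁻¹ ≤ Real.exp (2 * (k / (n - 1))) := by
      refine (inv_one_sub_le_exp (by positivity) ?_).trans ?_
      · rw [div_le_iff₀ hn1]; linarith
      · rw [Real.exp_le_exp]
        have : (i : ℝ) / (n - 1) ≤ k / (n - 1) :=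
          div_le_div_of_nonneg_right (by linarith) hn1.le
        linarith
    have b4 : (1 - (i : ℝ) / m)⁻¹ ≤ Real.exp (2 * (k / (n - 1))) := by
      refine (inv_one_sub_le_exp (by positivity) ?_).trans ?_
      · rw [div_le_iff₀ hm0]; linarith
      · rw [Real.exp_le_exp]
        have : (i : ℝ) / m ≤ k / (n - 1) := div_le_div₀ (by positivity) (by linarith) hn1 hnm'
        linarith
    have c0 : 0 ≤ ((T : ℝ) - i) / d := div_nonneg (by linarith) hd.le
    have c3 : 0 ≤ (1 - (i : ℝ) / (n - 1))⁻¹ := by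
      rw [inv_nonneg, sub_nonneg, div_le_one hn1]; linarith
    have c4 : 0 ≤ (1 - (i : ℝ) / m)⁻¹ := by
      rw [inv_nonneg, sub_nonneg, div_le_one hm0]; linarith
    calc ((T : ℝ) - i) / d * (1 - (i : ℝ) / N) * (1 - (i : ℝ) / (n - 1))⁻¹ *
          (1 - (i : ℝ) / m)⁻¹
        ≤ ((T : ℝ) - i) / d * 1 * (1 - (i : ℝ) / (n - 1))⁻¹ * (1 - (i : ℝ) / m)⁻¹ := by gcongr
      _ ≤ Real.exp ((T - d - i) / d) * 1 * Real.exp (2 * (k / (n - 1))) *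
          Real.exp (2 * (k / (n - 1))) := by gcongr
      _ = _ := by
          rw [mul_one, ← Real.exp_add, ← Real.exp_add]; congr 1; ring
  refine (Finset.prod_le_prod (fun i hi => ?_) key).trans (le_of_eq ?_)
  · have hik : (i : ℝ) + 1 ≤ k := by exact_mod_cast Finset.mem_range.1 hi
    have hkT' : (k : ℝ) ≤ T := by exact_mod_cast hkT
    have hi0 : (0 : ℝ) ≤ i := Nat.cast_nonneg _
    exact div_nonneg (mul_nonneg (by linarith) (by linarith))
      (mul_nonneg (by linarith) (by linarith))
  · rw [← Real.exp_sum, Finset.sum_add_distrib, sum_range_deviation k hd.ne']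
    congr 1
    simp only [Finset.sum_const, Finset.card_range, nsmul_eq_mul]
    ring

/-- Lower bound for the likelihood ratio at hub degree `T`. -/
lemma le_hubRatio {n k m T : ℕ} {Y : ℝ} (hn : 2 ≤ n) (hkn : 2 * k ≤ n - 1) (hnm : n - 1 ≤ m)
    (hmN : m ≤ n.choose 2) (hkT : k ≤ T) (hY : Y ≤ 1 / 8)
    (hTY : |T - avgDeg n m| ≤ Y / 2 * avgDeg n m) (hkY : k ≤ Y / 2 * avgDeg n m) :
    Real.exp (k * (T - avgDeg n m) / avgDeg n m - k * (k - 1) / (2 * avgDeg n m) - k * (2 * Y ^ 2)) ≤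
      hubRatio n k m T := by
  have hn' : (2 : ℝ) ≤ n := by exact_mod_cast hn
  have hn1 : (0 : ℝ) < n - 1 := by linarith
  have hkn' : 2 * (k : ℝ) ≤ n - 1 := by
    have : ((2 * k : ℕ) : ℝ) ≤ ((n - 1 : ℕ) : ℝ) := by exact_mod_cast hkn
    rw [Nat.cast_sub (by omega)] at this
    push_cast at this; linarith
  have hnm' : (n : ℝ) - 1 ≤ m := by
    have : ((n - 1 : ℕ) : ℝ) ≤ m := by exact_mod_cast hnm
    rw [Nat.cast_sub (by omega)] at this
    simpa using this
  have hm0 : (0 : ℝ) < m := by linarith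
  have hd : 0 < avgDeg n m := by unfold avgDeg; positivity
  have hN := cast_choose_two n
  rw [hubRatio_eq_prod hn (by omega) (by omega) hmN hkT]
  set d := avgDeg n m with hd'
  have hdN : d * (n.choose 2 : ℝ) = (n - 1) * m := by
    rw [hd', avgDeg, hN]; field_simp
  have hNm : (m : ℝ) ≤ n.choose 2 := by exact_mod_cast hmN
  set N : ℝ := (n.choose 2 : ℝ) with hN'
  have key : ∀ i ∈ Finset.range k, Real.exp ((T - d - i) / d - 2 * Y ^ 2) ≤
      ((T : ℝ) - i) * (N - i) / ((n - 1 - i) * (m - i)) := by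
    intro i hi
    have hik : (i : ℝ) + 1 ≤ k := by exact_mod_cast Finset.mem_range.1 hi
    have hkT' : (k : ℝ) ≤ T := by exact_mod_cast hkT
    have hi0 : (0 : ℝ) ≤ i := Nat.cast_nonneg _
    have hy : |((T : ℝ) - d - i) / d| ≤ Y := by
      rw [abs_div, abs_of_pos hd, div_le_iff₀ hd]
      obtain ⟨h1, h2⟩ := abs_le.1 hTY
      rw [abs_le]
      constructor <;> linarith
    have h1 : Real.exp ((T - d - i) / d - 2 * Y ^ 2) ≤ ((T : ℝ) - i) / d := by
      have h2 := exp_sub_sq_le (hy.trans hY)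
      have h3 : 1 + ((T : ℝ) - d - i) / d = (T - i) / d := by field_simp; ring
      rw [h3] at h2
      refine le_trans ?_ h2
      rw [Real.exp_le_exp]
      have := sq_le_sq' (by linarith [(abs_le.1 hy).1]) (abs_le.1 hy).2
      linarith
    refine h1.trans ?_
    have a1 : (0 : ℝ) < n - 1 - i := by linarith
    have a2 : (0 : ℝ) < m - i := by linarith
    have hTi : (0 : ℝ) ≤ T - i := by linarith
    rw [div_le_div_iff₀ hd (by positivity), mul_assoc ((T : ℝ) - i)]
    refine mul_le_mul_of_nonneg_left ?_ hTi
    -- `(n-1-i)(m-i) ≤ (n-1)(m-i) ≤ d (N-i)` because `(n-1) m = d N` and `d ≤ n-1`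
    have hdn : d ≤ n - 1 := by
      by_contra hcon
      push Not at hcon
      nlinarith
    nlinarith
  refine le_trans (le_of_eq ?_) (Finset.prod_le_prod (fun i _ => (Real.exp_pos _).le) key)
  rw [← Real.exp_sum, Finset.sum_sub_distrib, sum_range_deviation k hd.ne']
  congr 1
  simp only [Finset.sum_const, Finset.card_range, nsmul_eq_mul]

/-! ### The critical regime -/

/-- The standardized threshold of the maximum-degree test, with variance proxy `d (1 - m/N)`. -/
noncomputable def stdThreshold (α : ℝ) (n : ℕ) : ℝ :=
  √(2 * Real.log n - 1 / α * Real.log (Real.log n))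

/-- The threshold in units of `√d`. -/
noncomputable def shrunkThreshold (α : ℝ) (n m : ℕ) : ℝ :=
  √(1 - m / (n.choose 2 : ℝ)) * stdThreshold α n

lemma shrunkThreshold_nonneg (α : ℝ) (n m : ℕ) : 0 ≤ shrunkThreshold α n m := by
  unfold shrunkThreshold stdThreshold; positivity

/-- The bounds at a fixed `n` that place `(n, k, m)` in the critical window: with
`d = avgDeg n m`, the number `k ^ 2 / d` agrees with `2 log n` up to `C √(log n)`. -/
structure Regime (α C : ℝ) (n k m : ℕ) : Prop where
  one_lt : 1 < α
  C_nonneg : 0 ≤ C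
  n_large : 100 ≤ n
  log_large : 100 ≤ Real.log n
  low : (k : ℝ) ^ 2 ≤ 4 * Real.log n * avgDeg n m
  high : Real.log n * avgDeg n m ≤ (k : ℝ) ^ 2
  crit : |(k : ℝ) ^ 2 - 2 * Real.log n * avgDeg n m| ≤ C * √(Real.log n) * avgDeg n m
  k_large : 1000 * Real.log n ^ 2 ≤ k
  k_small : 1000 * (k : ℝ) ^ 2 ≤ n
  loglog : Real.log (Real.log n) ≤ √(Real.log n) / 2
  C_small : C + 10 ≤ √(avgDeg n m)

namespace Regime

variable {α C : ℝ} {n k m : ℕ}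

lemma n_real (h : Regime α C n k m) : (100 : ℝ) ≤ n := by exact_mod_cast h.n_large

lemma k_pos (h : Regime α C n k m) : (0 : ℝ) < k := by
  have := h.k_large
  have := h.log_large
  nlinarith

lemma le_k (h : Regime α C n k m) : 100000 * Real.log n ≤ k := by
  have := h.k_large
  have := h.log_large
  nlinarith

lemma avgDeg_pos (h : Regime α C n k m) : 0 < avgDeg n m := by
  have h1 := h.k_pos
  have h2 := h.low
  have h3 := h.log_large
  by_contra hd
  push Not at hd
  have : 4 * Real.log n * avgDeg n m ≤ 0 := mul_nonpos_of_nonneg_of_nonpos (by linarith) hd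
  nlinarith

lemma m_eq (h : Regime α C n k m) : (m : ℝ) = avgDeg n m * n / 2 := by
  have := h.n_real
  unfold avgDeg
  field_simp

lemma sqrt_sq (h : Regime α C n k m) : √(avgDeg n m) ^ 2 = avgDeg n m := Real.sq_sqrt h.avgDeg_pos.le

lemma sqrt_log_sq (h : Regime α C n k m) : √(Real.log n) ^ 2 = Real.log n :=
  Real.sq_sqrt (by linarith [h.log_large])

lemma ten_le_sqrt_log (h : Regime α C n k m) : 10 ≤ √(Real.log n) :=
  Real.le_sqrt_of_sq_le (by linarith [h.log_large])

lemma sqrt_pos (h : Regime α C n k m) : 0 < √(avgDeg n m) := Real.sqrt_pos.2 h.avgDeg_pos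

/-- `k ≤ 2 √(log n) √d`. -/
lemma k_le (h : Regime α C n k m) : (k : ℝ) ≤ 2 * √(Real.log n) * √(avgDeg n m) := by
  refine le_of_sq_le_sq ?_ (by positivity)
  have := h.low
  calc (k : ℝ) ^ 2 ≤ 4 * Real.log n * avgDeg n m := this
    _ = _ := by rw [mul_pow, mul_pow, h.sqrt_sq, h.sqrt_log_sq]; ring

lemma le_k' (h : Regime α C n k m) : √(Real.log n) * √(avgDeg n m) ≤ k := by
  refine le_of_sq_le_sq ?_ h.k_pos.le
  have := h.high
  rw [mul_pow, h.sqrt_sq, h.sqrt_log_sq]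
  exact this

/-- `d ≥ 250 k log n`. -/
lemma le_avgDeg (h : Regime α C n k m) : 250 * (k : ℝ) * Real.log n ≤ avgDeg n m := by
  have h1 := h.low
  have h2 := h.k_large
  have h3 := h.log_large
  have h4 := h.k_pos
  have h5 : 1000 * Real.log n ^ 2 * k ≤ 4 * Real.log n * avgDeg n m := by nlinarith
  have h6 : Real.log n * (250 * (k : ℝ) * Real.log n) ≤ Real.log n * avgDeg n m := by nlinarith
  exact le_of_mul_le_mul_left h6 (by linarith)

lemma avgDeg_large (h : Regime α C n k m) : 1000 * Real.log n ≤ avgDeg n m := by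
  have h1 := h.le_avgDeg
  have h2 := h.le_k
  have h3 := h.log_large
  nlinarith

/-- `√d ≥ 500 log n`. -/
lemma le_sqrt (h : Regime α C n k m) : 500 * Real.log n ≤ √(avgDeg n m) := by
  refine Real.le_sqrt_of_sq_le ?_
  have h1 := h.le_avgDeg
  have h2 := h.k_large
  have h3 := h.log_large
  have h4 : 250 * (1000 * Real.log n ^ 2) * Real.log n ≤ avgDeg n m := by nlinarith
  nlinarith [sq_nonneg (Real.log n)]

/-- The average degree is small compared with `n / log n`. -/
lemma avgDeg_mul_log_le (h : Regime α C n k m) : 1000 * (avgDeg n m * Real.log n) ≤ n := by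
  have h1 := h.high
  have h2 := h.k_small
  linarith

lemma avgDeg_le (h : Regime α C n k m) : 100000 * avgDeg n m ≤ n := by
  have h1 := h.avgDeg_mul_log_le
  have h2 := h.log_large
  have h3 := h.avgDeg_pos
  nlinarith

lemma k_le_n (h : Regime α C n k m) : 1000 * (k : ℝ) ≤ n := by
  have h1 := h.k_small
  have h2 := h.le_k
  have h3 := h.log_large
  nlinarith

lemma n_le_m (h : Regime α C n k m) : 100 * n ≤ m := by
  have h1 := h.m_eq
  have h2 := h.avgDeg_large
  have h3 := h.log_large
  have h4 := h.n_real
  have : 100 * (n : ℝ) ≤ m := by nlinarith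
  exact_mod_cast this

lemma m_le (h : Regime α C n k m) : 100 * (m + n : ℝ) ≤ n.choose 2 := by
  rw [cast_choose_two]
  have h1 := h.m_eq
  have h2 := h.avgDeg_le
  have h4 := h.n_real
  have h5 := h.avgDeg_large
  have h6 := h.log_large
  have h7 : (100000 : ℝ) * 1000 ≤ n := by nlinarith
  nlinarith

lemma m_le_choose (h : Regime α C n k m) : m ≤ n.choose 2 := by
  have h1 := h.m_le
  have : (m : ℝ) ≤ n.choose 2 := by
    have : (0 : ℝ) ≤ m := Nat.cast_nonneg _
    have : (0 : ℝ) ≤ n := Nat.cast_nonneg _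
    linarith
  exact_mod_cast this

/-- The edge density `m/N = d/(n - 1)` is small compared with `1 / log n`. -/
lemma density_mul_log_le (h : Regime α C n k m) : m / (n.choose 2 : ℝ) * Real.log n ≤ 1 / 100 := by
  have h4 := h.n_real
  have h1 := h.m_eq
  have h2 := h.avgDeg_mul_log_le
  have h3 := h.log_large
  have hn : (0 : ℝ) < n * (n - 1) / 2 := by
    have : (0 : ℝ) < n - 1 := by linarith
    positivity
  rw [cast_choose_two, div_mul_eq_mul_div, div_le_iff₀ hn, h1]
  nlinarith

lemma density_le (h : Regime α C n k m) : m / (n.choose 2 : ℝ) ≤ 1 / 100 := by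
  have h1 := h.density_mul_log_le
  have h2 : 0 ≤ m / (n.choose 2 : ℝ) := by positivity
  have h3 := h.log_large
  nlinarith

lemma loglog_nonneg (h : Regime α C n k m) : 0 ≤ Real.log (Real.log n) :=
  Real.log_nonneg (by linarith [h.log_large])

lemma inv_alpha_mul_loglog (h : Regime α C n k m) : 0 ≤ 1 / α * Real.log (Real.log n) ∧
    1 / α * Real.log (Real.log n) ≤ √(Real.log n) / 2 := by
  have h1 := h.one_lt
  have h2 := h.loglog_nonneg
  have h3 := h.loglog
  have h4 : 0 < 1 / α := by positivity
  have h5 : 1 / α ≤ 1 := by rw [div_le_one (by linarith)]; exact h1.le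
  constructor
  · positivity
  · nlinarith

lemma stdThreshold_sq (h : Regime α C n k m) :
    stdThreshold α n ^ 2 = 2 * Real.log n - 1 / α * Real.log (Real.log n) := by
  obtain ⟨h1, h2⟩ := h.inv_alpha_mul_loglog
  refine Real.sq_sqrt ?_
  have h3 := h.sqrt_log_sq
  have h4 := h.ten_le_sqrt_log
  nlinarith

lemma shrunkThreshold_sq (h : Regime α C n k m) :
    shrunkThreshold α n m ^ 2 = (1 - m / (n.choose 2 : ℝ)) * stdThreshold α n ^ 2 := by
  rw [shrunkThreshold, mul_pow, Real.sq_sqrt]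
  linarith [h.density_le]

lemma threshold_eq (h : Regime α C n k m) :
    threshold α n m = avgDeg n m + √(avgDeg n m) * shrunkThreshold α n m := by
  rw [threshold, shrunkThreshold, ← mul_assoc, ← Real.sqrt_mul h.avgDeg_pos.le]
  rfl

/-- Passing from the variance `d` to `d (1 - m/N)` costs only a bounded amount in the exponent. -/
lemma shrunkThreshold_sq_bounds (h : Regime α C n k m) :
    stdThreshold α n ^ 2 - 1 ≤ shrunkThreshold α n m ^ 2 ∧
      shrunkThreshold α n m ^ 2 ≤ stdThreshold α n ^ 2 := by
  rw [h.shrunkThreshold_sq]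
  have h1 : 0 ≤ m / (n.choose 2 : ℝ) := by positivity
  have h2 := h.density_mul_log_le
  have h3 := h.stdThreshold_sq
  have h4 := h.inv_alpha_mul_loglog.1
  have h5 := h.log_large
  have h6 : 0 ≤ stdThreshold α n ^ 2 := sq_nonneg _
  constructor
  · have : m / (n.choose 2 : ℝ) * stdThreshold α n ^ 2 ≤
        m / (n.choose 2 : ℝ) * (2 * Real.log n) := by gcongr; linarith
    nlinarith
  · nlinarith

lemma sqrt_log_le_shrunkThreshold (h : Regime α C n k m) : √(Real.log n) ≤ shrunkThreshold α n m := by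
  refine le_of_sq_le_sq ?_ (shrunkThreshold_nonneg α n m)
  have h1 := h.shrunkThreshold_sq_bounds.1
  have h2 := h.stdThreshold_sq
  have h3 := h.inv_alpha_mul_loglog.2
  have h4 := h.sqrt_log_sq
  have h5 := h.ten_le_sqrt_log
  nlinarith

lemma shrunkThreshold_le (h : Regime α C n k m) : shrunkThreshold α n m ≤ 3 / 2 * √(Real.log n) := by
  refine le_of_sq_le_sq ?_ (by positivity)
  have h1 := h.shrunkThreshold_sq_bounds.2
  have h2 := h.stdThreshold_sq
  have h3 := h.inv_alpha_mul_loglog.1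
  have h4 := h.sqrt_log_sq
  have h5 := h.log_large
  nlinarith

/-- At criticality the shift `k / √d` of the hub degree agrees with the threshold up to a bounded
number of standard deviations. -/
lemma abs_shift_sub_threshold_le (h : Regime α C n k m) :
    |k / √(avgDeg n m) - shrunkThreshold α n m| ≤ C + 1 := by
  have hw := h.sqrt_pos
  have hd := h.avgDeg_pos
  set s := k / √(avgDeg n m) with hs
  set x := shrunkThreshold α n m with hx
  set r := √(Real.log n) with hr
  have hr10 : 10 ≤ r := h.ten_le_sqrt_log
  have hrx : r ≤ x := h.sqrt_log_le_shrunkThreshold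
  have hs0 : 0 ≤ s := by have := h.k_pos; positivity
  have hs2 : s ^ 2 * avgDeg n m = k ^ 2 := by
    rw [hs, div_pow, h.sqrt_sq]; field_simp
  have hr2 : r ^ 2 = Real.log n := h.sqrt_log_sq
  have h1 : |s ^ 2 - 2 * r ^ 2| ≤ C * r := by
    have := h.crit
    rw [← hs2, ← hr, ← hr2, ← sub_mul, abs_mul, abs_of_pos hd] at this
    exact le_of_mul_le_mul_right this hd
  have h2 := h.shrunkThreshold_sq_bounds
  rw [h.stdThreshold_sq, ← hr2] at h2
  obtain ⟨h3, h4⟩ := h.inv_alpha_mul_loglog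
  rw [← hr] at h4
  rw [← hr2] at h3 h4
  have h5 : |s ^ 2 - x ^ 2| ≤ (C + 1) * r := by
    rw [abs_le] at h1 ⊢
    constructor <;> linarith [h1.1, h1.2, h2.1, h2.2]
  have h6 : |s - x| * r ≤ (C + 1) * r := by
    calc |s - x| * r ≤ |s - x| * |s + x| := by
          gcongr; rw [abs_of_nonneg (by linarith)]; linarith
      _ = |s ^ 2 - x ^ 2| := by rw [← abs_mul]; congr 1; ring
      _ ≤ _ := h5
  exact le_of_mul_le_mul_right h6 (by linarith)

/-- The integer threshold, in terms of the degree. -/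
lemma ceil_bounds (h : Regime α C n k m) :
    avgDeg n m + √(avgDeg n m) * shrunkThreshold α n m ≤ (⌈threshold α n m⌉₊ : ℝ) ∧
    (⌈threshold α n m⌉₊ : ℝ) ≤ avgDeg n m + √(avgDeg n m) * shrunkThreshold α n m + 1 := by
  rw [h.threshold_eq]
  have h1 := shrunkThreshold_nonneg α n m
  have h2 := h.avgDeg_pos
  exact ⟨Nat.le_ceil _, (Nat.ceil_lt_add_one (by positivity)).le⟩

lemma abs_ceil_sub_le (h : Regime α C n k m) :
    |(⌈threshold α n m⌉₊ : ℝ) - avgDeg n m| ≤ 2 * √(Real.log n) * √(avgDeg n m) := by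
  obtain ⟨h1, h2⟩ := h.ceil_bounds
  have h3 := shrunkThreshold_nonneg α n m
  have h4 := h.shrunkThreshold_le
  have h5 := h.sqrt_pos
  have h6 := h.ten_le_sqrt_log
  have h7 := h.le_sqrt
  have h8 := h.log_large
  have h9 : √(avgDeg n m) * shrunkThreshold α n m ≤
    √(avgDeg n m) * (3 / 2 * √(Real.log n)) := by gcongr
  have h10 : 0 ≤ √(avgDeg n m) * shrunkThreshold α n m := by positivity
  rw [abs_le]
  constructor <;> nlinarith

lemma sqrt_log_mul_sqrt_le (h : Regime α C n k m) : 64 * (√(Real.log n) * √(avgDeg n m)) ≤ avgDeg n m := by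
  have h1 := h.sqrt_sq
  have h2 := h.le_sqrt
  have h3 := h.ten_le_sqrt_log
  have h4 := h.sqrt_log_sq
  have h5 : 64 * √(Real.log n) ≤ √(avgDeg n m) := by nlinarith
  nlinarith [h.sqrt_pos]

lemma ceil_le (h : Regime α C n k m) : (⌈threshold α n m⌉₊ : ℝ) ≤ 2 * avgDeg n m := by
  have h1 := (abs_le.1 h.abs_ceil_sub_le).2
  have h2 := h.sqrt_log_mul_sqrt_le
  have h3 := h.avgDeg_pos
  linarith

lemma le_ceil (h : Regime α C n k m) : avgDeg n m / 2 ≤ (⌈threshold α n m⌉₊ : ℝ) := by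
  have h1 := (abs_le.1 h.abs_ceil_sub_le).1
  have h2 := h.sqrt_log_mul_sqrt_le
  have h3 := h.avgDeg_pos
  linarith

lemma k_le_ceil (h : Regime α C n k m) : k ≤ ⌈threshold α n m⌉₊ := by
  have h1 := h.le_ceil
  have h2 := h.le_avgDeg
  have h3 := h.log_large
  have h4 := h.k_pos
  have : (k : ℝ) ≤ ⌈threshold α n m⌉₊ := by nlinarith
  exact_mod_cast this

lemma ceil_le_n (h : Regime α C n k m) : ⌈threshold α n m⌉₊ ≤ n := by
  have h1 := h.ceil_le
  have h2 := h.avgDeg_le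
  have h3 := h.avgDeg_pos
  have : (⌈threshold α n m⌉₊ : ℝ) ≤ n := by linarith
  exact_mod_cast this

lemma ceil_sub_le (h : Regime α C n k m) :
    (((⌈threshold α n m⌉₊ - k : ℕ)) : ℝ) ≤ avgDeg n m + (C + 2) * √(avgDeg n m) := by
  rw [Nat.cast_sub h.k_le_ceil]
  have h1 := h.ceil_bounds.2
  have h2 := (abs_le.1 h.abs_shift_sub_threshold_le).1
  have h3 := h.sqrt_pos
  have h4 : √(avgDeg n m) * (k / √(avgDeg n m)) = k := by field_simp
  have h5 := h.C_small
  have h6 := h.C_nonneg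
  nlinarith

/-- The logarithm of the likelihood ratio at the threshold, up to the small corrections, is
`s x - s² / 2 = x² / 2 - (s - x)² / 2` with `s` the shift and `x` the threshold in units of `√d`. -/
lemma exponent_bounds (h : Regime α C n k m) :
    stdThreshold α n ^ 2 / 2 - (1 + (C + 1) ^ 2 / 2) ≤
      k * (⌈threshold α n m⌉₊ - avgDeg n m) / avgDeg n m - k * (k - 1) / (2 * avgDeg n m) ∧
    k * (⌈threshold α n m⌉₊ - avgDeg n m) / avgDeg n m - k * (k - 1) / (2 * avgDeg n m) ≤
      stdThreshold α n ^ 2 / 2 + 2 := by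
  obtain ⟨h1, h2⟩ := h.ceil_bounds
  have hs := sq_le_sq' (abs_le.1 h.abs_shift_sub_threshold_le).1
    (abs_le.1 h.abs_shift_sub_threshold_le).2
  have hx := h.shrunkThreshold_sq_bounds
  have hw := h.sqrt_pos
  have hd := h.avgDeg_pos
  have hk := h.k_pos
  have hkd : k / avgDeg n m ≤ 1 := by
    rw [div_le_one hd]
    have := h.le_avgDeg
    have := h.log_large
    nlinarith
  have hkd0 : 0 ≤ k / avgDeg n m := by positivity
  set T : ℝ := (⌈threshold α n m⌉₊ : ℝ) with hT
  set x := shrunkThreshold α n m with hx'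
  set s := k / √(avgDeg n m) with hs'
  set θ := T - (avgDeg n m + √(avgDeg n m) * x) with hθ
  have e : k * (T - avgDeg n m) / avgDeg n m - k * (k - 1) / (2 * avgDeg n m) =
      x ^ 2 / 2 - (s - x) ^ 2 / 2 + (θ + 1 / 2) * (k / avgDeg n m) := by
    have e1 : T = θ + avgDeg n m + √(avgDeg n m) * x := by rw [hθ]; ring
    have e2 : s ^ 2 = k ^ 2 / avgDeg n m := by rw [hs', div_pow, h.sqrt_sq]
    have e3 : k * (√(avgDeg n m) * x) / avgDeg n m = s * x := by
      rw [hs']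
      nth_rewrite 2 [← h.sqrt_sq]
      field_simp
    rw [e1]
    calc k * (θ + avgDeg n m + √(avgDeg n m) * x - avgDeg n m) / avgDeg n m -
        k * (k - 1) / (2 * avgDeg n m) = k * (√(avgDeg n m) * x) / avgDeg n m -
          k ^ 2 / avgDeg n m / 2 + (θ + 1 / 2) * (k / avgDeg n m) := by field_simp; ring
      _ = _ := by rw [e3, ← e2]; ring
  have hθ0 : 0 ≤ θ := by rw [hθ]; linarith
  have hθ1 : θ ≤ 1 := by rw [hθ]; linarith
  have hb0 : 0 ≤ (θ + 1 / 2) * (k / avgDeg n m) := by positivity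
  have hb1 : (θ + 1 / 2) * (k / avgDeg n m) ≤ 2 := by nlinarith
  rw [e]
  have := sq_nonneg (s - x)
  constructor <;> linarith [hx.1, hx.2]

lemma nat_facts (h : Regime α C n k m) : 2 ≤ n ∧ 2 ≤ k ∧ 2 * k ≤ n - 1 ∧ n - 1 ≤ m ∧ k ≤ m ∧
    2 * ⌈threshold α n m⌉₊ ≤ m ∧ m - k ≤ n.choose 2 - (n - 1) ∧ m + 2 * n ≤ n.choose 2 := by
  have a1 := h.n_large
  have a2 : 2 ≤ k := by
    have := h.le_k
    have := h.log_large
    have : (2 : ℝ) ≤ k := by linarith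
    exact_mod_cast this
  have a3 : 1000 * k ≤ n := by exact_mod_cast h.k_le_n
  have a4 := h.n_le_m
  have a5 := h.ceil_le_n
  have a6 : 100 * (m + n) ≤ n.choose 2 := by exact_mod_cast h.m_le
  refine ⟨by omega, a2, by omega, by omega, by omega, by omega, by omega, by omega⟩

lemma exp_stdThreshold (h : Regime α C n k m) : Real.exp (stdThreshold α n ^ 2 / 2) =
    n * Real.exp (-(1 / (2 * α) * Real.log (Real.log n))) := by
  have hn : (0 : ℝ) < n := by linarith [h.n_real]
  have hα := h.one_lt
  rw [h.stdThreshold_sq]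
  have e : (n : ℝ) * Real.exp (-(1 / (2 * α) * Real.log (Real.log n))) =
      Real.exp (Real.log n + -(1 / (2 * α) * Real.log (Real.log n))) := by
    rw [Real.exp_add, Real.exp_log hn]
  rw [e]
  congr 1
  field_simp
  ring

lemma hubRatio_ceil_le (h : Regime α C n k m) : hubRatio n k m ⌈threshold α n m⌉₊ ≤
    Real.exp 3 * (n * Real.exp (-(1 / (2 * α) * Real.log (Real.log n)))) := by
  obtain ⟨f1, f2, f3, f4, f5, f6, f7, f8⟩ := h.nat_facts
  refine (hubRatio_le f1 f3 f4 h.m_le_choose h.k_le_ceil).trans ?_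
  rw [← h.exp_stdThreshold, ← Real.exp_add, Real.exp_le_exp]
  have h1 := h.exponent_bounds.2
  have h2 : 4 * (k : ℝ) ^ 2 / (n - 1) ≤ 1 := by
    have := h.k_small
    have := h.n_real
    rw [div_le_one (by linarith)]
    linarith
  linarith

lemma le_hubRatio_ceil (h : Regime α C n k m) : Real.exp (-(2 + (C + 1) ^ 2 / 2)) *
    (n * Real.exp (-(1 / (2 * α) * Real.log (Real.log n)))) ≤
      hubRatio n k m ⌈threshold α n m⌉₊ := by
  obtain ⟨f1, f2, f3, f4, f5, f6, f7, f8⟩ := h.nat_facts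
  have hw := h.sqrt_pos
  have hd := h.avgDeg_pos
  have hr := h.ten_le_sqrt_log
  have hd2 := h.sqrt_sq
  have e : (4 * √(Real.log n) / √(avgDeg n m)) / 2 * avgDeg n m =
      2 * √(Real.log n) * √(avgDeg n m) := by
    nth_rewrite 2 [← hd2]
    field_simp; norm_num
  refine le_trans ?_ (le_hubRatio (Y := 4 * √(Real.log n) / √(avgDeg n m)) f1 f3 f4
    h.m_le_choose h.k_le_ceil ?_ ?_ ?_)
  · rw [← h.exp_stdThreshold, ← Real.exp_add, Real.exp_le_exp]
    have h1 := h.exponent_bounds.1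
    have h2 : (k : ℝ) * (2 * (4 * √(Real.log n) / √(avgDeg n m)) ^ 2) ≤ 1 := by
      rw [div_pow, mul_pow, h.sqrt_log_sq, hd2]
      have := h.le_avgDeg
      rw [mul_div_assoc', mul_div_assoc', div_le_one hd]
      linarith
    linarith
  · rw [div_le_iff₀ hw]
    have h1 := h.sqrt_log_mul_sqrt_le
    have : 64 * √(Real.log n) ≤ √(avgDeg n m) := by
      refine le_of_mul_le_mul_right ?_ hw
      nlinarith
    linarith
  · rw [e]; exact h.abs_ceil_sub_le
  · rw [e]; exact h.k_le

end Regime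

/-! ### Error bounds in the critical regime -/

namespace Regime

variable {α C : ℝ} {n k m : ℕ}

lemma hyper_facts (h : Regime α C n k m) :
    n - 1 - k ≤ m - k ∧ m - k ≤ n.choose 2 - (n - 1) ∧
    (((n - 1 - k : ℕ) : ℝ) + ((n.choose 2 - (n - 1) : ℕ) : ℝ) + 2 ≤
      2 * (((n.choose 2 - (n - 1) : ℕ) : ℝ) - ((m - k : ℕ) : ℝ))) ∧
    |hyperMode (n - 1 - k) (n.choose 2 - (n - 1)) (m - k) - avgDeg n m| ≤ √(avgDeg n m) := by
  obtain ⟨f1, f2, f3, f4, f5, f6, f7, f8⟩ := h.nat_facts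
  have g1 : 100 * (m + n) ≤ n.choose 2 := by exact_mod_cast h.m_le
  have c1 : ((n - 1 - k : ℕ) : ℝ) = n - 1 - k := by
    rw [Nat.cast_sub (by omega), Nat.cast_sub (by omega)]; simp
  have c2 : ((n.choose 2 - (n - 1) : ℕ) : ℝ) = n.choose 2 - (n - 1) := by
    rw [Nat.cast_sub (by omega), Nat.cast_sub (by omega)]; simp
  have c3 : ((m - k : ℕ) : ℝ) = m - k := by rw [Nat.cast_sub (by omega)]
  refine ⟨by omega, f7, ?_, ?_⟩
  · rw [c1, c2, c3]
    have := h.m_le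
    have := h.n_real
    have := h.k_pos
    have : (0 : ℝ) ≤ m := Nat.cast_nonneg _
    linarith
  · have hd := h.avgDeg_pos
    have hw := h.sqrt_pos
    have hn := h.n_real
    have hk := h.k_pos
    have hkn := h.k_le_n
    have hm := h.m_eq
    have hN := cast_choose_two n
    rw [hyperMode, c1, c2, c3]
    set d := avgDeg n m with hd'
    have hdN : d * (n.choose 2 : ℝ) = (n - 1) * m := by rw [hm, hN]; ring
    have hmN := h.m_le
    set N : ℝ := (n.choose 2 : ℝ) with hN'
    clear_value N
    have hm0 : (0 : ℝ) < m := by rw [hm]; positivity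
    have hP : N / 2 ≤ N - k + 2 := by nlinarith
    have hP0 : 0 < N - k + 2 := by nlinarith
    have e : ((n : ℝ) - 1 - k + 1) * (m - k + 1) / (n - 1 - k + (N - (n - 1)) + 2) - 1 - d =
        (m * (1 - k) + (n - k) * (1 - k) + d * (k - 2)) / (N - k + 2) - 1 := by
      have e1 : (n : ℝ) - 1 - k + (N - (n - 1)) + 2 = N - k + 2 := by ring
      rw [e1, sub_right_comm, div_sub' hP0.ne']
      congr 2
      linear_combination -hdN
    rw [e]
    -- the numerator is `O(k m)`, and `k m / N = O(k d / n)` is small compared with `√d`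
    have hk1 : (1 : ℝ) ≤ k := by exact_mod_cast (by omega : 1 ≤ k)
    have hdm : d ≤ m := by rw [hm]; nlinarith
    have hnm : (n : ℝ) ≤ m := by
      have := h.n_le_m
      exact_mod_cast (by omega : n ≤ m)
    have hnum : |(m : ℝ) * (1 - k) + (n - k) * (1 - k) + d * (k - 2)| ≤ 3 * (m * k) := by
      have p1 : 0 ≤ (m : ℝ) * (k - 1) := mul_nonneg hm0.le (by linarith)
      have p2 : 0 ≤ ((n : ℝ) - k) * (k - 1) := mul_nonneg (by linarith) (by linarith)
      have p3 : ((n : ℝ) - k) * (k - 1) ≤ m * k :=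
        mul_le_mul (by linarith) (by linarith) (by linarith) hm0.le
      have p4 : 0 ≤ d * (k - 1) := mul_nonneg hd.le (by linarith)
      have p5 : d * k ≤ m * k := mul_le_mul_of_nonneg_right hdm hk.le
      have p6 : (m : ℝ) ≤ m * k := le_mul_of_one_le_right hm0.le hk1
      have p7 : 0 ≤ d * k := by positivity
      rw [abs_le]
      constructor <;> linarith
    have hkw : 1000 * (√d * k) ≤ n := by
      have h1 := h.le_k'
      have h2 := h.ten_le_sqrt_log
      have h3 := h.k_small
      have h4 : √d ≤ k := by
        have : 1 * √d ≤ √(Real.log n) * √d := by gcongr; linarith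
        linarith
      have h5 : √d * k ≤ k * k := by gcongr
      linarith
    have hfrac : |((m : ℝ) * (1 - k) + (n - k) * (1 - k) + d * (k - 2)) / (N - k + 2)| ≤
        √d / 2 := by
      rw [abs_div, abs_of_pos hP0, div_le_iff₀ hP0]
      refine hnum.trans ?_
      have h3 : √d * √d = d := by rw [← sq]; exact h.sqrt_sq
      have h4 : (m : ℝ) * k = n / 2 * √d * (√d * k) := by
        rw [hm]
        linear_combination -(n : ℝ) / 2 * k * h3
      calc 3 * ((m : ℝ) * k) = 3 * (n / 2 * √d * (√d * k)) := by rw [h4]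
        _ ≤ 3 * (n / 2 * √d * (n / 1000)) := by gcongr; linarith
        _ = √d / 2 * (3 * n * n / 1000) := by ring
        _ ≤ √d / 2 * (N / 2) := by
            refine mul_le_mul_of_nonneg_left ?_ (by positivity)
            rw [hN]; nlinarith
        _ ≤ √d / 2 * (N - k + 2) := by gcongr
    have hw1 : 2 ≤ √d := by
      have := h.le_sqrt
      have := h.log_large
      linarith
    rw [abs_le] at hfrac ⊢
    constructor <;> linarith [hfrac.1, hfrac.2]

/-- Union bound: under the null law the maximum degree rarely reaches the threshold. -/
lemma mean_maxDeg_ceil_le (h : Regime α C n k m) :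
    mean n m ({G | ⌈threshold α n m⌉₊ ≤ maxDeg G}.indicator fun _ => 1) ≤
      128 * Real.exp (2 + (C + 1) ^ 2 / 2) *
        Real.exp (-((1 / 2 - 1 / (2 * α)) * Real.log (Real.log n))) := by
  obtain ⟨f1, f2, f3, f4, f5, f6, f7, f8⟩ := h.nat_facts
  obtain ⟨g1, g2, g3, g4⟩ := h.hyper_facts
  have hw8 : 8 ≤ √(avgDeg n m) := by linarith [h.C_small, h.C_nonneg]
  have hb := hyperPmf_le g1 g2 g3 hw8 h.sqrt_sq.symm g4
  have hTpos : 0 < ⌈threshold α n m⌉₊ := by have := h.k_le_ceil; omega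
  refine (mean_maxDeg_le hTpos f4).trans ?_
  have h1 := sum_Ico_degPmf_le f1 f2 f5 (by omega) h.m_le_choose h.k_le_ceil hb
  have h2 := h.le_hubRatio_ceil
  have h3 := h.ceil_le
  have hw := h.sqrt_pos
  have hk := h.k_pos
  have hn : (0 : ℝ) < n := by linarith [h.n_real]
  have hk2 : (k : ℝ) / 2 ≤ k - 1 := by
    have : (2 : ℝ) ≤ k := by exact_mod_cast f2
    linarith
  have hr := h.ten_le_sqrt_log
  set H := hubRatio n k m ⌈threshold α n m⌉₊ with hH
  set ℓ := Real.log (Real.log n) with hℓ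
  set b := 2 + (C + 1) ^ 2 / 2 with hb'
  set r := √(Real.log n) with hr'
  set w := √(avgDeg n m) with hw'
  have hHpos : 0 < H := lt_of_lt_of_le (by positivity) h2
  have hd : avgDeg n m = w * w := by rw [← sq]; exact h.sqrt_sq.symm
  have hr0 : 0 < r := by linarith
  have hexp : r = Real.exp (1 / 2 * ℓ) := by
    have hL : 0 < Real.log n := by linarith [h.log_large]
    rw [hr', Real.sqrt_eq_rpow, Real.rpow_def_of_pos hL, mul_comm]
  calc (n : ℝ) * ∑ i ∈ Finset.Ico ⌈threshold α n m⌉₊ n, degPmf n m i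
      ≤ n * (32 / w * (⌈threshold α n m⌉₊ / ((k - 1) * H))) := by gcongr
    _ ≤ n * (32 / w * (2 * (w * w) / (k / 2 * H))) := by
        rw [← hd]
        have := h.avgDeg_pos.le
        gcongr
    _ = 128 * (n * (w / k) / H) := by field_simp; ring
    _ ≤ 128 * (n * (1 / r) / (Real.exp (-b) * (n * Real.exp (-(1 / (2 * α) * ℓ))))) := by
        gcongr 128 * (n * ?_ / ?_)
        · rw [div_le_div_iff₀ hk hr0]
          have := h.le_k'
          linarith
    _ = 128 * Real.exp b * Real.exp (-((1 / 2 - 1 / (2 * α)) * ℓ)) := by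
        have e : -((1 / 2 - 1 / (2 * α)) * ℓ) = -(1 / 2 * ℓ) + 1 / (2 * α) * ℓ := by ring
        rw [e, Real.exp_add (-(1 / 2 * ℓ)), Real.exp_neg b, Real.exp_neg (1 / (2 * α) * ℓ),
          Real.exp_neg (1 / 2 * ℓ), ← hexp]
        field_simp

lemma diagonal_le (h : Regime α C n k m) :
    (∑ i ∈ Finset.range ⌈threshold α n m⌉₊, degPmf n m i * hubRatio n k m i ^ 2) / n ≤
      64 * Real.exp 3 * Real.exp (-(1 / 2 * Real.log (Real.log n))) := by
  obtain ⟨f1, f2, f3, f4, f5, f6, f7, f8⟩ := h.nat_facts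
  obtain ⟨g1, g2, g3, g4⟩ := h.hyper_facts
  have hw8 : 8 ≤ √(avgDeg n m) := by linarith [h.C_small, h.C_nonneg]
  have hb := hyperPmf_le g1 g2 g3 hw8 h.sqrt_sq.symm g4
  have h1 := sum_range_degPmf_mul_sq_le f1 (by omega) h.m_le_choose h.k_le_ceil hb
  have h2 := h.hubRatio_ceil_le
  have h3 := h.ceil_le
  have hw := h.sqrt_pos
  have hk := h.k_pos
  have hn : (0 : ℝ) < n := by linarith [h.n_real]
  have hr := h.ten_le_sqrt_log
  have hH0 := hubRatio_nonneg n k m ⌈threshold α n m⌉₊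
  have hα : 0 < 1 / (2 * α) := by have := h.one_lt; positivity
  have hℓ0 := h.loglog_nonneg
  set H := hubRatio n k m ⌈threshold α n m⌉₊ with hH
  set ℓ := Real.log (Real.log n) with hℓ
  set r := √(Real.log n) with hr'
  set w := √(avgDeg n m) with hw'
  have hd : avgDeg n m = w * w := by rw [← sq]; exact h.sqrt_sq.symm
  have hr0 : 0 < r := by linarith
  have hexp : r = Real.exp (1 / 2 * ℓ) := by
    have hL : 0 < Real.log n := by linarith [h.log_large]
    rw [hr', Real.sqrt_eq_rpow, Real.rpow_def_of_pos hL, mul_comm]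
  have h4 : H ≤ Real.exp 3 * n := by
    refine h2.trans ?_
    have : Real.exp (-(1 / (2 * α) * ℓ)) ≤ 1 := Real.exp_le_one_iff.2 (by
      have : 0 ≤ 1 / (2 * α) * ℓ := by positivity
      linarith)
    calc Real.exp 3 * (n * Real.exp (-(1 / (2 * α) * ℓ))) ≤ Real.exp 3 * (n * 1) := by gcongr
      _ = _ := by ring
  calc (∑ i ∈ Finset.range ⌈threshold α n m⌉₊, degPmf n m i * hubRatio n k m i ^ 2) / n
      ≤ 32 / w * (H * ⌈threshold α n m⌉₊ / (k + 1)) / n := by gcongr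
    _ ≤ 32 / w * (Real.exp 3 * n * (2 * (w * w)) / k) / n := by
        rw [← hd]
        have hd0 := h.avgDeg_pos.le
        have hk1 : (k : ℝ) ≤ k + 1 := by linarith
        gcongr
    _ = 64 * Real.exp 3 * (w / k) := by field_simp; ring
    _ ≤ 64 * Real.exp 3 * (1 / r) := by
        gcongr 64 * Real.exp 3 * ?_
        rw [div_le_div_iff₀ hk hr0]
        have := h.le_k'
        linarith
    _ = _ := by rw [Real.exp_neg, ← hexp, one_div]

/-- The correlation between two degrees contributes at most `1 / log n`. -/
lemma pair_factor_le (h : Regime α C n k m) :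
    ∀ i < ⌈threshold α n m⌉₊, ∀ j < ⌈threshold α n m⌉₊,
      degPairPmf n m i j ≤ (1 + 1 / Real.log n) * (degPmf n m i * degPmf n m j) := by
  obtain ⟨f1, f2, f3, f4, f5, f6, f7, f8⟩ := h.nat_facts
  have hn := h.n_real
  have hm := h.m_eq
  have hmN := h.m_le
  have hN := cast_choose_two n
  have hT := h.ceil_le
  have hd := h.avgDeg_pos
  have hdL := h.avgDeg_mul_log_le
  have hL := h.log_large
  have hd1000 := h.avgDeg_large
  have hm0 : (0 : ℝ) ≤ m := Nat.cast_nonneg _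
  have hn0 : (0 : ℝ) < n := by linarith
  have hn1 : (0 : ℝ) < n - 1 := by linarith
  intro i hi j hj
  have hβ1 : (n : ℝ) ≤ 8 / n * ((n.choose 2 : ℝ) - 2 * n - m) := by
    rw [div_mul_eq_mul_div, le_div_iff₀ hn0]
    have h1 : (n : ℝ) * n / 4 ≤ n.choose 2 := by
      rw [hN]; linarith [mul_nonneg hn0.le (show (0 : ℝ) ≤ n - 2 by linarith)]
    linarith [mul_nonneg hn0.le hn0.le]
  have hp := degPairPmf_le f1 f6 f8 (β := 8 / n) (by positivity) hβ1 i hi j hj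
  refine hp.trans (mul_le_mul_of_nonneg_right ?_
    (mul_nonneg (degPmf_nonneg ..) (degPmf_nonneg ..)))
  set T : ℝ := (⌈threshold α n m⌉₊ : ℝ) with hT'
  set d := avgDeg n m with hd'
  set N : ℝ := (n.choose 2 : ℝ) with hN'
  have hT0 : 0 ≤ T := Nat.cast_nonneg _
  clear_value N T
  set u := d / n with hu
  have hu0 : 0 < u := by positivity
  have huL : u * Real.log n ≤ 1 / 1000 := by
    rw [hu, div_mul_eq_mul_div, div_le_iff₀ hn0]; linarith
  have hdn : 100 * d ≤ d * n := by linarith [mul_le_mul_of_nonneg_left hn hd.le]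
  have e1 : (1 + 8 / (n : ℝ)) ^ (2 * ⌈threshold α n m⌉₊) ≤ Real.exp (32 * u) := by
    calc (1 + 8 / (n : ℝ)) ^ (2 * ⌈threshold α n m⌉₊)
        ≤ Real.exp (8 / n) ^ (2 * ⌈threshold α n m⌉₊) := by
          gcongr
          linarith [Real.add_one_le_exp (8 / (n : ℝ))]
      _ = Real.exp (2 * T * (8 / n)) := by rw [← Real.exp_nat_mul, hT']; push_cast; rfl
      _ ≤ Real.exp (32 * u) := by
          rw [Real.exp_le_exp, hu]
          calc 2 * T * (8 / n) ≤ 2 * (2 * d) * (8 / n) := by gcongr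
            _ = 32 * (d / n) := by ring
  have hN0 : 0 < N := by rw [hN]; positivity
  have e2 : N / (N - n - m) ≤ Real.exp (12 * u) := by
    have hx : N / (N - n - m) = (1 - (n + m) / N)⁻¹ := by
      rw [one_sub_div hN0.ne', inv_div]; congr 1; ring
    rw [hx]
    refine (inv_one_sub_le_exp (by positivity) ?_).trans ?_
    · rw [div_le_iff₀ hN0]; linarith
    · rw [Real.exp_le_exp, mul_div_assoc', div_le_iff₀ hN0, hu, hN, hm]
      have : 12 * (d / n) * (n * (n - 1) / 2) = 6 * d * (n - 1) := by field_simp; ring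
      rw [this]
      have h7 : 1000 * (n : ℝ) ≤ d * n := mul_le_mul_of_nonneg_right (by linarith) hn0.le
      linarith [hdn]
  have hm4 : m / 2 ≤ m - 2 * T + 1 := by
    have : 4 * d ≤ m / 2 := by rw [hm]; linarith [hdn]
    linarith
  have e3 : 1 + T ^ 2 * N / ((n - 1) ^ 2 * (m - 2 * T + 1)) ≤ Real.exp (16 * u) := by
    have h1 : T ^ 2 * N / ((n - 1) ^ 2 * (m - 2 * T + 1)) ≤ 16 * u := by
      have hmpos : (0 : ℝ) < m := by rw [hm]; positivity
      calc T ^ 2 * N / ((n - 1) ^ 2 * (m - 2 * T + 1))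
          ≤ (2 * d) ^ 2 * (n - 1) ^ 2 / ((n - 1) ^ 2 * (m / 2)) := by
            have q1 : T ^ 2 ≤ (2 * d) ^ 2 := pow_le_pow_left₀ hT0 hT 2
            have q2 : N ≤ (n - 1) ^ 2 := by
              rw [hN]; linarith [mul_nonneg hn1.le (show (0 : ℝ) ≤ n - 2 by linarith)]
            have q3 : ((n : ℝ) - 1) ^ 2 * (m / 2) ≤ (n - 1) ^ 2 * (m - 2 * T + 1) :=
              mul_le_mul_of_nonneg_left hm4 (sq_nonneg _)
            exact div_le_div₀ (by positivity) (mul_le_mul q1 q2 hN0.le (sq_nonneg _))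
              (by positivity) q3
        _ = 8 * d ^ 2 / m := by field_simp; ring
        _ = 16 * u := by rw [hm, hu]; field_simp; ring
    linarith [Real.add_one_le_exp (16 * u)]
  have hNm : 0 < N - n - m := by linarith
  have hmT : 0 ≤ (m : ℝ) - 2 * T + 1 := by linarith
  have hη : 0 ≤ 1 + T ^ 2 * N / (((n : ℝ) - 1) ^ 2 * (m - 2 * T + 1)) := by positivity
  calc (1 + 8 / (n : ℝ)) ^ (2 * ⌈threshold α n m⌉₊) * (N / (N - n - m)) *
        (1 + T ^ 2 * N / ((n - 1) ^ 2 * (m - 2 * T + 1)))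
      ≤ Real.exp (32 * u) * Real.exp (12 * u) * Real.exp (16 * u) := by gcongr
    _ = Real.exp (60 * u) := by rw [← Real.exp_add, ← Real.exp_add]; congr 1; ring
    _ ≤ 1 + 2 * (60 * u) := by
        have hu1 : 60 * u ≤ 1 := by linarith [mul_le_mul_of_nonneg_left hL hu0.le]
        have := (abs_le.1 (Real.abs_exp_sub_one_sub_id_le (x := 60 * u)
          (by rw [abs_of_pos (by positivity)]; exact hu1))).2
        have hu2 : 60 * u * (60 * u) ≤ 60 * u * 1 :=
          mul_le_mul_of_nonneg_left hu1 (by positivity)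
        linarith
    _ ≤ 1 + 1 / Real.log n := by
        have : 120 * u ≤ 1 / Real.log n := by
          rw [le_div_iff₀ (by linarith)]; linarith
        linarith

lemma truncVar_ceil_le (h : Regime α C n k m) (hmean : truncMean n k m ⌈threshold α n m⌉₊ ≤ 1) :
    truncVar n k m ⌈threshold α n m⌉₊ ≤ 1 / Real.log n +
      64 * Real.exp 3 * Real.exp (-(1 / 2 * Real.log (Real.log n))) := by
  obtain ⟨f1, f2, f3, f4, f5, f6, f7, f8⟩ := h.nat_facts
  have hL : 0 < 1 / Real.log n := by have := h.log_large; positivity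
  have h1 := truncVar_le (n := n) (k := k) (by omega) f4 h.ceil_le_n f6 hL.le h.pair_factor_le
  have h2 := h.diagonal_le
  have h3 := truncMean_nonneg n k m ⌈threshold α n m⌉₊
  have h4 : 1 / Real.log n * truncMean n k m ⌈threshold α n m⌉₊ ^ 2 ≤ 1 / Real.log n * 1 := by
    gcongr
    exact pow_le_one₀ h3 hmean
  linarith

end Regime

/-- The mean of the truncated ratio, which is the probability that the hub degree stays below the
threshold, is bounded away from `1`. -/
lemma exists_truncMean_le (C : ℝ) (hC : 0 ≤ C) :
    ∃ δ w₀ : ℝ, 0 < δ ∧ ∀ (α : ℝ) (n k m : ℕ), Regime α C n k m → w₀ ≤ √(avgDeg n m) →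
      truncMean n k m ⌈threshold α n m⌉₊ ≤ 1 - δ := by
  obtain ⟨δ, w₀, hδ, H⟩ := exists_le_sum_hyperPmf (C + 2) (by linarith)
  refine ⟨δ, w₀, hδ, fun α n k m h hw => ?_⟩
  obtain ⟨f1, f2, f3, f4, f5, f6, f7, f8⟩ := h.nat_facts
  obtain ⟨g1, g2, g3, g4⟩ := h.hyper_facts
  exact truncMean_le f1 (by omega) f4 h.m_le_choose f7 h.k_le_ceil h.ceil_le_n
    (H _ _ _ _ _ g1 g2 g3 hw h.sqrt_sq.symm g4 _ h.ceil_sub_le)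

/-! ### Passage to the limit -/

lemma tendsto_log_natCast : Tendsto (fun n : ℕ => Real.log n) atTop atTop :=
  Real.tendsto_log_atTop.comp tendsto_natCast_atTop_atTop

lemma eventually_regime {γ α : ℝ} (hα : 1 < α) {k m : ℕ → ℕ}
    (hk_lower : (fun n : ℕ => Real.log n ^ 2) =o[atTop] fun n => (k n : ℝ))
    (hk_upper : (fun n : ℕ => (k n : ℝ)) =o[atTop] fun n => √(n : ℝ))
    (hm : ∀ᶠ n : ℕ in atTop,
      |(m n : ℝ) - (k n : ℝ) ^ 2 * n / (4 * Real.log n) * (1 + γ / √(Real.log n))| ≤ 1) :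
    ∀ᶠ n in atTop, Regime α (4 * |γ| + 1) n (k n) (m n) := by
  have hlog := tendsto_log_natCast
  have hll : ∀ᶠ n : ℕ in atTop, Real.log (Real.log n) ≤ √(Real.log n) / 2 := by
    have h1 := (isLittleO_log_rpow_atTop (show (0 : ℝ) < 1 / 2 by norm_num)).def
      (show (0 : ℝ) < 1 / 2 by norm_num)
    filter_upwards [hlog.eventually h1] with n hn
    rw [← Real.sqrt_eq_rpow, Real.norm_eq_abs, Real.norm_eq_abs,
      abs_of_nonneg (Real.sqrt_nonneg _)] at hn
    linarith [le_abs_self (Real.log (Real.log n))]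
  have hsmall : ∀ᶠ n : ℕ in atTop, 4 * Real.log n ≤ n := by
    have h1 := Real.isLittleO_log_id_atTop.def (show (0 : ℝ) < 1 / 4 by norm_num)
    filter_upwards [tendsto_natCast_atTop_atTop.eventually h1] with n hn
    simp only [Real.norm_eq_abs, id, Nat.abs_cast] at hn
    linarith [le_abs_self (Real.log n)]
  filter_upwards [hk_lower.def (show (0 : ℝ) < 1 / 1000 by norm_num),
    hk_upper.def (show (0 : ℝ) < 1 / 40 by norm_num), hm, hll, hsmall, eventually_ge_atTop 100,
    hlog.eventually_ge_atTop 100, hlog.eventually_ge_atTop (16 * γ ^ 2),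
    hlog.eventually_ge_atTop (4 * |γ| + 1 + 10)] with n h1 h2 h3 h4 h5 h6 h7 h8 h9
  have hn : (100 : ℝ) ≤ n := by exact_mod_cast h6
  have hn0 : (0 : ℝ) < n := by linarith
  set L := Real.log n with hL
  set K : ℝ := (k n : ℝ) with hK
  have hK0 : 0 ≤ K := Nat.cast_nonneg _
  have hL0 : 0 < L := by linarith
  rw [Real.norm_of_nonneg (by positivity), Real.norm_of_nonneg hK0] at h1
  rw [Real.norm_of_nonneg hK0, Real.norm_of_nonneg (by positivity)] at h2
  have hk_large : 1000 * L ^ 2 ≤ K := by linarith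
  have hK1 : 1 ≤ K := by nlinarith
  have hr0 : 0 < √L := Real.sqrt_pos.2 hL0
  have hr2 : √L * √L = L := Real.mul_self_sqrt hL0.le
  set d := avgDeg n (m n) with hd
  -- the definition of `m`, multiplied by `4 L / n`
  have key : |2 * L * d - K ^ 2 * (1 + γ / √L)| ≤ 1 := by
    have e : 2 * L * d - K ^ 2 * (1 + γ / √L) =
        4 * L / n * ((m n : ℝ) - K ^ 2 * n / (4 * L) * (1 + γ / √L)) := by
      rw [hd, avgDeg]
      field_simp
      ring
    rw [e, abs_mul, abs_of_pos (by positivity)]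
    have : 4 * L / n ≤ 1 := by rw [div_le_one hn0]; exact h5
    calc 4 * L / n * |(m n : ℝ) - K ^ 2 * n / (4 * L) * (1 + γ / √L)| ≤ 1 * 1 := by gcongr
      _ = 1 := one_mul 1
  have hγ : |γ| / √L ≤ 1 / 4 := by
    rw [div_le_iff₀ hr0]
    have : 4 * |γ| ≤ √L := Real.le_sqrt_of_sq_le (by rw [mul_pow, sq_abs]; linarith)
    linarith
  have key2 : |K ^ 2 - 2 * L * d| ≤ K ^ 2 * (|γ| / √L) + 1 := by
    have e : K ^ 2 - 2 * L * d = -(2 * L * d - K ^ 2 * (1 + γ / √L)) + -(K ^ 2 * (γ / √L)) := by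
      ring
    rw [e]
    refine (abs_add_le _ _).trans ?_
    rw [abs_neg, abs_neg, abs_mul, abs_div, abs_of_pos hr0, abs_of_nonneg (sq_nonneg K)]
    linarith
  have hK2 : 8 ≤ K ^ 2 := by nlinarith
  have key3 : K ^ 2 * (|γ| / √L) ≤ K ^ 2 * (1 / 4) := by gcongr
  obtain ⟨b1, b2⟩ := abs_le.1 key2
  have hlow : K ^ 2 ≤ 4 * L * d := by linarith
  have hd1 : L ^ 2 ≤ d := by
    have : (1000 * L ^ 2) * (1000 * L ^ 2) ≤ K * K := by gcongr
    have h10 : L * L ^ 2 ≤ L * d := by nlinarith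
    exact le_of_mul_le_mul_left h10 hL0
  have hd0 : 0 < d := lt_of_lt_of_le (by positivity) hd1
  refine ⟨hα, by positivity, h6, h7, hlow, by linarith, ?_, hk_large, ?_, h4, ?_⟩
  · refine key2.trans ?_
    have e1 : K ^ 2 * (|γ| / √L) ≤ 4 * L * d * (|γ| / √L) := by gcongr
    have e2 : 4 * L * d * (|γ| / √L) = 4 * |γ| * √L * d := by
      calc 4 * L * d * (|γ| / √L) = 4 * (√L * √L) * d * (|γ| / √L) := by rw [hr2]
        _ = _ := by field_simp
    have e3 : 1 ≤ √L * d := by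
      have : 10 ≤ √L := Real.le_sqrt_of_sq_le (by linarith)
      nlinarith
    linarith
  · have h10 : K ^ 2 ≤ (1 / 40 * √(n : ℝ)) ^ 2 := by gcongr
    rw [mul_pow, Real.sq_sqrt hn0.le] at h10
    linarith
  · exact h9.trans (Real.le_sqrt_of_sq_le hd1)

/-- In the critical regime both disagreement probabilities are eventually below any `ε`. -/
lemma exists_bound (α C : ℝ) (hα : 1 < α) (hC : 0 ≤ C) :
    ∃ b : ℕ → ℝ, Tendsto b atTop (𝓝 0) ∧ ∀ᶠ n in atTop, ∀ k m : ℕ, Regime α C n k m →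
      (nullDist n m).real (symmDiff (lrRegion n k m) (maxDegRegion α n m)) ≤ b n ∧
      (plantedDist n k m).real (symmDiff (lrRegion n k m) (maxDegRegion α n m)) ≤ b n := by
  obtain ⟨δ, w₀, hδ, H⟩ := exists_truncMean_le C hC
  have hlog := tendsto_log_natCast
  have hloglog := Real.tendsto_log_atTop.comp hlog
  have hexp : ∀ c : ℝ, 0 < c →
      Tendsto (fun n : ℕ => Real.exp (-(c * Real.log (Real.log n)))) atTop (𝓝 0) := fun c hc =>
    Real.tendsto_exp_neg_atTop_nhds_zero.comp (hloglog.const_mul_atTop hc)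
  have hc : 0 < 1 / 2 - 1 / (2 * α) := by
    rw [sub_pos]
    exact one_div_lt_one_div_of_lt two_pos (by linarith)
  refine ⟨fun n => 128 * Real.exp (2 + (C + 1) ^ 2 / 2) *
      Real.exp (-((1 / 2 - 1 / (2 * α)) * Real.log (Real.log n))) +
      (1 / Real.log n + 64 * Real.exp 3 * Real.exp (-(1 / 2 * Real.log (Real.log n)))) / δ ^ 2,
    ?_, ?_⟩
  · have h1 := (hexp _ hc).const_mul (128 * Real.exp (2 + (C + 1) ^ 2 / 2))
    have h2 : Tendsto (fun n : ℕ => 1 / Real.log n) atTop (𝓝 0) := by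
      simp only [one_div]
      exact hlog.inv_tendsto_atTop
    have h3 := (h2.add ((hexp (1 / 2) one_half_pos).const_mul (64 * Real.exp 3))).div_const (δ ^ 2)
    simpa using h1.add h3
  · filter_upwards [hlog.eventually_ge_atTop w₀] with n hn k m h
    have hw : w₀ ≤ √(avgDeg n m) := by
      have := h.le_sqrt
      have := h.log_large
      linarith
    have hmean := H α n k m h hw
    obtain ⟨f1, f2, f3, f4, f5, f6, f7, f8⟩ := h.nat_facts
    have hvar := h.truncVar_ceil_le (by linarith)
    have hA := h.mean_maxDeg_ceil_le
    have hlt : truncMean n k m ⌈threshold α n m⌉₊ < 1 := by linarith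
    have hV : truncVar n k m ⌈threshold α n m⌉₊ /
        (1 - truncMean n k m ⌈threshold α n m⌉₊) ^ 2 ≤
        (1 / Real.log n + 64 * Real.exp 3 * Real.exp (-(1 / 2 * Real.log (Real.log n)))) /
          δ ^ 2 := by
      have hL : 0 < Real.log n := by linarith [h.log_large]
      refine div_le_div₀ (by positivity) hvar (by positivity) ?_
      gcongr
      linarith
    rw [maxDegRegion_eq]
    have h1 := nullDist_symmDiff_le f5 h.m_le_choose (by omega) hlt
    have h2 := plantedDist_symmDiff_le f5 h.m_le_choose (by omega) hlt
    constructor <;> linarith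

end PlantedStar

theorem theorem2 (γ α : ℝ) (hα : 1 < α) (k m : ℕ → ℕ)
    (hk_lower : (fun n : ℕ => Real.log n ^ 2) =o[atTop] fun n => (k n : ℝ))
    (hk_upper : (fun n : ℕ => (k n : ℝ)) =o[atTop] fun n => √(n : ℝ))
    (hm : ∀ᶠ n : ℕ in atTop,
      |(m n : ℝ) - (k n : ℝ) ^ 2 * n / (4 * Real.log n) * (1 + γ / √(Real.log n))| ≤ 1) :
    -- the two tests agree with high probability under the null distribution
    Tendsto (fun n : ℕ => (PlantedStar.nullDist n (m n)).real
        (symmDiff (PlantedStar.lrRegion n (k n) (m n)) (PlantedStar.maxDegRegion α n (m n))))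
      atTop (𝓝 0) ∧
    -- and under the planted distribution
    Tendsto (fun n : ℕ => (PlantedStar.plantedDist n (k n) (m n)).real
        (symmDiff (PlantedStar.lrRegion n (k n) (m n)) (PlantedStar.maxDegRegion α n (m n))))
      atTop (𝓝 0) ∧
    -- the maximum-degree test asymptotically minimizes the sum of the two errors over all tests
    (∀ ε : ℝ, 0 < ε → ∀ᶠ n : ℕ in atTop, ∀ R : Set (SimpleGraph (Fin n)),
      PlantedStar.testError n (k n) (m n) (PlantedStar.maxDegRegion α n (m n)) ≤
        PlantedStar.testError n (k n) (m n) R + ε) ∧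
    -- and one program performs every maximum-degree threshold test in quadratic time
    (∃ (p : PlantedStar.Program) (C : ℕ), ∀ (n : ℕ) (G : SimpleGraph (Fin n)) (t : ℝ),
      (PlantedStar.Accepts p G ⌈t⌉₊ ↔ t ≤ (PlantedStar.maxDeg G : ℝ)) ∧
        PlantedStar.steps p G ⌈t⌉₊ ≤ C * (n + 1) ^ 2) := by
  have hreg := PlantedStar.eventually_regime hα hk_lower hk_upper hm
  obtain ⟨b, hb, hbound⟩ := PlantedStar.exists_bound α (4 * |γ| + 1) hα (by positivity)
  have hev : ∀ᶠ n in atTop,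
      (PlantedStar.nullDist n (m n)).real (symmDiff (PlantedStar.lrRegion n (k n) (m n))
        (PlantedStar.maxDegRegion α n (m n))) ≤ b n ∧
      (PlantedStar.plantedDist n (k n) (m n)).real (symmDiff (PlantedStar.lrRegion n (k n) (m n))
        (PlantedStar.maxDegRegion α n (m n))) ≤ b n := by
    filter_upwards [hreg, hbound] with n h1 h2 using h2 _ _ h1
  refine ⟨?_, ?_, fun ε hε => ?_, PlantedStar.exists_maxDeg_program⟩
  · exact squeeze_zero' (Eventually.of_forall fun n => measureReal_nonneg)
      (hev.mono fun n h => h.1) hb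
  · exact squeeze_zero' (Eventually.of_forall fun n => measureReal_nonneg)
      (hev.mono fun n h => h.2) hb
  · filter_upwards [hreg, hev, hb.eventually_lt_const (half_pos hε)] with n h h1 h2 R
    obtain ⟨-, -, f3, -, f5, -⟩ := h.nat_facts
    have := PlantedStar.testError_le f5 h.m_le_choose (by omega)
      (PlantedStar.maxDegRegion α n (m n)) R
    linarith [h1.1, h1.2]
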